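/- Theorem (of Bishop's constructive mathematics: intuitionistic logic with dependent choice). Let $X$ be a separable Banach space, let $Y$ be a Banach space, and let $T$ be a sequentially continuous linear mapping of $X$ onto $Y$ that is nonzero, in the sense that $\|Tx\|>0$ for some $x\in X$. Suppose that $\ker T$ is located in $X$, that is, that the infimum $$\rho(x,\ker T)=\inf\{\|x-z\| : z\in X,\ Tz=0\}$$ exists for each $x\in X$, and that for some real number $r>0$ the infimum $$\delta_r=\inf\{\|Tx\| : x\in X,\ \rho(x,\ker T)\ge r\}$$ exists. (A real number $d$ is the infimum of a set $S$ of real numbers if $d\le s$ for all $s\in S$, and for each $e>d$ there is $s\in S$ with $s<e$.) Then $T$ is uniformly Z-stable on $X$: for each $\varepsilon>0$ there exists $\delta>0$ such that for all $x\in X$ with $\|Tx\|<\delta$ there is $z\in X$ with $Tz=0$ and $\|x-z\|<\varepsilon$. Being a theorem of constructive mathematics, the result is a claim of constructive provability, in the following precise sense. Consider intuitionistic arithmetic in all finite types over the sets $\mathbb N$, $\mathbb Q$, $\mathbb R$ and two arbitrary sets $X$, $Y$, with product types, extensional function types, the combinators $K$ and $S$, primitive recursion in all types, full induction and the scheme of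 relativized dependent choice; here $\mathbb Q$ is the field of fractions $(k-l)/(m+1)$ with $k,l,m\in\mathbb N$, and $\mathbb R$ is the set of regular sequences of rationals ($|x_m-x_n|\le \frac1{m+1}+\frac1{n+1}$ for all $m,n$), two of them being equal if $|x_n-y_n|\le\frac2{n+1}$ for all $n$. Let $X$ and $Y$ be equipped with arbitrary operations $0,+,-$, multiplication by real numbers and $\|\cdot\|$, and let $T$ be an arbitrary function from $X$ to $Y$. Then the conclusion "$T$ is uniformly Z-stable on $X$" is derivable, by intuitionistic natural deduction in this system, from the hypotheses above: $X$ and $Y$ are real Banach spaces, $X$ is separable (it has a dense sequence), $T$ is linear, nonzero, sequentially continuous and onto, $\ker T$ is located, and $\delta_r$ exists for some $r>0$. -/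

import Mathlib

/-! # A formal system for Bishop-style constructive mathematics

Intuitionistic arithmetic in all finite types, with extensional functions and relativized
dependent choice, over the sets `ℕ`, `ℚ`, `ℝ` and two arbitrary sets `X` and `Y` that carry the
operations of normed spaces, together with an arbitrary function `T : X → Y`.
Provability is derivability by the rules of intuitionistic natural deduction: excluded middle,
Markov's principle and the like are not available.

Every sort comes with its own equality, which all functions respect. Variables are typed
de Bruijn indices; a context is the list of the types of the free variables. -/

namespace BISH

/-- Names of the two spaces. -/
inductive Sp
  | X
  | Y

/-- Finite types over `ℕ`, `ℚ`, `ℝ` and the two spaces. -/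
inductive Ty
  | nat
  | rat
  | real
  | sp (i : Sp)
  | prod (a b : Ty)
  | fn (a b : Ty)

abbrev Ctx := List Ty

/-- Variables of type `a` in a context. -/
inductive Var : Ctx → Ty → Type
  | z {Γ : Ctx} {a : Ty} : Var (a :: Γ) a
  | s {Γ : Ctx} {a b : Ty} (v : Var Γ a) : Var (b :: Γ) a

/-- The constants. The last six (the operations of the spaces and the map `T`) are subject to
no axiom of the system, so that whatever is derivable holds for arbitrary such data. -/
inductive Const : Ty → Type
  | K (a b : Ty) : Const (a.fn (b.fn a))
  | S (a b c : Ty) : Const ((a.fn (b.fn c)).fn ((a.fn b).fn (a.fn c)))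
  | pair (a b : Ty) : Const (a.fn (b.fn (a.prod b)))
  | fst (a b : Ty) : Const ((a.prod b).fn a)
  | snd (a b : Ty) : Const ((a.prod b).fn b)
  | zero : Const Ty.nat
  | succ : Const (Ty.nat.fn Ty.nat)
  | recN (a : Ty) : Const (a.fn ((Ty.nat.fn (a.fn a)).fn (Ty.nat.fn a)))
  | natQ : Const (Ty.nat.fn Ty.rat)
  | addQ : Const (Ty.rat.fn (Ty.rat.fn Ty.rat))
  | negQ : Const (Ty.rat.fn Ty.rat)
  | mulQ : Const (Ty.rat.fn (Ty.rat.fn Ty.rat))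
  | invQ : Const (Ty.rat.fn Ty.rat)
  | lim : Const ((Ty.nat.fn Ty.rat).fn Ty.real)
  | addR : Const (Ty.real.fn (Ty.real.fn Ty.real))
  | mulR : Const (Ty.real.fn (Ty.real.fn Ty.real))
  | vzero (i : Sp) : Const (Ty.sp i)
  | vadd (i : Sp) : Const ((Ty.sp i).fn ((Ty.sp i).fn (Ty.sp i)))
  | vneg (i : Sp) : Const ((Ty.sp i).fn (Ty.sp i))
  | vsmul (i : Sp) : Const (Ty.real.fn ((Ty.sp i).fn (Ty.sp i)))
  | norm (i : Sp) : Const ((Ty.sp i).fn Ty.real)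
  | op : Const ((Ty.sp Sp.X).fn (Ty.sp Sp.Y))

/-- Terms of type `a` in a context. -/
inductive Tm (Γ : Ctx) : Ty → Type
  | var {a : Ty} (v : Var Γ a) : Tm Γ a
  | const {a : Ty} (c : Const a) : Tm Γ a
  | app {a b : Ty} (f : Tm Γ (a.fn b)) (x : Tm Γ a) : Tm Γ b

/-- Formulas in a context. -/
inductive Fm : Ctx → Type
  | eq {Γ : Ctx} (a : Ty) (s t : Tm Γ a) : Fm Γ
  | bot {Γ : Ctx} : Fm Γ
  | and {Γ : Ctx} (φ ψ : Fm Γ) : Fm Γ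
  | or {Γ : Ctx} (φ ψ : Fm Γ) : Fm Γ
  | imp {Γ : Ctx} (φ ψ : Fm Γ) : Fm Γ
  | all {Γ : Ctx} (a : Ty) (φ : Fm (a :: Γ)) : Fm Γ
  | ex {Γ : Ctx} (a : Ty) (φ : Fm (a :: Γ)) : Fm Γ

infixr:35 " ⩓ " => Fm.and
infixr:30 " ⩔ " => Fm.or
infixr:25 " ⇒ " => Fm.imp

/-! ## Substitution -/

/-- Simultaneous substitution of terms over `Δ` for the variables of `Γ`. -/
abbrev Sub (Γ Δ : Ctx) := ∀ a : Ty, Var Γ a → Tm Δ a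

def Tm.subst {Γ Δ : Ctx} (σ : Sub Γ Δ) : ∀ {a : Ty}, Tm Γ a → Tm Δ a
  | _, .var v => σ _ v
  | _, .const c => .const c
  | _, .app f x => .app (f.subst σ) (x.subst σ)

/-- Weakening by one variable. -/
def Tm.wk {Γ : Ctx} {a : Ty} (b : Ty) (t : Tm Γ a) : Tm (b :: Γ) a :=
  t.subst fun _ v => .var (.s v)

/-- The substitution `σ` under a binder. -/
def Sub.lift {Γ Δ : Ctx} (σ : Sub Γ Δ) (b : Ty) : Sub (b :: Γ) (b :: Δ)
  | _, .z => .var .z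
  | _, .s v => (σ _ v).wk b

/-- The substitution that sends the first variable to `t` and every other one according to `σ`. -/
def Sub.cons {Γ Δ : Ctx} {b : Ty} (t : Tm Δ b) (σ : Sub Γ Δ) : Sub (b :: Γ) Δ
  | _, .z => t
  | _, .s v => σ _ v

def Sub.id (Γ : Ctx) : Sub Γ Γ := fun _ v => .var v

def Fm.subst : ∀ {Γ Δ : Ctx}, Sub Γ Δ → Fm Γ → Fm Δ
  | _, _, σ, .eq a s t => .eq a (s.subst σ) (t.subst σ)
  | _, _, _, .bot => .bot
  | _, _, σ, .and φ ψ => .and (φ.subst σ) (ψ.subst σ)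
  | _, _, σ, .or φ ψ => .or (φ.subst σ) (ψ.subst σ)
  | _, _, σ, .imp φ ψ => .imp (φ.subst σ) (ψ.subst σ)
  | _, _, σ, .all a φ => .all a (φ.subst (σ.lift a))
  | _, _, σ, .ex a φ => .ex a (φ.subst (σ.lift a))

def Fm.wk {Γ : Ctx} (b : Ty) (φ : Fm Γ) : Fm (b :: Γ) :=
  φ.subst fun _ v => .var (.s v)

/-- `φ[t]`: the term `t` for the first variable of `φ`. -/
def Fm.inst {Γ : Ctx} {a : Ty} (φ : Fm (a :: Γ)) (t : Tm Γ a) : Fm Γ :=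
  φ.subst (Sub.cons t (Sub.id Γ))

/-! ## Binders with named variables

A term is silently weakened when it is used under further binders. -/

instance {Γ : Ctx} {a b : Ty} : Coe (Tm Γ a) (Tm (b :: Γ) a) := ⟨Tm.wk b⟩

/-- `∀ x : a, φ x`. -/
def All {Γ : Ctx} (a : Ty) (φ : Tm (a :: Γ) a → Fm (a :: Γ)) : Fm Γ := .all a (φ (.var .z))

/-- `∃ x : a, φ x`. -/
def Ex {Γ : Ctx} (a : Ty) (φ : Tm (a :: Γ) a → Fm (a :: Γ)) : Fm Γ := .ex a (φ (.var .z))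

def iff {Γ : Ctx} (φ ψ : Fm Γ) : Fm Γ := (φ ⇒ ψ) ⩓ (ψ ⇒ φ)

/-! ## Natural numbers -/

section
variable {Γ : Ctx}

/-- Application of a function of type `a → b`. -/
def ap (a b : Ty) (f : Tm Γ (a.fn b)) (x : Tm Γ a) : Tm Γ b := .app f x

def zeroN : Tm Γ .nat := .const .zero
def succ (n : Tm Γ .nat) : Tm Γ .nat := .app (.const .succ) n
def recN (a : Ty) (x : Tm Γ a) (f : Tm Γ (Ty.nat.fn (a.fn a))) (n : Tm Γ .nat) : Tm Γ a :=
  .app (.app (.app (.const (.recN a)) x) f) n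

/-- `m + n`, by recursion on `n`. -/
def addN (m n : Tm Γ .nat) : Tm Γ .nat :=
  recN .nat m (.app (.const (.K (Ty.nat.fn .nat) .nat)) (.const .succ)) n

def leN (m n : Tm Γ .nat) : Fm Γ := Ex .nat fun k => .eq .nat (addN m k) n

/-! ## Rational numbers -/

def natQ (n : Tm Γ .nat) : Tm Γ .rat := .app (.const .natQ) n
def zeroQ : Tm Γ .rat := natQ zeroN
def oneQ : Tm Γ .rat := natQ (succ zeroN)
def addQ (p q : Tm Γ .rat) : Tm Γ .rat := .app (.app (.const .addQ) p) q
def negQ (p : Tm Γ .rat) : Tm Γ .rat := .app (.const .negQ) p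
def subQ (p q : Tm Γ .rat) : Tm Γ .rat := addQ p (negQ q)
def mulQ (p q : Tm Γ .rat) : Tm Γ .rat := .app (.app (.const .mulQ) p) q
def invQ (p : Tm Γ .rat) : Tm Γ .rat := .app (.const .invQ) p

/-- `1 / (n + 1)`. -/
def rcp (n : Tm Γ .nat) : Tm Γ .rat := invQ (natQ (succ n))

/-- `p ≤ q`: the difference `q - p` is a fraction `k / (l + 1)`. -/
def leQ (p q : Tm Γ .rat) : Fm Γ :=
  Ex .nat fun k => Ex .nat fun l => .eq .rat (addQ p (mulQ (natQ k) (rcp l))) q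

/-- `p < q`: the difference `q - p` is a fraction `(k + 1) / (l + 1)`. -/
def ltQ (p q : Tm Γ .rat) : Fm Γ :=
  Ex .nat fun k => Ex .nat fun l => .eq .rat (addQ p (mulQ (natQ (succ k)) (rcp l))) q

/-- `|p - q| ≤ e`. -/
def nearQ (p q e : Tm Γ .rat) : Fm Γ := leQ (subQ p q) e ⩓ leQ (subQ q p) e

/-! ## Real numbers

A real number is given by a regular sequence of rationals; `lim` is the canonical map from
regular sequences onto the set `ℝ`. (Its values at other sequences play no role.) -/

/-- Sequences in `a`. -/
abbrev seq (a : Ty) : Ty := Ty.nat.fn a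

/-- The `n`-th term of a sequence. -/
def nth (a : Ty) (u : Tm Γ (seq a)) (n : Tm Γ .nat) : Tm Γ a := .app u n

/-- `|x m - x n| ≤ 1 / (m + 1) + 1 / (n + 1)` for all `m`, `n`. -/
def Reg (x : Tm Γ (seq .rat)) : Fm Γ :=
  All .nat fun m => All .nat fun n =>
    nearQ (nth .rat x m) (nth .rat x n) (addQ (rcp m) (rcp n))

/-- The real number represented by a regular sequence. -/
def lim (x : Tm Γ (seq .rat)) : Tm Γ .real := .app (.const .lim) x

/-- `x` is a regular sequence which represents `r`. -/
def Rep (x : Tm Γ (seq .rat)) (r : Tm Γ .real) : Fm Γ := Reg x ⩓ .eq .real (lim x) r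

/-- `r < s`: for representatives `x`, `y` and some `n`, `x n + 2 / (n + 1) < y n`. -/
def lt (r s : Tm Γ .real) : Fm Γ :=
  Ex (seq .rat) fun x => Ex (seq .rat) fun y => Rep x r ⩓ Rep y s ⩓
    Ex .nat fun n => ltQ (addQ (nth .rat x n) (addQ (rcp n) (rcp n))) (nth .rat y n)

/-- `r ≤ s`: for representatives `x`, `y` and all `n`, `x n ≤ y n + 2 / (n + 1)`. -/
def le (r s : Tm Γ .real) : Fm Γ :=
  Ex (seq .rat) fun x => Ex (seq .rat) fun y => Rep x r ⩓ Rep y s ⩓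
    All .nat fun n => leQ (nth .rat x n) (addQ (nth .rat y n) (addQ (rcp n) (rcp n)))

/-- The real number given by a constant sequence. -/
def ratR (q : Tm Γ .rat) : Tm Γ .real := lim (.app (.const (.K .rat .nat)) q)

def zeroR : Tm Γ .real := ratR zeroQ
def oneR : Tm Γ .real := ratR oneQ
def addR (r s : Tm Γ .real) : Tm Γ .real := .app (.app (.const .addR) r) s
def mulR (r s : Tm Γ .real) : Tm Γ .real := .app (.app (.const .mulR) r) s

/-- `s = |r|`: the real number `s` is nonnegative and has the same square as `r`. -/
def isAbs (r s : Tm Γ .real) : Fm Γ := le zeroR s ⩓ .eq .real (mulR s s) (mulR r r)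

end

/-! ## Axioms and rules -/

/-- The axioms of the system, in every context. -/
inductive Ax : ∀ {Γ : Ctx}, Fm Γ → Prop
  -- functions and pairs
  | ext {Γ : Ctx} (a b : Ty) : Ax (Γ := Γ)
      (All (a.fn b) fun f => All (a.fn b) fun g =>
        (All a fun x => .eq b (ap a b f x) (ap a b g x)) ⇒ .eq (a.fn b) f g)
  | K {Γ : Ctx} (a b : Ty) : Ax (Γ := Γ)
      (All a fun x => All b fun y => .eq a (.app (.app (.const (.K a b)) x) y) x)
  | S {Γ : Ctx} (a b c : Ty) : Ax (Γ := Γ)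
      (All (a.fn (b.fn c)) fun f => All (a.fn b) fun g => All a fun x =>
        .eq c (.app (.app (.app (.const (.S a b c)) f) g) x)
          (ap b c (ap a (b.fn c) f x) (ap a b g x)))
  | fst {Γ : Ctx} (a b : Ty) : Ax (Γ := Γ)
      (All a fun x => All b fun y =>
        .eq a (.app (.const (.fst a b)) (.app (.app (.const (.pair a b)) x) y)) x)
  | snd {Γ : Ctx} (a b : Ty) : Ax (Γ := Γ)
      (All a fun x => All b fun y =>
        .eq b (.app (.const (.snd a b)) (.app (.app (.const (.pair a b)) x) y)) y)
  | pair {Γ : Ctx} (a b : Ty) : Ax (Γ := Γ)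
      (All (a.prod b) fun p => .eq (a.prod b)
        (.app (.app (.const (.pair a b)) (.app (.const (.fst a b)) p))
          (.app (.const (.snd a b)) p)) p)
  -- natural numbers
  | succ_ne_zero {Γ : Ctx} : Ax (Γ := Γ)
      (All .nat fun n => .eq .nat (succ n) zeroN ⇒ .bot)
  | succ_inj {Γ : Ctx} : Ax (Γ := Γ)
      (All .nat fun m => All .nat fun n => .eq .nat (succ m) (succ n) ⇒ .eq .nat m n)
  | rec_zero {Γ : Ctx} (a : Ty) : Ax (Γ := Γ)
      (All a fun x => All (Ty.nat.fn (a.fn a)) fun f => .eq a (recN a x f zeroN) x)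
  | rec_succ {Γ : Ctx} (a : Ty) : Ax (Γ := Γ)
      (All a fun x => All (Ty.nat.fn (a.fn a)) fun f => All .nat fun n =>
        .eq a (recN a x f (succ n)) (ap a a (ap .nat (a.fn a) f n) (recN a x f n)))
  | induction {Γ : Ctx} (φ : Fm (.nat :: Γ)) : Ax
      (φ.inst zeroN ⇒
        .all .nat (φ ⇒ φ.subst (Sub.cons (succ (.var .z)) fun _ v => .var (.s v))) ⇒
        .all .nat φ)
  -- Relativized dependent choice: if `A 0 x` holds, and if whenever `A n x` holds there is
  -- `y` with `A (n + 1) y` and `R n x y`, then there is a sequence `f` with `f 0 = x` and,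
  -- for all `n`, `A n (f n)` and `R n (f n) (f (n + 1))`.
  -- The variables of `A` are `x`, `n`; those of `R` are `y`, `x`, `n`.
  | choice {Γ : Ctx} (a : Ty) (A : Fm (a :: .nat :: Γ)) (R : Fm (a :: a :: .nat :: Γ)) : Ax
      ((.all .nat (.all a (A ⇒ .ex a
          (A.subst (Sub.cons (.var .z) (Sub.cons (succ (.var (.s (.s .z))))
              fun _ v => .var (.s (.s (.s v))))) ⩓ R)))) ⇒
        .all a (A.subst (Sub.cons (.var .z) (Sub.cons zeroN fun _ v => .var (.s v))) ⇒
          .ex (seq a) (.eq a (nth a (.var .z) zeroN) (.var (.s .z)) ⩓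
            .all .nat
              (A.subst (Sub.cons (nth a (.var (.s .z)) (.var .z)) (Sub.cons (.var .z)
                  fun _ v => .var (.s (.s (.s v))))) ⩓
                R.subst (Sub.cons (nth a (.var (.s .z)) (succ (.var .z)))
                  (Sub.cons (nth a (.var (.s .z)) (.var .z)) (Sub.cons (.var .z)
                    fun _ v => .var (.s (.s (.s v))))))))))
  -- rational numbers
  | addQ_assoc {Γ : Ctx} : Ax (Γ := Γ) (All .rat fun p => All .rat fun q => All .rat fun r =>
      .eq .rat (addQ (addQ p q) r) (addQ p (addQ q r)))
  | addQ_comm {Γ : Ctx} : Ax (Γ := Γ) (All .rat fun p => All .rat fun q =>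
      .eq .rat (addQ p q) (addQ q p))
  | addQ_zero {Γ : Ctx} : Ax (Γ := Γ) (All .rat fun p => .eq .rat (addQ p zeroQ) p)
  | addQ_neg {Γ : Ctx} : Ax (Γ := Γ) (All .rat fun p => .eq .rat (addQ p (negQ p)) zeroQ)
  | mulQ_assoc {Γ : Ctx} : Ax (Γ := Γ) (All .rat fun p => All .rat fun q => All .rat fun r =>
      .eq .rat (mulQ (mulQ p q) r) (mulQ p (mulQ q r)))
  | mulQ_comm {Γ : Ctx} : Ax (Γ := Γ) (All .rat fun p => All .rat fun q =>
      .eq .rat (mulQ p q) (mulQ q p))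
  | mulQ_one {Γ : Ctx} : Ax (Γ := Γ) (All .rat fun p => .eq .rat (mulQ p oneQ) p)
  | mulQ_addQ {Γ : Ctx} : Ax (Γ := Γ) (All .rat fun p => All .rat fun q => All .rat fun r =>
      .eq .rat (mulQ p (addQ q r)) (addQ (mulQ p q) (mulQ p r)))
  | mulQ_inv {Γ : Ctx} : Ax (Γ := Γ) (All .rat fun p =>
      (.eq .rat p zeroQ ⇒ .bot) ⇒ .eq .rat (mulQ p (invQ p)) oneQ)
  | natQ_succ {Γ : Ctx} : Ax (Γ := Γ) (All .nat fun n =>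
      .eq .rat (natQ (succ n)) (addQ (natQ n) oneQ))
  | natQ_succ_ne_zero {Γ : Ctx} : Ax (Γ := Γ) (All .nat fun n =>
      .eq .rat (natQ (succ n)) zeroQ ⇒ .bot)
  | ratQ_fraction {Γ : Ctx} : Ax (Γ := Γ) (All .rat fun q =>
      Ex .nat fun k => Ex .nat fun l => Ex .nat fun m =>
        .eq .rat q (mulQ (subQ (natQ k) (natQ l)) (rcp m)))
  -- real numbers
  | real_rep {Γ : Ctx} : Ax (Γ := Γ) (All .real fun r => Ex (seq .rat) fun x => Rep x r)
  | real_eq {Γ : Ctx} : Ax (Γ := Γ) (All (seq .rat) fun x => All (seq .rat) fun y =>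
      Reg x ⇒ Reg y ⇒ iff (.eq .real (lim x) (lim y))
        (All .nat fun n => nearQ (nth .rat x n) (nth .rat y n) (addQ (rcp n) (rcp n))))
  -- sum: the sequence with `n`-th term `x (2 n + 1) + y (2 n + 1)`
  | addR_lim {Γ : Ctx} : Ax (Γ := Γ)
      (All (seq .rat) fun x => All (seq .rat) fun y => All (seq .rat) fun z => Reg x ⇒ Reg y ⇒
        (All .nat fun n => .eq .rat (nth .rat z n)
          (addQ (nth .rat x (succ (addN n n))) (nth .rat y (succ (addN n n))))) ⇒
        .eq .real (addR (lim x) (lim y)) (lim z))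
  -- product: any regular sequence whose distance to the termwise product tends to `0`
  | mulR_lim {Γ : Ctx} : Ax (Γ := Γ)
      (All (seq .rat) fun x => All (seq .rat) fun y => All (seq .rat) fun z =>
        Reg x ⇒ Reg y ⇒ Reg z ⇒
        (All .nat fun k => Ex .nat fun m => All .nat fun n => leN m n ⇒
          nearQ (nth .rat z n) (mulQ (nth .rat x n) (nth .rat y n)) (rcp k)) ⇒
        .eq .real (mulR (lim x) (lim y)) (lim z))

/-- Intuitionistic natural deduction with equality: `Deriv H φ` says that `φ` is derivable from
the assumptions `H` and the axioms. -/
inductive Deriv : ∀ {Γ : Ctx}, List (Fm Γ) → Fm Γ → Prop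
  | ax {Γ : Ctx} {H : List (Fm Γ)} {φ : Fm Γ} : Ax φ → Deriv H φ
  | hyp {Γ : Ctx} {H : List (Fm Γ)} {φ : Fm Γ} : φ ∈ H → Deriv H φ
  | botE {Γ : Ctx} {H : List (Fm Γ)} {φ : Fm Γ} : Deriv H .bot → Deriv H φ
  | andI {Γ : Ctx} {H : List (Fm Γ)} {φ ψ : Fm Γ} : Deriv H φ → Deriv H ψ → Deriv H (φ ⩓ ψ)
  | andE₁ {Γ : Ctx} {H : List (Fm Γ)} {φ ψ : Fm Γ} : Deriv H (φ ⩓ ψ) → Deriv H φ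
  | andE₂ {Γ : Ctx} {H : List (Fm Γ)} {φ ψ : Fm Γ} : Deriv H (φ ⩓ ψ) → Deriv H ψ
  | orI₁ {Γ : Ctx} {H : List (Fm Γ)} {φ ψ : Fm Γ} : Deriv H φ → Deriv H (φ ⩔ ψ)
  | orI₂ {Γ : Ctx} {H : List (Fm Γ)} {φ ψ : Fm Γ} : Deriv H ψ → Deriv H (φ ⩔ ψ)
  | orE {Γ : Ctx} {H : List (Fm Γ)} {φ ψ χ : Fm Γ} :
      Deriv H (φ ⩔ ψ) → Deriv (φ :: H) χ → Deriv (ψ :: H) χ → Deriv H χ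
  | impI {Γ : Ctx} {H : List (Fm Γ)} {φ ψ : Fm Γ} : Deriv (φ :: H) ψ → Deriv H (φ ⇒ ψ)
  | impE {Γ : Ctx} {H : List (Fm Γ)} {φ ψ : Fm Γ} : Deriv H (φ ⇒ ψ) → Deriv H φ → Deriv H ψ
  | allI {Γ : Ctx} {H : List (Fm Γ)} {a : Ty} {φ : Fm (a :: Γ)} :
      Deriv (H.map (Fm.wk a)) φ → Deriv H (.all a φ)
  | allE {Γ : Ctx} {H : List (Fm Γ)} {a : Ty} {φ : Fm (a :: Γ)} (t : Tm Γ a) :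
      Deriv H (.all a φ) → Deriv H (φ.inst t)
  | exI {Γ : Ctx} {H : List (Fm Γ)} {a : Ty} {φ : Fm (a :: Γ)} (t : Tm Γ a) :
      Deriv H (φ.inst t) → Deriv H (.ex a φ)
  | exE {Γ : Ctx} {H : List (Fm Γ)} {a : Ty} {φ : Fm (a :: Γ)} {χ : Fm Γ} :
      Deriv H (.ex a φ) → Deriv (φ :: H.map (Fm.wk a)) (χ.wk a) → Deriv H χ
  | eqI {Γ : Ctx} {H : List (Fm Γ)} {a : Ty} (t : Tm Γ a) : Deriv H (.eq a t t)
  | eqE {Γ : Ctx} {H : List (Fm Γ)} {a : Ty} {s t : Tm Γ a} (φ : Fm (a :: Γ)) :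
      Deriv H (.eq a s t) → Deriv H (φ.inst s) → Deriv H (φ.inst t)

/-! ## Normed spaces -/

section
variable {Γ : Ctx}

def vzero (i : Sp) : Tm Γ (.sp i) := .const (.vzero i)
def vadd (i : Sp) (x y : Tm Γ (.sp i)) : Tm Γ (.sp i) := .app (.app (.const (.vadd i)) x) y
def vneg (i : Sp) (x : Tm Γ (.sp i)) : Tm Γ (.sp i) := .app (.const (.vneg i)) x
def vsub (i : Sp) (x y : Tm Γ (.sp i)) : Tm Γ (.sp i) := vadd i x (vneg i y)
def smul (i : Sp) (r : Tm Γ .real) (x : Tm Γ (.sp i)) : Tm Γ (.sp i) :=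
  .app (.app (.const (.vsmul i)) r) x
def norm (i : Sp) (x : Tm Γ (.sp i)) : Tm Γ .real := .app (.const (.norm i)) x

/-- The metric `ρ(x, y) = ‖x - y‖`. -/
def dist (i : Sp) (x y : Tm Γ (.sp i)) : Tm Γ .real := norm i (vsub i x y)

/-- The axioms of a real vector space. -/
def isVectorSpace (i : Sp) : Fm Γ :=
  (All (.sp i) fun x => All (.sp i) fun y => All (.sp i) fun z =>
    .eq (.sp i) (vadd i (vadd i x y) z) (vadd i x (vadd i y z))) ⩓
  (All (.sp i) fun x => All (.sp i) fun y => .eq (.sp i) (vadd i x y) (vadd i y x)) ⩓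
  (All (.sp i) fun x => .eq (.sp i) (vadd i x (vzero i)) x) ⩓
  (All (.sp i) fun x => .eq (.sp i) (vadd i x (vneg i x)) (vzero i)) ⩓
  (All .real fun r => All (.sp i) fun x => All (.sp i) fun y =>
    .eq (.sp i) (smul i r (vadd i x y)) (vadd i (smul i r x) (smul i r y))) ⩓
  (All .real fun r => All .real fun s => All (.sp i) fun x =>
    .eq (.sp i) (smul i (addR r s) x) (vadd i (smul i r x) (smul i s x))) ⩓
  (All .real fun r => All .real fun s => All (.sp i) fun x =>
    .eq (.sp i) (smul i (mulR r s) x) (smul i r (smul i s x))) ⩓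
  (All (.sp i) fun x => .eq (.sp i) (smul i oneR x) x)

/-- The axioms of a norm; the last one is `‖r x‖ = |r| ‖x‖`. -/
def isNorm (i : Sp) : Fm Γ :=
  (All (.sp i) fun x => le zeroR (norm i x)) ⩓
  (All (.sp i) fun x => .eq .real (norm i x) zeroR ⇒ .eq (.sp i) x (vzero i)) ⩓
  (All (.sp i) fun x => All (.sp i) fun y =>
    le (norm i (vadd i x y)) (addR (norm i x) (norm i y))) ⩓
  (All .real fun r => All .real fun s => All (.sp i) fun x => isAbs r s ⇒
    .eq .real (norm i (smul i r x)) (mulR s (norm i x)))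

/-- For every `e > 0`, the distance of `u m` and `u n` is less than `e` for all large `m`, `n`. -/
def isCauchy (i : Sp) (u : Tm Γ (seq (.sp i))) : Fm Γ :=
  All .real fun e => lt zeroR e ⇒ Ex .nat fun k => All .nat fun m => All .nat fun n =>
    leN k m ⇒ leN k n ⇒ lt (dist i (nth (.sp i) u m) (nth (.sp i) u n)) e

/-- The sequence `u` converges to `x`. -/
def converges (i : Sp) (u : Tm Γ (seq (.sp i))) (x : Tm Γ (.sp i)) : Fm Γ :=
  All .real fun e => lt zeroR e ⇒ Ex .nat fun k => All .nat fun n =>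
    leN k n ⇒ lt (dist i (nth (.sp i) u n) x) e

def isComplete (i : Sp) : Fm Γ :=
  All (seq (.sp i)) fun u => isCauchy i u ⇒ Ex (.sp i) fun x => converges i u x

def isBanach (i : Sp) : Fm Γ := isVectorSpace i ⩓ isNorm i ⩓ isComplete i

/-- There is a dense sequence. -/
def isSeparable (i : Sp) : Fm Γ :=
  Ex (seq (.sp i)) fun u => All (.sp i) fun x => All .real fun e => lt zeroR e ⇒
    Ex .nat fun n => lt (dist i x (nth (.sp i) u n)) e

/-- `d` is the infimum of the set `{s | P p s}` of real numbers (`p` is a parameter): it is a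
lower bound, and every `e > d` exceeds some element of the set. -/
def isInf {b : Ty} (P : ∀ Δ : Ctx, Tm Δ b → Tm Δ .real → Fm Δ)
    (p : Tm Γ b) (d : Tm Γ .real) : Fm Γ :=
  (All .real fun s => P _ p s ⇒ le d s) ⩓
  (All .real fun e => lt d e ⇒ Ex .real fun s => P _ p s ⩓ lt s e)

/-! ## The operator `T` -/

def T (x : Tm Γ (.sp .X)) : Tm Γ (.sp .Y) := .app (.const .op) x

def isLinear : Fm Γ :=
  (All (.sp .X) fun x => All (.sp .X) fun y =>
    .eq (.sp .Y) (T (vadd .X x y)) (vadd .Y (T x) (T y))) ⩓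
  (All .real fun r => All (.sp .X) fun x => .eq (.sp .Y) (T (smul .X r x)) (smul .Y r (T x)))

/-- There is `x` with `T x ≠ 0`, that is, `‖T x‖ > 0`. -/
def isNonzero : Fm Γ := Ex (.sp .X) fun x => lt zeroR (norm .Y (T x))

def isOnto : Fm Γ := All (.sp .Y) fun y => Ex (.sp .X) fun x => .eq (.sp .Y) (T x) y

/-- If `u` converges to `x` and `v n = T (u n)` for all `n`, then `v` converges to `T x`. -/
def isSeqContinuous : Fm Γ :=
  All (seq (.sp .X)) fun u => All (.sp .X) fun x => All (seq (.sp .Y)) fun v =>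
    converges .X u x ⇒
    (All .nat fun n => .eq (.sp .Y) (nth (.sp .Y) v n) (T (nth (.sp .X) u n))) ⇒
    converges .Y v (T x)

def inKer (z : Tm Γ (.sp .X)) : Fm Γ := .eq (.sp .Y) (T z) (vzero .Y)

/-- `s ∈ {ρ(x, z) | z ∈ ker T}`. -/
def isDistToKerPoint (Δ : Ctx) (x : Tm Δ (.sp .X)) (s : Tm Δ .real) : Fm Δ :=
  Ex (.sp .X) fun z => inKer z ⩓ .eq .real s (dist .X x z)

/-- `d = ρ(x, ker T)`. -/
def isDistToKer (x : Tm Γ (.sp .X)) (d : Tm Γ .real) : Fm Γ := isInf isDistToKerPoint x d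

/-- `ker T` is located: `ρ(x, ker T)` exists for every `x`. -/
def kerLocated : Fm Γ := All (.sp .X) fun x => Ex .real fun d => isDistToKer x d

/-- `s ∈ {‖T x‖ | ρ(x, ker T) ≥ r}`. -/
def isNormFarFromKer (Δ : Ctx) (r s : Tm Δ .real) : Fm Δ :=
  Ex (.sp .X) fun x => (Ex .real fun d => isDistToKer x d ⩓ le r d) ⩓
    .eq .real s (norm .Y (T x))

/-- For some `r > 0` the infimum of `{‖T x‖ | ρ(x, ker T) ≥ r}` exists. -/
def infExists : Fm Γ :=
  Ex .real fun r => lt zeroR r ⩓ Ex .real fun d => isInf isNormFarFromKer r d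

/-- For every `e > 0` there is `d > 0` such that if `‖T x‖ < d`, then `ρ(x, z) < e` for some `z`
with `T z = 0`. -/
def isUniformlyZStable : Fm Γ :=
  All .real fun e => lt zeroR e ⇒ Ex .real fun d => lt zeroR d ⩓
    All (.sp .X) fun x => lt (norm .Y (T x)) d ⇒
      Ex (.sp .X) fun z => inKer z ⩓ lt (dist .X x z) e

end

end BISH

/-! The claim is about derivability, so it is proved semantically. A completeness theorem,
`deriv_of_forall_sat`, reduces it to truth in every world. A world is a deductively closed theory
with the disjunction and existence properties, whose elements are parameters up to provable
equality. Disjunction and existence are evaluated inside the world, while implication and universal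
quantification obey the Kripke clauses over all maps into other worlds (`World.sat_imp`,
`World.sat_all`). Zorn's lemma and classical logic are used about worlds, which is harmless because
only the existence of a derivation is at stake. Inside a world nothing is available but the axioms:
its natural numbers may be nonstandard, so each induction and each choice of a sequence passes
through a formula (`World.induction`, `World.choice`).

The analysis starts from the remark that stability is a matter of scaling once $\delta_r>0$ is known
(`stable`): a point at distance more than $\varepsilon/2$ from the kernel, suitably multiplied, is
at distance at least $r$, so its image cannot be too small.

Positivity of $\delta_r$ (`inf_pos`) rests on a device of Ishihara's type, `dichotomy`. Suppose that
$A_n$ or $B_n$ holds for each $n$, and that $B_n$ supplies a point $x$ at distance at least $\rho$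
from the kernel with very small image. Follow the sequence in $Y$ that is $0$ as long as $B$ is
chosen and, when $A_m$ is first chosen, jumps to $m\,Tx$ and stays there. The image is so small that
the sequence is Cauchy whether or not it jumps. Its limit is $Tu$ for some $u$, because $T$ is onto.
A jump at $m$ gives $Tu=m\,Tx$, so $x-u/m$ lies in the kernel and $\|u\|/m\ge\rho$. Hence no jump
occurs beyond a bound computed from $u$, and one look at a late stage decides between "some $A_n$"
and "all $B_n$". With $A$ saying $0<\delta_r$ and $B_n$ saying that $\delta_r$ is below the $n$-th
tolerance, either $\delta_r>0$ or there are far points with arbitrarily small images (`SmallFar`).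

The second case is absurd (`not_smallFar`). There the premise on $B$ is free, so the dichotomy
becomes the limited principle of omniscience, and the classical proof of the open mapping theorem
can be carried out. By `SmallFar.exists_ball`, every ball of $Y$ contains a ball missing the image
of a given ball of $X$; otherwise that image would be nearly dense in the ball, and successive
approximation would produce a short preimage of $Tx$ for a far point $x$ (`SmallFar.not_dense`).
Nested balls then yield, by completeness of $Y$, a point outside the range of $T$. -/

section
namespace BISH

/-! ## Substitution -/

/-- Renamings of variables. -/
abbrev Ren (Γ Δ : Ctx) := ∀ a : Ty, Var Γ a → Var Δ a

def Ren.toSub {Γ Δ : Ctx} (r : Ren Γ Δ) : Sub Γ Δ := fun a v => .var (r a v)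

def Ren.lift {Γ Δ : Ctx} (r : Ren Γ Δ) (b : Ty) : Ren (b :: Γ) (b :: Δ)
  | _, .z => .z
  | _, .s v => .s (r _ v)

def Ren.wk (Γ : Ctx) (b : Ty) : Ren Γ (b :: Γ) := fun _ v => .s v

def Fm.ren {Γ Δ : Ctx} (r : Ren Γ Δ) (φ : Fm Γ) : Fm Δ := φ.subst r.toSub

def Sub.comp {Γ Δ Θ : Ctx} (σ : Sub Γ Δ) (τ : Sub Δ Θ) : Sub Γ Θ := fun a v => (σ a v).subst τ

theorem Sub.ext_cons {Γ Δ : Ctx} {b : Ty} {σ τ : Sub (b :: Γ) Δ} (h0 : σ b .z = τ b .z)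
    (hs : ∀ a (v : Var Γ a), σ a (.s v) = τ a (.s v)) : σ = τ := by
  funext a v
  cases v with
  | z => exact h0
  | s v => exact hs a v

theorem Ren.toSub_lift {Γ Δ : Ctx} (r : Ren Γ Δ) (b : Ty) :
    r.toSub.lift b = (r.lift b).toSub :=
  Sub.ext_cons rfl fun _ _ => rfl

theorem Tm.subst_subst {Γ Δ Θ : Ctx} (σ : Sub Γ Δ) (τ : Sub Δ Θ) {a : Ty} (t : Tm Γ a) :
    (t.subst σ).subst τ = t.subst (σ.comp τ) := by
  induction t with
  | var v => rfl
  | const c => rfl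
  | app f x hf hx => simp only [Tm.subst, hf, hx]

theorem Tm.wk_subst_lift {Γ Δ : Ctx} (σ : Sub Γ Δ) (b : Ty) {a : Ty} (t : Tm Γ a) :
    (t.wk b).subst (σ.lift b) = (t.subst σ).wk b := by
  simp only [Tm.wk, Tm.subst_subst]; rfl

theorem Sub.lift_comp {Γ Δ Θ : Ctx} (σ : Sub Γ Δ) (τ : Sub Δ Θ) (b : Ty) :
    (σ.lift b).comp (τ.lift b) = (σ.comp τ).lift b :=
  Sub.ext_cons rfl fun _ v => Tm.wk_subst_lift τ b (σ _ v)

theorem Fm.subst_subst {Γ Δ Θ : Ctx} (σ : Sub Γ Δ) (τ : Sub Δ Θ) (φ : Fm Γ) :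
    (φ.subst σ).subst τ = φ.subst (σ.comp τ) := by
  induction φ generalizing Δ Θ with
  | eq a s t => simp only [Fm.subst, Tm.subst_subst]
  | bot => rfl
  | and φ ψ h1 h2 => simp only [Fm.subst, h1, h2]
  | or φ ψ h1 h2 => simp only [Fm.subst, h1, h2]
  | imp φ ψ h1 h2 => simp only [Fm.subst, h1, h2]
  | all a φ h => simp only [Fm.subst, h, Sub.lift_comp]
  | ex a φ h => simp only [Fm.subst, h, Sub.lift_comp]

theorem Tm.subst_id {Γ : Ctx} {a : Ty} (t : Tm Γ a) : t.subst (Sub.id Γ) = t := by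
  induction t with
  | var v => rfl
  | const c => rfl
  | app f x hf hx => simp only [Tm.subst, hf, hx]

theorem Sub.lift_id (Γ : Ctx) (b : Ty) : (Sub.id Γ).lift b = Sub.id (b :: Γ) :=
  Sub.ext_cons rfl fun _ _ => rfl

theorem Fm.subst_id {Γ : Ctx} (φ : Fm Γ) : φ.subst (Sub.id Γ) = φ := by
  induction φ with
  | eq a s t => simp only [Fm.subst, Tm.subst_id]
  | bot => rfl
  | and φ ψ h1 h2 => simp only [Fm.subst, h1, h2]
  | or φ ψ h1 h2 => simp only [Fm.subst, h1, h2]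
  | imp φ ψ h1 h2 => simp only [Fm.subst, h1, h2]
  | all a φ h => simp only [Fm.subst, h, Sub.lift_id]
  | ex a φ h => simp only [Fm.subst, h, Sub.lift_id]

theorem Fm.wk_eq_ren {Γ : Ctx} (b : Ty) (φ : Fm Γ) : φ.wk b = φ.ren (Ren.wk Γ b) := rfl

theorem Fm.ren_ren {Γ Δ Θ : Ctx} (r : Ren Γ Δ) (q : Ren Δ Θ) (φ : Fm Γ) :
    (φ.ren r).ren q = φ.ren fun a v => q a (r a v) :=
  Fm.subst_subst _ _ φ

theorem Fm.ren_id {Γ : Ctx} (φ : Fm Γ) : (φ.ren fun _ v => v) = φ := Fm.subst_id φ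

theorem Fm.ren_all {Γ Δ : Ctx} (r : Ren Γ Δ) (a : Ty) (φ : Fm (a :: Γ)) :
    (Fm.all a φ).ren r = .all a (φ.ren (r.lift a)) := by
  simp only [Fm.ren, Fm.subst, Ren.toSub_lift]

theorem Fm.ren_ex {Γ Δ : Ctx} (r : Ren Γ Δ) (a : Ty) (φ : Fm (a :: Γ)) :
    (Fm.ex a φ).ren r = .ex a (φ.ren (r.lift a)) := by
  simp only [Fm.ren, Fm.subst, Ren.toSub_lift]

theorem Tm.wk_subst_cons {Γ Δ : Ctx} {b : Ty} (s : Tm Δ b) (σ : Sub Γ Δ) {a : Ty} (t : Tm Γ a) :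
    (t.wk b).subst (Sub.cons s σ) = t.subst σ := by
  simp only [Tm.wk, Tm.subst_subst]; rfl

theorem Fm.wk_subst_lift {Γ Δ : Ctx} (σ : Sub Γ Δ) (b : Ty) (φ : Fm Γ) :
    (φ.wk b).subst (σ.lift b) = (φ.subst σ).wk b := by
  simp only [Fm.wk, Fm.subst_subst]; rfl

theorem Fm.subst_inst {Γ Δ : Ctx} (σ : Sub Γ Δ) {a : Ty} (φ : Fm (a :: Γ)) (t : Tm Γ a) :
    (φ.inst t).subst σ = (φ.subst (σ.lift a)).inst (t.subst σ) := by
  simp only [Fm.inst, Fm.subst_subst]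
  congr 1
  refine Sub.ext_cons rfl fun b v => ?_
  simp only [Sub.comp, Sub.cons, Sub.lift, Tm.wk_subst_cons, Tm.subst_id]
  rfl

/-- The generic instance of the body of a quantifier is the body itself. -/
theorem Fm.inst_ren_lift_wk {Γ : Ctx} {a : Ty} (φ : Fm (a :: Γ)) :
    (φ.ren ((Ren.wk Γ a).lift a)).inst (.var .z) = φ := by
  simp only [Fm.ren, Fm.inst, Fm.subst_subst]
  conv_rhs => rw [← φ.subst_id]
  congr 1
  exact Sub.ext_cons rfl fun b v => rfl

theorem Fm.subst_subst_eq {Γ Δ Δ' Θ : Ctx} {σ : Sub Γ Δ} {τ : Sub Δ Θ} {σ' : Sub Γ Δ'}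
    {τ' : Sub Δ' Θ} (h : σ.comp τ = σ'.comp τ') (φ : Fm Γ) :
    (φ.subst σ).subst τ = (φ.subst σ').subst τ' := by
  rw [Fm.subst_subst, Fm.subst_subst, h]

/-- Apart from the two schemes the axioms are closed sentences, so substitution only changes the
context. Induction and choice become the instances for the substituted formulas; what has to be
checked is that the substitutions written into the schemes commute with `σ`. -/
theorem Ax.subst {Γ Δ : Ctx} (σ : Sub Γ Δ) {φ : Fm Γ} (h : Ax φ) : Ax (φ.subst σ) := by
  cases h with
  | ext a b => exact Ax.ext a b
  | K a b => exact Ax.K a b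
  | S a b c => exact Ax.S a b c
  | fst a b => exact Ax.fst a b
  | snd a b => exact Ax.snd a b
  | pair a b => exact Ax.pair a b
  | rec_zero a => exact Ax.rec_zero a
  | rec_succ a => exact Ax.rec_succ a
  | induction φ =>
    have := Ax.induction (φ.subst (σ.lift .nat))
    simp only [Fm.subst, Fm.subst_inst]
    convert this using 4
    · rfl
    · congr 1
      refine Fm.subst_subst_eq ?_ φ
      refine Sub.ext_cons rfl fun b v => ?_
      simp only [Sub.comp, Sub.cons, Sub.lift, Tm.wk_subst_cons]
      rfl
  | choice a A R =>
    have := Ax.choice a (A.subst ((σ.lift .nat).lift a)) (R.subst (((σ.lift .nat).lift a).lift a))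
    simp only [Fm.subst]
    convert this using 2
    · congr 5
      refine Fm.subst_subst_eq ?_ A
      refine Sub.ext_cons rfl fun b v => ?_
      cases v with
      | z => rfl
      | s v => simp only [Sub.comp, Sub.cons, Sub.lift, Tm.wk, Tm.subst_subst, Tm.subst]; rfl
    · congr 2
      · refine Fm.subst_subst_eq ?_ A
        refine Sub.ext_cons rfl fun b v => ?_
        cases v with
        | z => rfl
        | s v => simp only [Sub.comp, Sub.cons, Sub.lift, Tm.wk, Tm.subst_subst, Tm.subst]; rfl
      · congr 4
        · refine Fm.subst_subst_eq ?_ A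
          refine Sub.ext_cons rfl fun b v => ?_
          cases v with
          | z => rfl
          | s v => simp only [Sub.comp, Sub.cons, Sub.lift, Tm.wk, Tm.subst_subst, Tm.subst]; rfl
        · refine Fm.subst_subst_eq ?_ R
          refine Sub.ext_cons rfl fun b v => ?_
          cases v with
          | z => rfl
          | s v =>
            cases v with
            | z => rfl
            | s v => simp only [Sub.comp, Sub.cons, Sub.lift, Tm.wk, Tm.subst_subst, Tm.subst]; rfl
  | _ => constructor

theorem Deriv.subst {Γ Δ : Ctx} (σ : Sub Γ Δ) {H : List (Fm Γ)} {φ : Fm Γ} (h : Deriv H φ) :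
    Deriv (H.map (Fm.subst σ)) (φ.subst σ) := by
  have key : ∀ {Γ Δ : Ctx} (σ : Sub Γ Δ) (a : Ty) (H : List (Fm Γ)),
      (H.map (Fm.wk a)).map (Fm.subst (σ.lift a)) = (H.map (Fm.subst σ)).map (Fm.wk a) := by
    intro Γ Δ σ a H
    simp only [List.map_map]
    congr 1
    funext ψ
    exact Fm.wk_subst_lift σ a ψ
  induction h generalizing Δ with
  | ax h => exact .ax (h.subst σ)
  | hyp h => exact .hyp (List.mem_map_of_mem h)
  | botE _ ih => exact .botE (ih σ)
  | andI _ _ h1 h2 => exact .andI (h1 σ) (h2 σ)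
  | andE₁ _ ih => exact .andE₁ (ih σ)
  | andE₂ _ ih => exact .andE₂ (ih σ)
  | orI₁ _ ih => exact .orI₁ (ih σ)
  | orI₂ _ ih => exact .orI₂ (ih σ)
  | orE _ _ _ h h1 h2 => exact .orE (h σ) (h1 σ) (h2 σ)
  | impI _ ih => exact .impI (ih σ)
  | impE _ _ h1 h2 => exact .impE (h1 σ) (h2 σ)
  | allI _ ih => exact .allI (by have := ih (σ.lift _); rwa [key] at this)
  | allE t _ ih => rw [Fm.subst_inst]; exact .allE _ (ih σ)
  | exI t _ ih => exact .exI (t.subst σ) (by have := ih σ; rwa [Fm.subst_inst] at this)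
  | exE _ _ h1 h2 =>
    refine .exE (h1 σ) ?_
    have := h2 (σ.lift _)
    rwa [List.map_cons, key, Fm.wk_subst_lift] at this
  | eqI t => exact .eqI _
  | eqE φ _ _ h1 h2 =>
    rw [Fm.subst_inst]
    exact .eqE _ (h1 σ) (by have := h2 σ; rwa [Fm.subst_inst] at this)

theorem Deriv.ren {Γ Δ : Ctx} (r : Ren Γ Δ) {H : List (Fm Γ)} {φ : Fm Γ} (h : Deriv H φ) :
    Deriv (H.map (Fm.ren r)) (φ.ren r) := h.subst r.toSub

end BISH
end

section
namespace BISH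

/-! ## Derived rules -/

theorem Deriv.mono {Γ : Ctx} {H G : List (Fm Γ)} {φ : Fm Γ} (h : Deriv H φ) (hG : H ⊆ G) :
    Deriv G φ := by
  induction h with
  | ax h => exact .ax h
  | hyp h => exact .hyp (hG h)
  | botE _ ih => exact .botE (ih hG)
  | andI _ _ h1 h2 => exact .andI (h1 hG) (h2 hG)
  | andE₁ _ ih => exact .andE₁ (ih hG)
  | andE₂ _ ih => exact .andE₂ (ih hG)
  | orI₁ _ ih => exact .orI₁ (ih hG)
  | orI₂ _ ih => exact .orI₂ (ih hG)
  | orE _ _ _ h h1 h2 =>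
    exact .orE (h hG) (h1 (List.cons_subset_cons _ hG)) (h2 (List.cons_subset_cons _ hG))
  | impI _ ih => exact .impI (ih (List.cons_subset_cons _ hG))
  | impE _ _ h1 h2 => exact .impE (h1 hG) (h2 hG)
  | allI _ ih => exact .allI (ih (List.map_subset _ hG))
  | allE t _ ih => exact .allE t (ih hG)
  | exI t _ ih => exact .exI t (ih hG)
  | exE _ _ h1 h2 => exact .exE (h1 hG) (h2 (List.cons_subset_cons _ (List.map_subset _ hG)))
  | eqI t => exact .eqI t
  | eqE φ _ _ h1 h2 => exact .eqE φ (h1 hG) (h2 hG)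

/-- The assumptions are discharged one at a time by implication introduction and then supplied. -/
theorem Deriv.cut {Γ : Ctx} {H G : List (Fm Γ)} {φ : Fm Γ} (h : Deriv H φ)
    (hG : ∀ ψ ∈ H, Deriv G ψ) : Deriv G φ := by
  induction H generalizing φ with
  | nil => exact h.mono (List.nil_subset _)
  | cons ψ H ih =>
    exact .impE (ih h.impI fun χ hχ => hG χ (List.mem_cons_of_mem _ hχ)) (hG ψ List.mem_cons_self)

section
variable {Γ : Ctx} {H : List (Fm Γ)}

theorem Deriv.allE_wk {a : Ty} {φ : Fm (a :: Γ)} {G : List (Fm (a :: Γ))}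
    (h : Deriv G ((Fm.all a φ).wk a)) : Deriv G φ := by
  rw [Fm.wk_eq_ren, Fm.ren_all] at h
  simpa only [Fm.inst_ren_lift_wk] using h.allE (.var .z)

theorem Deriv.exI_wk {a : Ty} {φ : Fm (a :: Γ)} {G : List (Fm (a :: Γ))}
    (h : Deriv G φ) : Deriv G ((Fm.ex a φ).wk a) := by
  rw [Fm.wk_eq_ren, Fm.ren_ex]
  exact .exI (.var .z) (by rwa [Fm.inst_ren_lift_wk])

/-- This is what makes the theory with a fresh parameter deductively closed: a fact about the fresh
parameter is a universally quantified fact. -/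
theorem Deriv.map_all {a : Ty} {φ : Fm (a :: Γ)} {G : List (Fm (a :: Γ))} (h : Deriv G φ) :
    Deriv (G.map (Fm.all a)) (.all a φ) := by
  refine .allI (h.cut fun ψ hψ => Deriv.allE_wk (.hyp ?_))
  exact List.mem_map_of_mem (List.mem_map_of_mem hψ)

theorem Deriv.exE_of_all {a : Ty} {φ : Fm (a :: Γ)} {χ : Fm Γ} (h : Deriv H (.ex a φ))
    (h' : Deriv H (.all a (φ ⇒ χ.wk a))) : Deriv H χ := by
  refine .exE h (.impE (Deriv.allE_wk ?_) (.hyp List.mem_cons_self))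
  exact (h'.ren (Ren.wk Γ a)).mono (List.subset_cons_self _ _)

theorem Deriv.eq_symm {a : Ty} {s t : Tm Γ a} (h : Deriv H (.eq a s t)) :
    Deriv H (.eq a t s) := by
  have := Deriv.eqE (.eq a (.var .z) (s.wk a)) h
  simp only [Fm.inst, Fm.subst, Tm.wk_subst_cons, Tm.subst_id] at this
  exact this (.eqI s)

theorem Deriv.eq_trans {a : Ty} {s t u : Tm Γ a} (h : Deriv H (.eq a s t))
    (h' : Deriv H (.eq a t u)) : Deriv H (.eq a s u) := by
  have := Deriv.eqE (.eq a (s.wk a) (.var .z)) h'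
  simp only [Fm.inst, Fm.subst, Tm.wk_subst_cons, Tm.subst_id] at this
  exact this h

theorem Deriv.eq_app {a b : Ty} {f g : Tm Γ (a.fn b)} {s t : Tm Γ a}
    (hf : Deriv H (.eq _ f g)) (h : Deriv H (.eq a s t)) :
    Deriv H (.eq b (.app f s) (.app g t)) := by
  have h1 := Deriv.eqE (.eq b ((Tm.app f s).wk _) (.app (.var .z) (s.wk _))) hf
  have h2 := Deriv.eqE (.eq b ((Tm.app f s).wk _) (.app (g.wk _) (.var .z))) h
  simp only [Fm.inst, Fm.subst, Tm.subst, Tm.wk_subst_cons, Tm.subst_id] at h1 h2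
  exact h2 (h1 (.eqI _))

end

/-! ## Assignments -/

/-- Assignments of values to the variables of a context. -/
abbrev Env (D : Ty → Type) (Γ : Ctx) := ∀ a : Ty, Var Γ a → D a

section
variable {D : Ty → Type} {Γ Δ : Ctx}

def Env.nil : Env D [] := fun _ v => nomatch v

def Env.cons {a : Ty} (d : D a) (e : Env D Γ) : Env D (a :: Γ)
  | _, .z => d
  | _, .s v => e _ v

def Env.append : ∀ {Γ : Ctx}, Env D Γ → Env D Δ → Env D (Γ ++ Δ)
  | [], _, e' => e'
  | _ :: _, e, e' => Env.cons (e _ .z) (Env.append (fun a v => e a (.s v)) e')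

def Ren.inl : ∀ (Γ Δ : Ctx), Ren Γ (Γ ++ Δ)
  | _ :: _, _, _, .z => .z
  | _ :: Γ, Δ, _, .s v => .s (Ren.inl Γ Δ _ v)

def Ren.inr : ∀ (Γ Δ : Ctx), Ren Δ (Γ ++ Δ)
  | [], _, _, v => v
  | _ :: Γ, Δ, _, v => .s (Ren.inr Γ Δ _ v)

theorem Env.nil_eq (e : Env D []) : e = Env.nil := by
  funext b v
  cases v

theorem Env.append_inl (e : Env D Γ) (e' : Env D Δ) {a : Ty} (v : Var Γ a) :
    e.append e' a (Ren.inl Γ Δ a v) = e a v := by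
  induction v with
  | z => rfl
  | s v ih => exact ih _

theorem Env.append_inr (e : Env D Γ) (e' : Env D Δ) {a : Ty} (v : Var Δ a) :
    e.append e' a (Ren.inr Γ Δ a v) = e' a v := by
  induction Γ with
  | nil => rfl
  | cons b Γ ih => exact ih _

theorem Env.map_cons {D' : Ty → Type} (f : ∀ a, D a → D' a) {a : Ty} (d : D a) (e : Env D Γ) :
    (fun b v => f b (Env.cons d e b v)) = Env.cons (f a d) (fun b v => f b (e b v)) := by
  funext b v
  cases v <;> rfl

theorem Env.map_append {D' : Ty → Type} (f : ∀ a, D a → D' a) (e : Env D Γ) (e' : Env D Δ) :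
    (fun b v => f b (Env.append e e' b v)) =
      Env.append (fun b v => f b (e b v)) (fun b v => f b (e' b v)) := by
  induction Γ with
  | nil => rfl
  | cons c Γ ih =>
    exact (Env.map_cons f _ _).trans (congrArg _ (ih fun a v => e a (.s v)))

/-- Case distinction for the variables of an appended context. -/
theorem Env.append_cases {P : ∀ a, D a → Prop} {e : Env D Γ} {e' : Env D Δ}
    (h : ∀ a v, P a (e a v)) (h' : ∀ a v, P a (e' a v)) (a : Ty) (v : Var (Γ ++ Δ) a) :
    P a (e.append e' a v) := by
  induction Γ with
  | nil => exact h' a v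
  | cons b Γ ih =>
    cases v with
    | z => exact h _ _
    | s v => exact ih (fun a v => h a (.s v)) v

theorem Env.cons_cases {P : ∀ a, D a → Prop} {b : Ty} {d : D b} {e : Env D Γ}
    (h : P b d) (h' : ∀ a v, P a (e a v)) (a : Ty) (v : Var (b :: Γ) a) :
    P a (Env.cons d e a v) := by
  cases v with
  | z => exact h
  | s v => exact h' _ v

end

/-! ## Theories with parameters -/

/-- A deductively closed set of formulas with parameters from the sets `U a`. -/
structure Theory (V : Ty → Type) where
  U : ∀ a, Set (V a)
  inh : ∀ a, ∃ x, x ∈ U a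
  mem : ∀ {Γ : Ctx}, Fm Γ → Env V Γ → Prop
  dom : ∀ {Γ : Ctx} {φ : Fm Γ} {e : Env V Γ}, mem φ e → ∀ a v, e a v ∈ U a
  ren : ∀ {Γ Δ : Ctx} (r : Ren Γ Δ) (φ : Fm Γ) {e : Env V Δ}, (∀ a v, e a v ∈ U a) →
    (mem (φ.ren r) e ↔ mem φ fun a v => e a (r a v))
  deriv : ∀ {Γ : Ctx} {H : List (Fm Γ)} {φ : Fm Γ} {e : Env V Γ}, (∀ a v, e a v ∈ U a) →
    Deriv H φ → (∀ ψ ∈ H, mem ψ e) → mem φ e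

namespace Theory
variable {V : Ty → Type}

/-- Inclusion of theories. -/
def le (T T' : Theory V) : Prop :=
  (∀ a, T.U a ⊆ T'.U a) ∧ ∀ {Γ : Ctx} (φ : Fm Γ) (e : Env V Γ), T.mem φ e → T'.mem φ e

theorem le_refl (T : Theory V) : T.le T := ⟨fun _ => subset_rfl, fun _ _ h => h⟩

theorem le_trans {T T' T'' : Theory V} (h : T.le T') (h' : T'.le T'') : T.le T'' :=
  ⟨fun a => (h.1 a).trans (h'.1 a), fun φ e hφ => h'.2 φ e (h.2 φ e hφ)⟩

theorem deriv₁ (T : Theory V) {Γ : Ctx} {φ ψ : Fm Γ} {e : Env V Γ} (h : T.mem φ e)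
    (hd : Deriv [φ] ψ) : T.mem ψ e :=
  T.deriv (T.dom h) hd (by simpa using h)

theorem deriv₂ (T : Theory V) {Γ : Ctx} {φ ψ χ : Fm Γ} {e : Env V Γ} (h : T.mem φ e)
    (h' : T.mem ψ e) (hd : Deriv [φ, ψ] χ) : T.mem χ e :=
  T.deriv (T.dom h) hd (by simpa using ⟨h, h'⟩)

/-- The theory generated by one more formula. -/
def add (T : Theory V) {Γ₀ : Ctx} (φ₀ : Fm Γ₀) (e₀ : Env V Γ₀) (h₀ : ∀ a v, e₀ a v ∈ T.U a) :
    Theory V where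
  U := T.U
  inh := T.inh
  -- The added formula and `φ` may have different contexts and share parameters, so the implication
  -- is formed over the concatenated context.
  mem {Γ} φ e := (∀ a v, e a v ∈ T.U a) ∧
    T.mem (φ₀.ren (Ren.inl Γ₀ Γ) ⇒ φ.ren (Ren.inr Γ₀ Γ)) (e₀.append e)
  dom h := h.1
  ren {Γ Δ} r φ e he := by
    let R : Ren (Γ₀ ++ Γ) (Γ₀ ++ Δ) :=
      Env.append (D := Var (Γ₀ ++ Δ)) (Ren.inl Γ₀ Δ) fun a v => Ren.inr Γ₀ Δ a (r a v)
    have h1 : (φ₀.ren (Ren.inl Γ₀ Γ) ⇒ φ.ren (Ren.inr Γ₀ Γ)).ren R =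
        (φ₀.ren (Ren.inl Γ₀ Δ) ⇒ (φ.ren r).ren (Ren.inr Γ₀ Δ)) := by
      change ((φ₀.ren _).ren R ⇒ (φ.ren _).ren R) = _
      simp only [Fm.ren_ren, R, Env.append_inl, Env.append_inr]
    have h2 : (fun a v => e₀.append e a (R a v)) = e₀.append fun a v => e a (r a v) := by
      have := Env.map_append (D' := V) (fun a v => e₀.append e a v)
        (Ren.inl Γ₀ Δ) fun a v => Ren.inr Γ₀ Δ a (r a v)
      simp only [Env.append_inl, Env.append_inr] at this
      exact this
    rw [← h1, T.ren R _ (Env.append_cases (P := fun a x => x ∈ T.U a) h₀ he), h2]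
    exact ⟨fun h => ⟨fun a v => he a _, h.2⟩, fun h => ⟨he, h.2⟩⟩
  deriv {Γ H φ e} he hd hH := by
    refine ⟨he, T.deriv (H := (H.map (Fm.ren (Ren.inr Γ₀ Γ))).map (φ₀.ren (Ren.inl Γ₀ Γ) ⇒ ·))
      (Env.append_cases (P := fun a x => x ∈ T.U a) h₀ he) ?_ ?_⟩
    · refine .impI ((hd.ren _).cut fun ψ hψ => .impE (φ := φ₀.ren (Ren.inl Γ₀ Γ)) ?_ ?_)
      · exact .hyp (List.mem_cons_of_mem _ (List.mem_map_of_mem hψ))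
      · exact .hyp List.mem_cons_self
    · simp only [List.map_map, List.mem_map, Function.comp]
      rintro _ ⟨ψ, hψ, rfl⟩
      exact (hH ψ hψ).2

theorem mem_add_self (T : Theory V) {Γ₀ : Ctx} (φ₀ : Fm Γ₀) (e₀ : Env V Γ₀)
    (h₀ : ∀ a v, e₀ a v ∈ T.U a) : (T.add φ₀ e₀ h₀).mem φ₀ e₀ := by
  refine ⟨h₀, ?_⟩
  let R : Ren (Γ₀ ++ Γ₀) Γ₀ := Env.append (D := Var Γ₀) (fun a v => v) fun a v => v
  have h1 : (φ₀.ren (Ren.inl Γ₀ Γ₀) ⇒ φ₀.ren (Ren.inr Γ₀ Γ₀)).ren R = (φ₀ ⇒ φ₀) := by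
    change ((φ₀.ren _).ren R ⇒ (φ₀.ren _).ren R) = _
    simp only [Fm.ren_ren, R, Env.append_inl, Env.append_inr, Fm.ren_id]
  have h2 : (fun a v => e₀ a (R a v)) = e₀.append e₀ :=
    Env.map_append (D' := V) (fun a v => e₀ a v) (fun _ v => v) fun _ v => v
  rw [← h2, ← T.ren R _ h₀, h1]
  exact T.deriv h₀ (H := []) (.impI (.hyp List.mem_cons_self)) (by simp)

theorem le_add (T : Theory V) {Γ₀ : Ctx} (φ₀ : Fm Γ₀) (e₀ : Env V Γ₀)
    (h₀ : ∀ a v, e₀ a v ∈ T.U a) : T.le (T.add φ₀ e₀ h₀) := by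
  refine ⟨fun _ => subset_rfl, fun {Γ} φ e h => ⟨T.dom h, ?_⟩⟩
  have hU := Env.append_cases (P := fun a x => x ∈ T.U a) h₀ (T.dom h)
  refine T.deriv hU (H := [φ.ren (Ren.inr Γ₀ Γ)]) (.impI (.hyp (by simp))) ?_
  simp only [List.mem_singleton, forall_eq]
  rw [T.ren _ _ hU]
  simpa only [Env.append_inr] using h

/-- Formulas over a common context. -/
theorem mem_add_iff (T : Theory V) {Γ : Ctx} (φ ψ : Fm Γ) (e : Env V Γ)
    (h : ∀ a v, e a v ∈ T.U a) : (T.add φ e h).mem ψ e ↔ T.mem (φ ⇒ ψ) e := by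
  constructor
  · intro hm
    refine T.deriv h (H := [φ ⇒ ψ]) (.hyp (by simp)) ?_
    simp only [List.mem_singleton, forall_eq]
    let R : Ren (Γ ++ Γ) Γ := Env.append (D := Var Γ) (fun a v => v) fun a v => v
    have h1 : (φ.ren (Ren.inl Γ Γ) ⇒ ψ.ren (Ren.inr Γ Γ)).ren R = (φ ⇒ ψ) := by
      change ((φ.ren _).ren R ⇒ (ψ.ren _).ren R) = _
      simp only [Fm.ren_ren, R, Env.append_inl, Env.append_inr, Fm.ren_id]
    have h2 : (fun a v => e a (R a v)) = e.append e :=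
      Env.map_append (D' := V) (fun a v => e a v) (fun _ v => v) fun _ v => v
    rw [← h1, T.ren R _ h, h2]
    exact hm.2
  · intro hm
    refine (T.add φ e h).deriv h (H := [φ, φ ⇒ ψ])
      (.impE (φ := φ) (.hyp (by simp)) (.hyp (by simp))) ?_
    simp only [List.mem_cons, List.not_mem_nil, or_false, forall_eq_or_imp, forall_eq]
    exact ⟨T.mem_add_self φ e h, (T.le_add φ e h).2 _ _ hm⟩

end Theory
end BISH
end

section
namespace BISH

/-! ## Fresh parameters -/

section
variable {V : Ty → Type} {Γ Δ : Ctx} {a : Ty}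

open Classical in
/-- The new variable if the value `x` of `v` is `c`, otherwise `v` itself. -/
noncomputable def freshVar (c : V a) {b : Ty} (x : V b) (v : Var Γ b) : Var (a :: Γ) b :=
  if h : (⟨b, x⟩ : Σ b, V b) = ⟨a, c⟩ then (Sigma.mk.inj_iff.1 h).1 ▸ Var.z else .s v

theorem freshVar_self (c : V a) (v : Var Γ a) : freshVar c c v = .z := by
  rw [freshVar, dif_pos rfl]

theorem freshVar_of_ne {c : V a} {b : Ty} {x : V b} (h : (⟨b, x⟩ : Σ b, V b) ≠ ⟨a, c⟩)
    (v : Var Γ b) : freshVar c x v = .s v := by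
  rw [freshVar, dif_neg h]

theorem freshVar_ren (c : V a) {b : Ty} (x : V b) (v : Var Γ b) (r : Ren Γ Δ) :
    (r.lift a) b (freshVar c x v) = freshVar c x (r b v) := by
  by_cases h : (⟨b, x⟩ : Σ b, V b) = ⟨a, c⟩
  · cases h
    rw [freshVar_self, freshVar_self]
    rfl
  · rw [freshVar_of_ne h, freshVar_of_ne h]
    rfl

end

namespace Theory
variable {V : Ty → Type}

open Classical in
/-- Values other than `c` are kept. -/
noncomputable def old (T : Theory V) {a : Ty} (c : V a) {b : Ty} (x : V b) : V b :=
  if (⟨b, x⟩ : Σ b, V b) = ⟨a, c⟩ then (T.inh b).choose else x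

theorem old_of_ne (T : Theory V) {a : Ty} {c : V a} {b : Ty} {x : V b}
    (h : (⟨b, x⟩ : Σ b, V b) ≠ ⟨a, c⟩) : T.old c x = x := if_neg h

/-- The same theory with one more parameter `c`, about which nothing is assumed. -/
noncomputable def fresh (T : Theory V) {a : Ty} (c : V a) : Theory V where
  U b := {x | x ∈ T.U b ∨ (⟨b, x⟩ : Σ b, V b) = ⟨a, c⟩}
  inh b := (T.inh b).imp fun _ => Or.inl
  -- Every variable with value `c` is turned into the bound variable. The default value that `old`
  -- assigns to it is therefore never read.
  mem {Γ} φ e := (∀ b v, e b v ∈ T.U b ∨ (⟨b, e b v⟩ : Σ b, V b) = ⟨a, c⟩) ∧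
    T.mem (.all a (φ.ren fun b v => freshVar c (e b v) v)) (fun b v => T.old c (e b v))
  dom h := h.1
  ren {Γ Δ} r φ e he := by
    have hU : ∀ b v, T.old c (e b v) ∈ T.U b := by
      intro b v
      rw [old]
      split_ifs with h
      · exact (T.inh b).choose_spec
      · exact (he b v).resolve_right h
    have := T.ren r (.all a (φ.ren fun b v => freshVar c (e b (r b v)) v)) hU
    rw [Fm.ren_all, Fm.ren_ren] at this
    simp only [freshVar_ren] at this
    rw [← this, Fm.ren_ren]
    exact ⟨fun h => ⟨fun a v => he a _, h.2⟩, fun h => ⟨he, h.2⟩⟩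
  deriv {Γ H φ e} he hd hH := by
    have hU : ∀ b v, T.old c (e b v) ∈ T.U b := by
      intro b v
      rw [old]
      split_ifs with h
      · exact (T.inh b).choose_spec
      · exact (he b v).resolve_right h
    refine ⟨he, T.deriv hU (hd.ren fun b v => freshVar c (e b v) v).map_all ?_⟩
    simp only [List.map_map, List.mem_map, Function.comp]
    rintro _ ⟨ψ, hψ, rfl⟩
    exact (hH ψ hψ).2

/-- Since `c` is not a parameter of `T`, only the head variable has the value `c`, and the renaming
in the definition of `fresh` reduces to weakening under the binder. -/
theorem fresh_cons (T : Theory V) {a : Ty} {c : V a} (hc : c ∉ T.U a) {Γ : Ctx}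
    (φ : Fm (a :: Γ)) {e : Env V Γ} (he : ∀ b v, e b v ∈ T.U b) :
    (T.fresh c).mem φ (Env.cons c e) ↔ T.mem (.all a φ) e := by
  have hne : ∀ b v, (⟨b, e b v⟩ : Σ b, V b) ≠ ⟨a, c⟩ := by
    intro b v h
    have := he b v
    cases h
    exact hc this
  have h1 : (fun b (v : Var (a :: Γ) b) => freshVar c (Env.cons c e b v) v) =
      (Ren.wk Γ a).lift a := by
    funext b v
    cases v with
    | z => exact freshVar_self c _
    | s v => exact freshVar_of_ne (hne b v) _
  have hU : ∀ b v, T.old c (Env.cons c e b v) ∈ T.U b := by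
    intro b v
    rw [old]
    split_ifs with h
    · exact (T.inh b).choose_spec
    · cases v with
      | z => exact absurd rfl h
      | s v => exact he b v
  have h2 : (T.fresh c).mem φ (Env.cons c e) ↔
      T.mem (.all a (φ.ren fun b v => freshVar c (Env.cons c e b v) v))
        (fun b v => T.old c (Env.cons c e b v)) :=
    ⟨fun h => h.2, fun h => ⟨fun b v => by
      cases v with
      | z => exact .inr rfl
      | s v => exact .inl (he b v), h⟩⟩
  rw [h2, h1, ← Fm.ren_all, T.ren _ _ hU]
  have h3 : (fun b (v : Var Γ b) => T.old c (Env.cons c e b (Ren.wk Γ a b v))) = e := by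
    funext b v
    exact T.old_of_ne (hne b v)
  rw [h3]

/-- A formula without the fresh parameter is closed by a vacuous quantifier. -/
theorem le_fresh (T : Theory V) {a : Ty} {c : V a} (hc : c ∉ T.U a) : T.le (T.fresh c) := by
  refine ⟨fun b x hx => .inl hx, fun {Γ} φ e h => ?_⟩
  have he := T.dom h
  have h1 : (T.fresh c).mem (φ.wk a) (Env.cons c e) := by
    rw [T.fresh_cons hc _ he]
    exact T.deriv he (H := [φ]) (.allI (.hyp (by simp))) (by simpa using h)
  rw [Fm.wk_eq_ren, (T.fresh c).ren] at h1
  · exact h1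
  · intro b v
    cases v with
    | z => exact .inr rfl
    | s v => exact .inl (he b v)

/-- Adding a witness of an existential member is conservative. -/
theorem mem_of_witness (T : Theory V) {a : Ty} {c : V a} (hc : c ∉ T.U a) {Γ₀ Γ : Ctx}
    {φ : Fm (a :: Γ₀)} {e₀ : Env V Γ₀} (hφ : T.mem (.ex a φ) e₀) {χ : Fm Γ} {e : Env V Γ}
    (he : ∀ b v, e b v ∈ T.U b) (hU : ∀ b v, Env.cons c e₀ b v ∈ (T.fresh c).U b)
    (h : ((T.fresh c).add φ (Env.cons c e₀) hU).mem χ e) : T.mem χ e := by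
  have he₀ := T.dom hφ
  have hε : ∀ b v, e₀.append e b v ∈ T.U b :=
    Env.append_cases (P := fun a x => x ∈ T.U a) he₀ he
  have hε' : ∀ b v, Env.cons c (e₀.append e) b v ∈ (T.fresh c).U b :=
    Env.cons_cases (P := fun a x => x ∈ (T.fresh c).U a) (.inr rfl) fun b v => .inl (hε b v)
  -- In the joint context, `φ ⇒ χ` at a fresh `c` means that it holds for all values; since `χ` does
  -- not involve `c`, existential elimination applies.
  have hχ : T.mem (χ.ren (Ren.inr Γ₀ Γ)) (e₀.append e) := by
    have h1 : (T.fresh c).mem (φ.ren ((Ren.inl Γ₀ Γ).lift a) ⇒ (χ.ren (Ren.inr Γ₀ Γ)).wk a)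
        (Env.cons c (e₀.append e)) := by
      have h2 := h.2
      have h3 : Ren.inl (a :: Γ₀) Γ = (Ren.inl Γ₀ Γ).lift a := by
        funext b v
        cases v <;> rfl
      rw [h3] at h2
      rw [Fm.wk_eq_ren, Fm.ren_ren]
      exact h2
    rw [T.fresh_cons hc _ hε] at h1
    refine T.deriv₂ ?_ h1 (.exE_of_all (a := a) (φ := φ.ren ((Ren.inl Γ₀ Γ).lift a))
      (.hyp List.mem_cons_self) (.hyp (by simp)))
    rw [← Fm.ren_ex, T.ren _ _ hε]
    simpa only [Env.append_inl] using hφ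
  rw [T.ren _ _ hε] at hχ
  simpa only [Env.append_inr] using hχ

end Theory
end BISH
end

section
namespace BISH

/-! ## Saturated theories -/

/-- Parameters, closed under the formation of witnesses for existential formulas. -/
inductive Wit (V : Ty → Type) : Ty → Type
  | base {a : Ty} (v : V a) : Wit V a
  | wit {a : Ty} {Γ : Ctx} (φ : Fm (a :: Γ)) (e : ∀ b, Var Γ b → Wit V b) : Wit V a

namespace Theory
variable {V : Ty → Type}

instance : Std.Refl (le (V := V)) := ⟨le_refl⟩

/-- Contexts are finite, so finitely many comparisons in the chain suffice. The same compactness for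
assumption lists makes the union of a chain deductively closed. -/
theorem exists_mem_chain {c : Set (Theory V)} (hc : IsChain le c) (hne : c.Nonempty) {Γ : Ctx}
    {e : Env V Γ} (he : ∀ a v, ∃ T ∈ c, e a v ∈ T.U a) : ∃ T ∈ c, ∀ a v, e a v ∈ T.U a := by
  induction Γ with
  | nil =>
    obtain ⟨T, hT⟩ := hne
    exact ⟨T, hT, fun a v => nomatch v⟩
  | cons b Γ ih =>
    obtain ⟨T, hT, h⟩ := ih (e := fun a v => e a (.s v)) fun a v => he a (.s v)
    obtain ⟨T', hT', h'⟩ := he b .z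
    obtain ⟨T'', hT'', h1, h2⟩ := hc.directedOn T hT T' hT'
    refine ⟨T'', hT'', fun a v => ?_⟩
    cases v with
    | z => exact h2.1 _ h'
    | s v => exact h1.1 _ (h a v)

theorem exists_mem_chain_list {c : Set (Theory V)} (hc : IsChain le c) {T : Theory V}
    (hT : T ∈ c) {Γ : Ctx} {e : Env V Γ} {H : List (Fm Γ)} (hH : ∀ ψ ∈ H, ∃ T ∈ c, T.mem ψ e) :
    ∃ T' ∈ c, T.le T' ∧ ∀ ψ ∈ H, T'.mem ψ e := by
  induction H with
  | nil => exact ⟨T, hT, T.le_refl, by simp⟩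
  | cons φ H ih =>
    obtain ⟨T₁, hT₁, hle, h1⟩ := ih fun ψ hψ => hH ψ (List.mem_cons_of_mem _ hψ)
    obtain ⟨T₂, hT₂, h2⟩ := hH φ List.mem_cons_self
    obtain ⟨T₃, hT₃, h13, h23⟩ := hc.directedOn T₁ hT₁ T₂ hT₂
    refine ⟨T₃, hT₃, Theory.le_trans hle h13, fun ψ hψ => ?_⟩
    rcases List.mem_cons.1 hψ with rfl | hψ
    · exact h23.2 _ _ h2
    · exact h13.2 _ _ (h1 ψ hψ)

/-- The union of a chain. -/
def union (c : Set (Theory V)) (hc : IsChain le c) (hne : c.Nonempty) : Theory V where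
  U a := {x | ∃ T ∈ c, x ∈ T.U a}
  inh a := by
    obtain ⟨T, hT⟩ := hne
    obtain ⟨x, hx⟩ := T.inh a
    exact ⟨x, T, hT, hx⟩
  mem φ e := ∃ T ∈ c, T.mem φ e
  dom := fun ⟨T, hT, h⟩ a v => ⟨T, hT, T.dom h a v⟩
  ren {Γ Δ} r φ e he := by
    obtain ⟨T, hT, hTe⟩ := exists_mem_chain hc hne he
    constructor
    · rintro ⟨T', hT', h⟩
      exact ⟨T', hT', (T'.ren r φ (T'.dom h)).1 h⟩
    · rintro ⟨T', hT', h⟩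
      obtain ⟨T'', hT'', h1, h2⟩ := hc.directedOn T hT T' hT'
      exact ⟨T'', hT'', (T''.ren r φ fun a v => h1.1 _ (hTe a v)).2 (h2.2 _ _ h)⟩
  deriv {Γ H φ e} he hd hH := by
    obtain ⟨T, hT, hTe⟩ := exists_mem_chain hc hne he
    obtain ⟨T', hT', hle, h⟩ := exists_mem_chain_list hc hT hH
    exact ⟨T', hT', T'.deriv (fun a v => hle.1 _ (hTe a v)) hd h⟩

theorem mem_of_mem_bot (T : Theory V) {Γ Δ : Ctx} {e : Env V Γ} (h : T.mem .bot e) {χ : Fm Δ}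
    {e' : Env V Δ} (he' : ∀ a v, e' a v ∈ T.U a) : T.mem χ e' := by
  have hε := Env.append_cases (P := fun a x => x ∈ T.U a) (T.dom h) he'
  have h1 : T.mem (Fm.ren (Ren.inl Γ Δ) .bot) (e.append e') := by
    rw [T.ren _ _ hε]
    simpa only [Env.append_inl] using h
  have h2 : T.mem (χ.ren (Ren.inr Γ Δ)) (e.append e') :=
    T.deriv₁ h1 (.botE (.hyp (List.mem_singleton.2 rfl)))
  rw [T.ren _ _ hε] at h2
  simpa only [Env.append_inr] using h2

/-- Every formula that is not in a theory is avoided by some extension with the disjunction and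
existence properties. -/
theorem exists_saturated (T₀ : Theory (Wit V))
    (hwit : ∀ {a : Ty} {Γ : Ctx} (φ : Fm (a :: Γ)) (e : Env (Wit V) Γ), Wit.wit φ e ∈ T₀.U a →
      T₀.mem φ (Env.cons (Wit.wit φ e) e)) {Γ₀ : Ctx} {χ : Fm Γ₀} {e₀ : Env (Wit V) Γ₀}
    (he₀ : ∀ a v, e₀ a v ∈ T₀.U a) (hχ : ¬ T₀.mem χ e₀) :
    ∃ T : Theory (Wit V), T₀.le T ∧ ¬ T.mem χ e₀ ∧
      (∀ {Γ : Ctx} (φ ψ : Fm Γ) (e : Env (Wit V) Γ), T.mem (φ ⩔ ψ) e → T.mem φ e ∨ T.mem ψ e) ∧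
      ∀ {Γ : Ctx} {a : Ty} (φ : Fm (a :: Γ)) (e : Env (Wit V) Γ), T.mem (.ex a φ) e →
        ∃ x ∈ T.U a, T.mem φ (Env.cons x e) := by
  -- Zorn's lemma on the extensions that avoid `χ` and in which every witness name already in use
  -- satisfies the formula it is named after. Because of the last condition, a name found in a
  -- maximal theory is at once a witness.
  let Good := {T : Theory (Wit V) // T₀.le T ∧ ¬ T.mem χ e₀ ∧
    ∀ {a : Ty} {Γ : Ctx} (φ : Fm (a :: Γ)) (e : Env (Wit V) Γ), Wit.wit φ e ∈ T.U a →
      T.mem φ (Env.cons (Wit.wit φ e) e)}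
  obtain ⟨⟨M, hM0, hMχ, hMw⟩, hmax⟩ := exists_maximal_of_chains_bounded
    (r := fun T T' : Good => T.1.le T'.1) (by
      intro c hc
      rcases c.eq_empty_or_nonempty with rfl | hne
      · exact ⟨⟨T₀, T₀.le_refl, hχ, hwit⟩, by simp⟩
      have hc' : IsChain le (Subtype.val '' c) := by
        rintro _ ⟨T, hT, rfl⟩ _ ⟨T', hT', rfl⟩ hn
        exact hc hT hT' fun h => hn (congrArg _ h)
      refine ⟨⟨union _ hc' (hne.image _), ?_, ?_, ?_⟩, ?_⟩
      · obtain ⟨T, hT⟩ := hne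
        exact ⟨fun a x hx => ⟨T.1, ⟨T, hT, rfl⟩, T.2.1.1 _ hx⟩,
          fun φ e h => ⟨T.1, ⟨T, hT, rfl⟩, T.2.1.2 _ _ h⟩⟩
      · rintro ⟨_, ⟨T, hT, rfl⟩, h⟩
        exact T.2.2.1 h
      · rintro a Γ φ e ⟨_, ⟨T, hT, rfl⟩, h⟩
        exact ⟨T.1, ⟨T, hT, rfl⟩, T.2.2.2 φ e h⟩
      · exact fun T hT => ⟨fun a x hx => ⟨T.1, ⟨T, hT, rfl⟩, hx⟩,
          fun φ e h => ⟨T.1, ⟨T, hT, rfl⟩, h⟩⟩)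
    fun {T T' T''} h h' => Theory.le_trans h h'
  have heM : ∀ a v, e₀ a v ∈ M.U a := fun a v => hM0.1 _ (he₀ a v)
  refine ⟨M, hM0, hMχ, fun {Γ} φ ψ e h => ?_, fun {Γ a} φ e h => ?_⟩
  · have he := M.dom h
    by_contra! hn
    -- By maximality, adding a nonmember must produce `χ`. If neither disjunct were a member, both
    -- would imply `χ`, and disjunction elimination would put `χ` into `M`.
    have key : ∀ φ : Fm Γ, ¬ M.mem φ e → (M.add φ e he).mem χ e₀ := by
      intro φ hφ
      by_contra hχ'
      refine hφ ((hmax ⟨M.add φ e he, Theory.le_trans hM0 (M.le_add φ e he), hχ', fun ψ e' hw => ?_⟩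
        (M.le_add φ e he)).2 _ _ (M.mem_add_self φ e he))
      exact (M.le_add φ e he).2 _ _ (hMw ψ e' hw)
    have h1 := (key φ hn.1).2
    have h2 := (key ψ hn.2).2
    have hε := Env.append_cases (P := fun a x => x ∈ M.U a) he heM
    have h3 : M.mem ((φ ⩔ ψ).ren (Ren.inl Γ Γ₀)) (e.append e₀) := by
      rw [M.ren _ _ hε]
      simpa only [Env.append_inl] using h
    have h4 : M.mem (χ.ren (Ren.inr Γ Γ₀)) (e.append e₀) := by
      have hd : ∀ {Δ : Ctx} (φ ψ χ : Fm Δ), Deriv [φ ⩔ ψ, φ ⇒ χ, ψ ⇒ χ] χ := fun φ ψ χ =>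
        .orE (φ := φ) (ψ := ψ) (.hyp (by simp)) (.impE (φ := φ) (.hyp (by simp)) (.hyp (by simp)))
          (.impE (φ := ψ) (.hyp (by simp)) (.hyp (by simp)))
      refine M.deriv hε (hd (φ.ren (Ren.inl Γ Γ₀)) (ψ.ren (Ren.inl Γ Γ₀)) _) ?_
      simp only [List.mem_cons, List.not_mem_nil, or_false, forall_eq_or_imp, forall_eq]
      exact ⟨h3, h1, h2⟩
    rw [M.ren _ _ hε] at h4
    exact hMχ (by simpa only [Env.append_inr] using h4)
  · have he := M.dom h
    by_cases hc : Wit.wit φ e ∈ M.U a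
    · exact ⟨_, hc, hMw φ e hc⟩
    exfalso
    have hU : ∀ b v, Env.cons (Wit.wit φ e) e b v ∈ (M.fresh (Wit.wit φ e)).U b :=
      Env.cons_cases (P := fun b x => x ∈ (M.fresh (Wit.wit φ e)).U b) (.inr rfl)
        fun b v => .inl (he b v)
    -- Introducing the canonical name together with its formula is conservative, so the larger
    -- theory still avoids `χ`; maximality then contradicts the name being new.
    have hle := Theory.le_trans (M.le_fresh hc) ((M.fresh (Wit.wit φ e)).le_add φ _ hU)
    refine hc ((hmax ⟨(M.fresh (Wit.wit φ e)).add φ _ hU, Theory.le_trans hM0 hle,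
      fun h' => hMχ (M.mem_of_witness hc h heM hU h'), fun {b Δ} ψ e' hw => ?_⟩ hle).1 a (.inr rfl))
    rcases hw with hw | hw
    · exact hle.2 _ _ (hMw ψ e' hw)
    · cases hw
      exact mem_add_self _ _ _ _

end Theory
end BISH
end

section
namespace BISH

/-! ## Worlds -/

/-- Sets with an interpretation of the constants and of application. -/
structure Interp where
  D : Ty → Type
  const : ∀ {a : Ty}, Const a → D a
  app : ∀ {a b : Ty}, D (a.fn b) → D a → D b

def Tm.eval (I : Interp) {Γ : Ctx} (e : Env I.D Γ) : ∀ {a : Ty}, Tm Γ a → I.D a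
  | _, .var v => e _ v
  | _, .const c => I.const c
  | _, .app f x => I.app (f.eval I e) (x.eval I e)

/-- A deductively closed theory with the disjunction and existence properties, in which provably
equal elements are equal. -/
structure World extends Interp where
  sat : ∀ {Γ : Ctx}, Fm Γ → Env D Γ → Prop
  sat_ren : ∀ {Γ Δ : Ctx} (r : Ren Γ Δ) (φ : Fm Γ) (e : Env D Δ),
    sat (φ.ren r) e ↔ sat φ fun a v => e a (r a v)
  sat_deriv : ∀ {Γ : Ctx} {H : List (Fm Γ)} {φ : Fm Γ} {e : Env D Γ}, Deriv H φ →
    (∀ ψ ∈ H, sat ψ e) → sat φ e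
  sat_eq : ∀ {Γ : Ctx} {a : Ty} (s t : Tm Γ a) (e : Env D Γ),
    sat (.eq a s t) e ↔ s.eval toInterp e = t.eval toInterp e
  sat_bot : ∀ {Γ : Ctx} (e : Env D Γ), ¬ sat .bot e
  sat_or : ∀ {Γ : Ctx} (φ ψ : Fm Γ) (e : Env D Γ), sat (φ ⩔ ψ) e ↔ sat φ e ∨ sat ψ e
  sat_ex : ∀ {Γ : Ctx} {a : Ty} (φ : Fm (a :: Γ)) (e : Env D Γ),
    sat (.ex a φ) e ↔ ∃ d, sat φ (Env.cons d e)

/-- A term of type `a`. -/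
def Ty.term : ∀ (Γ : Ctx) (a : Ty), Tm Γ a
  | _, .nat => zeroN
  | _, .rat => zeroQ
  | _, .real => zeroR
  | _, .sp i => vzero i
  | Γ, .prod a b => .app (.app (.const (.pair a b)) (a.term Γ)) (b.term Γ)
  | Γ, .fn a b => .app (.const (.K b a)) (b.term Γ)

namespace Theory
variable {V : Ty → Type} (T : Theory V)

theorem up {Γ Δ : Ctx} {φ : Fm Γ} {e : Env V Γ} {e' : Env V Δ} (h : T.mem φ e) (r : Ren Γ Δ)
    (he' : ∀ a v, e' a v ∈ T.U a) (hr : (fun a v => e' a (r a v)) = e) : T.mem (φ.ren r) e' := by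
  rwa [T.ren r φ he', hr]

def eqv {a : Ty} (x y : V a) : Prop :=
  T.mem (.eq a (.var .z) (.var (.s .z))) (Env.cons x (Env.cons y Env.nil))

theorem mem_eq_var {Γ : Ctx} {e : Env V Γ} (he : ∀ a v, e a v ∈ T.U a) {a : Ty} (u v : Var Γ a) :
    T.mem (.eq a (.var u) (.var v)) e ↔ T.eqv (e a u) (e a v) := by
  have := T.ren (Env.cons (D := Var Γ) u (Env.cons v Env.nil))
    (.eq a (.var .z) (.var (.s .z))) he
  rw [Env.map_cons e, Env.map_cons e, Env.nil_eq fun b v => e b _] at this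
  exact this

theorem cons_mem {Γ : Ctx} {e : Env V Γ} (he : ∀ a v, e a v ∈ T.U a) {a : Ty} {x : V a}
    (hx : x ∈ T.U a) : ∀ b v, Env.cons x e b v ∈ T.U b :=
  Env.cons_cases (P := fun b x => x ∈ T.U b) hx he

theorem nil_mem : ∀ b v, (Env.nil : Env V []) b v ∈ T.U b := fun _ v => nomatch v

theorem eqv_refl {a : Ty} {x : V a} (hx : x ∈ T.U a) : T.eqv x x :=
  (T.mem_eq_var (T.cons_mem T.nil_mem hx) .z .z).1 (T.deriv (T.cons_mem T.nil_mem hx)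
    (H := []) (.eqI _) (by simp))

theorem eqv_symm {a : Ty} {x y : V a} (h : T.eqv x y) : T.eqv y x :=
  (T.mem_eq_var (T.dom h) (.s .z) .z).1 (T.deriv₁ h (Deriv.eq_symm (.hyp List.mem_cons_self)))

theorem eqv_trans {a : Ty} {x y z : V a} (h : T.eqv x y) (h' : T.eqv y z) : T.eqv x z := by
  have hU : ∀ b v, Env.cons x (Env.cons y (Env.cons z Env.nil)) b v ∈ T.U b :=
    T.cons_mem (T.dom h') (T.dom h a .z)
  exact (T.mem_eq_var hU .z (.s (.s .z))).1 (T.deriv₂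
    ((T.mem_eq_var hU .z (.s .z)).2 h) ((T.mem_eq_var hU (.s .z) (.s (.s .z))).2 h')
    (Deriv.eq_trans (.hyp List.mem_cons_self) (.hyp (by simp))))

theorem mem_cons_of_eqv {Γ : Ctx} {a : Ty} {φ : Fm (a :: Γ)} {x y : V a} {e : Env V Γ}
    (hxy : T.eqv x y) (h : T.mem φ (Env.cons x e)) : T.mem φ (Env.cons y e) := by
  have hy : y ∈ T.U a := T.dom hxy a (.s .z)
  have hU : ∀ b v, Env.cons y (Env.cons x e) b v ∈ T.U b := T.cons_mem (T.dom h) hy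
  let r : Ren (a :: Γ) (a :: a :: a :: Γ) := Env.cons (D := Var (a :: a :: a :: Γ)) .z
    fun b v => .s (.s (.s v))
  let q (u : Var (a :: a :: Γ) a) : Ren (a :: Γ) (a :: a :: Γ) :=
    Env.cons (D := Var (a :: a :: Γ)) u fun b v => .s (.s v)
  have hq : ∀ u, (φ.ren r).inst (.var u) = φ.ren (q u) := by
    intro u
    simp only [Fm.inst, Fm.ren, Fm.subst_subst]
    congr 1
    exact Sub.ext_cons rfl fun b v => rfl
  have hm : ∀ u, T.mem (φ.ren (q u)) (Env.cons y (Env.cons x e)) ↔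
      T.mem φ (Env.cons (Env.cons y (Env.cons x e) a u) e) := by
    intro u
    rw [T.ren _ _ hU, Env.map_cons (Env.cons y (Env.cons x e))]
    rfl
  refine (hm .z).1 (T.deriv₂ ((T.mem_eq_var hU (.s .z) .z).2 hxy) ((hm (.s .z)).2 h) ?_)
  have := Deriv.eqE (H := [.eq a (.var (.s .z)) (.var .z), φ.ren (q (.s .z))]) (φ.ren r)
    (.hyp List.mem_cons_self)
  rw [hq, hq] at this
  exact this (.hyp (by simp))

/-- Leibniz's rule replaces only the value of the head variable. After each replacement that
variable is moved into `Δ`, which exposes the next one; this is why the induction is generalized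
over `Δ`. -/
theorem mem_append_of_eqv {Γ Δ : Ctx} {φ : Fm (Γ ++ Δ)} {e e' : Env V Γ} {d : Env V Δ}
    (hd : ∀ a v, d a v ∈ T.U a) (hee : ∀ a v, T.eqv (e a v) (e' a v))
    (h : T.mem φ (e.append d)) : T.mem φ (e'.append d) := by
  induction Γ generalizing Δ with
  | nil => exact h
  | cons a Γ ih =>
    have he' : ∀ b v, e' b v ∈ T.U b := fun b v => T.dom (hee b v) b (.s .z)
    have he : ∀ b v, e b v ∈ T.U b := fun b v => T.dom (hee b v) b .z
    have h1 : T.mem φ (Env.cons (e' a .z) (Env.append (fun b v => e b (.s v)) d)) :=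
      T.mem_cons_of_eqv (hee a .z) h
    let r : Ren (a :: (Γ ++ Δ)) (Γ ++ (a :: Δ)) :=
      Env.cons (D := Var (Γ ++ (a :: Δ))) (Ren.inr Γ (a :: Δ) a .z)
        (Env.append (D := Var (Γ ++ (a :: Δ))) (Ren.inl Γ (a :: Δ))
          fun b v => Ren.inr Γ (a :: Δ) b (.s v))
    have hr : ∀ f : Env V Γ, (fun b v => f.append (Env.cons (e' a .z) d) b (r b v)) =
        Env.cons (e' a .z) (f.append d) := by
      intro f
      have := Env.map_append (D' := V) (f.append (Env.cons (e' a .z) d))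
        (Ren.inl Γ (a :: Δ)) fun b v => Ren.inr Γ (a :: Δ) b (.s v)
      simp only [Env.append_inl, Env.append_inr] at this
      rw [Env.map_cons (f.append (Env.cons (e' a .z) d)), Env.append_inr]
      exact congrArg _ this
    have h2 := ih (e := fun b v => e b (.s v)) (e' := fun b v => e' b (.s v))
      (T.cons_mem hd (he' a .z)) (fun b v => hee b (.s v)) (T.up h1 r
        (Env.append_cases (P := fun b x => x ∈ T.U b) (fun b v => he b (.s v))
          (T.cons_mem hd (he' a .z))) (hr _))
    rw [T.ren r φ (T.dom h2), hr] at h2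
    exact h2

theorem mem_of_eqv {Γ : Ctx} {φ : Fm Γ} {e e' : Env V Γ} (hee : ∀ a v, T.eqv (e a v) (e' a v))
    (h : T.mem φ e) : T.mem φ e' := by
  have he' : ∀ b v, e' b v ∈ T.U b := fun b v => T.dom (hee b v) b (.s .z)
  have hU : ∀ {e : Env V Γ}, (∀ b v, e b v ∈ T.U b) →
      ∀ b v, e.append Env.nil b v ∈ T.U b := fun he =>
    Env.append_cases (P := fun b x => x ∈ T.U b) he T.nil_mem
  have h1 := T.mem_append_of_eqv T.nil_mem hee (T.up (e' := e.append Env.nil) h (Ren.inl Γ [])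
    (hU (T.dom h)) (by simp only [Env.append_inl]))
  rw [T.ren _ _ (hU he')] at h1
  simpa only [Env.append_inl] using h1

/-- `x` is a value of the term `t`. -/
def isVal {Γ : Ctx} (e : Env V Γ) {a : Ty} (t : Tm Γ a) (x : V a) : Prop :=
  T.mem (.eq a (.var .z) (t.wk a)) (Env.cons x e)

variable {T}

theorem isVal.ren {Γ Δ : Ctx} {e : Env V Γ} {e' : Env V Δ} {a : Ty} {t : Tm Γ a} {x : V a}
    (h : T.isVal e t x) (he' : ∀ a v, e' a v ∈ T.U a) (r : Ren Γ Δ)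
    (hr : (fun a v => e' a (r a v)) = e) (u : Var Δ a) (hu : e' a u = x) :
    T.mem (.eq a (.var u) (t.subst r.toSub)) e' := by
  have := T.up h (Env.cons (D := Var Δ) u r) he' (by rw [Env.map_cons e', hr, hu])
  simp only [Fm.ren, Fm.subst, Tm.wk, Tm.subst_subst] at this
  exact this

theorem mem_eq_iff_of_isVal {Γ : Ctx} {e : Env V Γ} {a : Ty} {s t : Tm Γ a} {x y : V a}
    (hx : T.isVal e s x) (hy : T.isVal e t y) : T.mem (.eq a s t) e ↔ T.eqv x y := by
  have he : ∀ b v, e b v ∈ T.U b := fun b v => T.dom hx b (.s v)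
  have hU : ∀ b v, Env.cons x (Env.cons y e) b v ∈ T.U b := T.cons_mem (T.dom hy) (T.dom hx a .z)
  let r : Ren Γ (a :: a :: Γ) := fun b v => .s (.s v)
  have h1 := hx.ren hU r rfl .z rfl
  have h2 := hy.ren hU r rfl (.s .z) rfl
  have h3 := T.ren r (.eq a s t) hU
  rw [show (fun b v => Env.cons x (Env.cons y e) b (r b v)) = e from rfl] at h3
  have h4 : _ ↔ T.eqv x y := T.mem_eq_var hU .z (.s .z)
  rw [← h3, ← h4]
  constructor
  · intro h
    refine T.deriv hU (H := [_, _, _]) (Deriv.eq_trans (t := s.subst r.toSub) (.hyp ?_)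
      (.eq_trans (t := t.subst r.toSub) (.hyp ?_) (.eq_symm (.hyp ?_)))) (by
        simp only [List.mem_cons, List.not_mem_nil, or_false, forall_eq_or_imp, forall_eq]
        exact ⟨h1, h2, h⟩)
    · simp
    · simp [Fm.ren, Fm.subst]
    · simp
  · intro h
    refine T.deriv hU (H := [_, _, _]) (Deriv.eq_trans (t := .var .z) (.eq_symm (.hyp ?_))
      (.eq_trans (t := .var (.s .z)) (.hyp ?_) (.hyp ?_))) (by
        simp only [List.mem_cons, List.not_mem_nil, or_false, forall_eq_or_imp, forall_eq]
        exact ⟨h1, h2, h⟩)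
    · simp
    · simp
    · simp

theorem isVal.eqv {Γ : Ctx} {e : Env V Γ} {a : Ty} {t : Tm Γ a} {x y : V a}
    (hx : T.isVal e t x) (hy : T.isVal e t y) : T.eqv x y :=
  (mem_eq_iff_of_isVal hx hy).1
    (T.deriv (fun b v => T.dom hx b (.s v)) (H := []) (.eqI t) (by simp))

theorem isVal.app {Γ : Ctx} {e : Env V Γ} {a b : Ty} {f : Tm Γ (a.fn b)} {t : Tm Γ a}
    {g : V (a.fn b)} {x : V a} {y : V b} (hf : T.isVal e f g) (ht : T.isVal e t x)
    (hy : T.isVal (Env.cons g (Env.cons x Env.nil)) (.app (.var .z) (.var (.s .z))) y) :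
    T.isVal e (.app f t) y := by
  have hU : ∀ c v, Env.cons y (Env.cons g (Env.cons x e)) c v ∈ T.U c :=
    T.cons_mem (T.cons_mem (T.dom ht) (T.dom hf _ .z)) (T.dom hy b .z)
  let r : Ren Γ (b :: a.fn b :: a :: Γ) := fun c v => .s (.s (.s v))
  let q : Ren [a.fn b, a] (b :: a.fn b :: a :: Γ) :=
    Env.cons (D := Var (b :: a.fn b :: a :: Γ)) (.s .z) (Env.cons (.s (.s .z)) Env.nil)
  have h1 := hf.ren hU r rfl (.s .z) rfl
  have h2 := ht.ren hU r rfl (.s (.s .z)) rfl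
  have h3 := hy.ren hU q (by
    rw [Env.map_cons (Env.cons y (Env.cons g (Env.cons x e))),
      Env.map_cons (Env.cons y (Env.cons g (Env.cons x e))), Env.nil_eq fun c v => _]
    rfl) .z rfl
  have h4 : T.mem (.eq b (.var .z) (.app (f.subst r.toSub) (t.subst r.toSub)))
      (Env.cons y (Env.cons g (Env.cons x e))) := by
    refine T.deriv hU (H := [_, _, _]) (Deriv.eq_trans
      (t := .app (.var (.s .z)) (.var (.s (.s .z)))) (.hyp ?_) (.eq_app (.hyp ?_) (.hyp ?_))) (by
      simp only [List.mem_cons, List.not_mem_nil, or_false, forall_eq_or_imp, forall_eq]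
      exact ⟨h1, h2, h3⟩)
    · simp only [List.mem_cons]
      exact .inr (.inr (.inl rfl))
    · simp
    · simp
  have := (T.ren (Env.cons (D := Var (b :: a.fn b :: a :: Γ)) .z r)
    (.eq b (.var .z) ((Tm.app f t).wk b)) hU).1 (by
      simp only [Fm.ren, Fm.subst, Tm.wk, Tm.subst_subst, Tm.subst]
      exact h4)
  rwa [Env.map_cons (Env.cons y (Env.cons g (Env.cons x e)))] at this

end Theory
end BISH
end

/-! ### The world of a saturated theory, and completeness -/

section
namespace BISH

namespace Theory
variable {V : Ty → Type} (T : Theory V)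

/-- The parameters up to provable equality. -/
def setoid (a : Ty) : Setoid {x : V a // x ∈ T.U a} where
  r x y := T.eqv x.1 y.1
  iseqv := ⟨fun x => T.eqv_refl x.2, T.eqv_symm, T.eqv_trans⟩

abbrev Q (a : Ty) : Type := Quotient (T.setoid a)

def toQ {a : Ty} (x : V a) (hx : x ∈ T.U a) : T.Q a := Quotient.mk (T.setoid a) ⟨x, hx⟩

noncomputable def out {a : Ty} (x : T.Q a) : V a := (Quotient.out x).1

theorem out_mem {a : Ty} (x : T.Q a) : T.out x ∈ T.U a := (Quotient.out x).2

theorem out_cons {Γ : Ctx} {a : Ty} (x : T.Q a) (e : Env T.Q Γ) :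
    (fun b v => T.out (Env.cons x e b v)) = Env.cons (T.out x) fun b v => T.out (e b v) := by
  funext b v
  cases v <;> rfl

theorem eqv_out_toQ {a : Ty} {x : V a} (hx : x ∈ T.U a) : T.eqv (T.out (T.toQ x hx)) x :=
  Quotient.mk_out (s := T.setoid a) ⟨x, hx⟩

theorem eq_of_eqv {a : Ty} {x y : T.Q a} (h : T.eqv (T.out x) (T.out y)) : x = y := by
  have := Quotient.sound (s := T.setoid a) (a := Quotient.out x) (b := Quotient.out y) h
  simpa using this

theorem eqv_out_iff {a : Ty} {x y : T.Q a} : T.eqv (T.out x) (T.out y) ↔ x = y :=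
  ⟨T.eq_of_eqv, fun h => h ▸ T.eqv_refl (T.out_mem x)⟩

variable {T} (hex : ∀ {Γ : Ctx} {a : Ty} (φ : Fm (a :: Γ)) (e : Env V Γ), T.mem (.ex a φ) e →
  ∃ x ∈ T.U a, T.mem φ (Env.cons x e))

/-- Reflexivity derives that something equals `t`, and the existence property names it. The
parameters themselves need not be closed under term formation. -/
theorem exists_isVal (hex : ∀ {Γ : Ctx} {a : Ty} (φ : Fm (a :: Γ)) (e : Env V Γ),
    T.mem (.ex a φ) e → ∃ x ∈ T.U a, T.mem φ (Env.cons x e)) {Γ : Ctx} {a : Ty} (t : Tm Γ a) (e : Env T.Q Γ) :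
    ∃ x : T.Q a, T.isVal (fun b v => T.out (e b v)) t (T.out x) := by
  have he : ∀ b v, T.out (e b v) ∈ T.U b := fun b v => T.out_mem _
  have h : T.mem (.ex a (.eq a (.var .z) (t.wk a))) (fun b v => T.out (e b v)) := by
    refine T.deriv he (H := []) (.exI t ?_) (by simp)
    simp only [Fm.inst, Fm.subst, Tm.wk_subst_cons, Tm.subst_id]
    exact .eqI t
  obtain ⟨x, hx, h⟩ := hex _ _ h
  exact ⟨T.toQ x hx, T.mem_cons_of_eqv (T.eqv_symm (T.eqv_out_toQ hx)) h⟩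

noncomputable def value {Γ : Ctx} {a : Ty} (t : Tm Γ a) (e : Env T.Q Γ) : T.Q a :=
  (exists_isVal hex t e).choose

theorem isVal_value {Γ : Ctx} {a : Ty} (t : Tm Γ a) (e : Env T.Q Γ) :
    T.isVal (fun b v => T.out (e b v)) t (T.out (value hex t e)) :=
  (exists_isVal hex t e).choose_spec

theorem eq_value_of_isVal {Γ : Ctx} {a : Ty} {t : Tm Γ a} {e : Env T.Q Γ} {x : T.Q a}
    (h : T.isVal (fun b v => T.out (e b v)) t (T.out x)) : value hex t e = x :=
  T.eq_of_eqv ((isVal_value hex t e).eqv h)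

noncomputable def interp : Interp where
  D := T.Q
  const c := value hex (.const c) Env.nil
  app {a b} f x := value hex (.app (.var .z : Tm [a.fn b, a] _) (.var (.s .z)))
    (Env.cons f (Env.cons x Env.nil))

/-- Values are unique up to provable equality, hence unique in the quotient, so evaluation built up
from constants and application agrees with the value assigned to the whole term. -/
theorem eval_interp {Γ : Ctx} {a : Ty} (t : Tm Γ a) (e : Env T.Q Γ) :
    t.eval (interp hex) e = value hex t e := by
  symm
  induction t with
  | var v =>
    refine eq_value_of_isVal hex (T.mem_eq_var (T.cons_mem (fun b v => T.out_mem _)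
      (T.out_mem _)) .z (.s v) |>.2 ?_)
    exact T.eqv_refl (T.out_mem _)
  | const c =>
    refine eq_value_of_isVal hex ?_
    have := isVal_value hex (.const c) Env.nil
    rw [Env.nil_eq fun b v => T.out _] at this
    exact T.up this (Env.cons (D := Var (_ :: _)) .z fun _ v => nomatch v)
      (T.cons_mem (fun b v => T.out_mem _) (T.out_mem _)) (by
        funext b v
        cases v with
        | z => rfl
        | s v => cases v)
  | app f x hf hx =>
    refine eq_value_of_isVal hex (Theory.isVal.app (isVal_value hex f e) (isVal_value hex x e) ?_)
    rw [hf, hx]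
    have := isVal_value hex (.app (.var .z : Tm [_, _] _) (.var (.s .z)))
      (Env.cons (f.eval (interp hex) e) (Env.cons (x.eval (interp hex) e) Env.nil))
    have h := (T.out_cons (f.eval (interp hex) e)
      (Env.cons (x.eval (interp hex) e) Env.nil)).trans (congrArg _ (T.out_cons _ _))
    rw [Env.nil_eq fun b v => T.out _] at h
    exact (congrArg (fun ε => T.isVal ε _ _) h).mp this

theorem mem_eq_iff {Γ : Ctx} {a : Ty} (s t : Tm Γ a) (e : Env T.Q Γ) :
    T.mem (.eq a s t) (fun b v => T.out (e b v)) ↔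
      s.eval (interp hex) e = t.eval (interp hex) e := by
  rw [eval_interp, eval_interp]
  exact (mem_eq_iff_of_isVal (isVal_value hex s e) (isVal_value hex t e)).trans T.eqv_out_iff

/-- The world of a saturated theory. -/
noncomputable def toWorld
    (hor : ∀ {Γ : Ctx} (φ ψ : Fm Γ) (e : Env V Γ), T.mem (φ ⩔ ψ) e → T.mem φ e ∨ T.mem ψ e)
    (hbot : ∀ {Γ : Ctx} (e : Env V Γ), ¬ T.mem .bot e) : World where
  toInterp := interp hex
  sat φ e := T.mem φ fun a v => T.out (e a v)
  sat_ren r φ e := T.ren r φ fun a v => T.out_mem _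
  sat_deriv hd hH := T.deriv (fun a v => T.out_mem _) hd hH
  sat_eq := mem_eq_iff hex
  sat_bot e := hbot _
  sat_or φ ψ e := ⟨hor φ ψ _, fun h => h.elim
    (fun h => T.deriv₁ h (.orI₁ (.hyp List.mem_cons_self)))
    fun h => T.deriv₁ h (.orI₂ (.hyp List.mem_cons_self))⟩
  sat_ex {Γ a} φ e := by
    constructor
    · intro h
      obtain ⟨x, hx, h⟩ := hex _ _ h
      refine ⟨T.toQ x hx, ?_⟩
      exact (congrArg (T.mem φ) (T.out_cons (T.toQ x hx) e)).mpr
        (T.mem_cons_of_eqv (T.eqv_symm (T.eqv_out_toQ hx)) h)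
    · rintro ⟨d, h⟩
      have h1 := T.deriv₁ h (Deriv.exI_wk (.hyp List.mem_cons_self))
      exact (T.ren (Ren.wk Γ a) (.ex a φ) fun b v => T.out_mem _).1 h1

end Theory

/-- Maps that preserve satisfaction. -/
structure World.Hom (w w' : World) where
  map : ∀ {a : Ty}, w.D a → w'.D a
  map_sat : ∀ {Γ : Ctx} {φ : Fm Γ} {e : Env w.D Γ}, w.sat φ e →
    w'.sat φ fun _ v => map (e _ v)

/-- A theory whose parameters are not witnesses. -/
def Theory.ofBase {V : Ty → Type} (inh : ∀ a, Nonempty (V a))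
    (mem : ∀ {Γ : Ctx}, Fm Γ → Env V Γ → Prop)
    (ren : ∀ {Γ Δ : Ctx} (r : Ren Γ Δ) (φ : Fm Γ) (e : Env V Δ),
      mem (φ.ren r) e ↔ mem φ fun a v => e a (r a v))
    (deriv : ∀ {Γ : Ctx} {H : List (Fm Γ)} {φ : Fm Γ} {e : Env V Γ}, Deriv H φ →
      (∀ ψ ∈ H, mem ψ e) → mem φ e) : Theory (Wit V) where
  U a := Set.range Wit.base
  inh a := (inh a).elim fun x => ⟨.base x, x, rfl⟩
  mem {Γ} φ e := ∃ e' : Env V Γ, mem φ e' ∧ e = fun a v => .base (e' a v)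
  dom := by
    rintro Γ φ e ⟨e', -, rfl⟩ a v
    exact ⟨_, rfl⟩
  ren {Γ Δ} r φ e he := by
    choose e' he' using he
    obtain rfl : e = fun a v => .base (e' a v) := by
      funext a v
      exact (he' a v).symm
    constructor
    · rintro ⟨e'', h, h'⟩
      exact ⟨fun a v => e'' a (r a v), (ren r φ e'').1 h, by
        funext a v
        exact congrFun (congrFun h' a) (r a v)⟩
    · rintro ⟨e'', h, h'⟩
      refine ⟨e', (ren r φ e').2 ?_, rfl⟩
      obtain rfl : (fun a v => e' a (r a v)) = e'' := by
        funext a v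
        exact Wit.base.inj (congrFun (congrFun h' a) v)
      exact h
  deriv {Γ H φ e} he hd hH := by
    choose e' he' using he
    obtain rfl : e = fun a v => .base (e' a v) := by
      funext a v
      exact (he' a v).symm
    refine ⟨e', deriv hd fun ψ hψ => ?_, rfl⟩
    obtain ⟨e'', h, h'⟩ := hH ψ hψ
    obtain rfl : e' = e'' := by
      funext a v
      exact Wit.base.inj (congrFun (congrFun h' a) v)
    exact h

/-- Every formula that is not in a theory fails in some world in which the theory holds. -/
theorem Theory.exists_world {V : Ty → Type} (T₀ : Theory (Wit V))
    (hwit : ∀ {a : Ty} {Γ : Ctx} (φ : Fm (a :: Γ)) (e : Env (Wit V) Γ), Wit.wit φ e ∈ T₀.U a →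
      T₀.mem φ (Env.cons (Wit.wit φ e) e)) {Γ₀ : Ctx} {χ : Fm Γ₀} {e₀ : Env (Wit V) Γ₀}
    (he₀ : ∀ a v, e₀ a v ∈ T₀.U a) (hχ : ¬ T₀.mem χ e₀) :
    ∃ (w : World) (g : ∀ a, Wit V a → w.D a),
      (∀ {Γ : Ctx} {φ : Fm Γ} {e : Env (Wit V) Γ}, T₀.mem φ e → w.sat φ fun a v => g a (e a v)) ∧
      ¬ w.sat χ fun a v => g a (e₀ a v) := by
  classical
  obtain ⟨T, hle, hT, hor, hex⟩ := T₀.exists_saturated hwit he₀ hχ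
  -- Outside the parameters of `T` the value is arbitrary; only parameters of `T₀` matter below.
  let g : ∀ a, Wit V a → T.Q a := fun a x =>
    if hx : x ∈ T.U a then T.toQ x hx else T.toQ (T.inh a).choose (T.inh a).choose_spec
  have hg : ∀ a x, x ∈ T.U a → T.eqv (T.out (g a x)) x := by
    intro a x hx
    simp only [g, dif_pos hx]
    exact T.eqv_out_toQ hx
  have he₀T : ∀ a v, e₀ a v ∈ T.U a := fun a v => hle.1 _ (he₀ a v)
  refine ⟨Theory.toWorld hex hor fun e h => hT (T.mem_of_mem_bot h he₀T), g, ?_, ?_⟩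
  · intro Γ φ e h
    have h1 := hle.2 _ _ h
    exact T.mem_of_eqv (fun a v => T.eqv_symm (hg _ _ (T.dom h1 a v))) h1
  · intro h
    exact hT (T.mem_of_eqv (fun a v => hg _ _ (he₀T a v)) h)

/-- Completeness. -/
theorem deriv_of_forall_sat {Γ : Ctx} {H : List (Fm Γ)} {φ : Fm Γ}
    (h : ∀ (w : World) (e : Env w.D Γ), (∀ ψ ∈ H, w.sat ψ e) → w.sat φ e) : Deriv H φ := by
  by_contra hd
  -- The Lindenbaum theory of `H`: its parameters are the terms over `Γ`, with each variable
  -- standing for itself. If `φ` is not derivable, it is not a member at this assignment and some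
  -- world refutes it.
  let T := Theory.ofBase (V := Tm Γ) (fun a => ⟨a.term Γ⟩) (fun ψ e => Deriv H (ψ.subst e))
    (fun r ψ e => by
      rw [Fm.ren, Fm.subst_subst]
      rfl)
    (fun {Δ G ψ e} hd hG => (hd.subst e).cut fun χ hχ => by
      obtain ⟨χ', hχ', rfl⟩ := List.mem_map.1 hχ
      exact hG χ' hχ')
  obtain ⟨w, g, h1, h2⟩ := T.exists_world (χ := φ) (e₀ := fun a v => .base (.var v)) (by
      rintro a Δ ψ e ⟨x, hx⟩
      cases hx) (fun a v => ⟨_, rfl⟩) (by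
      rintro ⟨e, he, h'⟩
      obtain rfl : e = Sub.id Γ := by
        funext a v
        exact (Wit.base.inj (congrFun (congrFun h' a) v)).symm
      rw [Fm.subst_id] at he
      exact hd he)
  refine h2 (h w _ fun ψ hψ => h1 ⟨Sub.id Γ, ?_, rfl⟩)
  change Deriv H (ψ.subst (Sub.id Γ))
  rw [Fm.subst_id]
  exact .hyp hψ

namespace World
variable (w : World)

theorem sat_and {Γ : Ctx} (φ ψ : Fm Γ) (e : Env w.D Γ) :
    w.sat (φ ⩓ ψ) e ↔ w.sat φ e ∧ w.sat ψ e := by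
  constructor
  · intro h
    exact ⟨w.sat_deriv (H := [φ ⩓ ψ]) (.andE₁ (.hyp List.mem_cons_self)) (by simpa using h),
      w.sat_deriv (H := [φ ⩓ ψ]) (.andE₂ (.hyp List.mem_cons_self)) (by simpa using h)⟩
  · intro h
    exact w.sat_deriv (H := [φ, ψ]) (.andI (.hyp (by simp)) (.hyp (by simp))) (by simpa using h)

theorem nonempty (a : Ty) : Nonempty (w.D a) := ⟨(a.term []).eval w.toInterp Env.nil⟩

/-- The theory of a world, with its elements as parameters. -/
def theory : Theory (Wit w.D) := Theory.ofBase w.nonempty w.sat w.sat_ren w.sat_deriv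

theorem theory_wit {a : Ty} {Γ : Ctx} (φ : Fm (a :: Γ)) (e : Env (Wit w.D) Γ) :
    Wit.wit φ e ∉ w.theory.U a := by
  rintro ⟨x, hx⟩
  cases hx

theorem mem_theory {Γ : Ctx} {φ : Fm Γ} {e : Env w.D Γ} :
    (w.theory.mem φ fun a v => .base (e a v)) ↔ w.sat φ e := by
  constructor
  · rintro ⟨e', h, h'⟩
    obtain rfl : e = e' := by
      funext a v
      exact Wit.base.inj (congrFun (congrFun h' a) v)
    exact h
  · exact fun h => ⟨e, h, rfl⟩

/-- From right to left: if the implication fails, the theory of `w` with `φ` added does not contain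
`ψ`, and a world refuting `ψ` over it receives a map from `w`. -/
theorem sat_imp {Γ : Ctx} (φ ψ : Fm Γ) (e : Env w.D Γ) : w.sat (φ ⇒ ψ) e ↔
    ∀ (w' : World) (f : w.Hom w'), w'.sat φ (fun _ v => f.map (e _ v)) →
      w'.sat ψ (fun _ v => f.map (e _ v)) := by
  constructor
  · intro h w' f h'
    exact w'.sat_deriv (H := [φ, φ ⇒ ψ]) (.impE (φ := φ) (.hyp (by simp)) (.hyp (by simp)))
      (by simpa using ⟨h', f.map_sat h⟩)
  · intro h
    by_contra hn
    let e' : Env (Wit w.D) Γ := fun a v => .base (e a v)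
    have he' : ∀ a v, e' a v ∈ w.theory.U a := fun a v => ⟨_, rfl⟩
    obtain ⟨w', g, h1, h2⟩ := (w.theory.add φ e' he').exists_world (χ := ψ) (e₀ := e')
      (fun φ e hw => absurd hw (w.theory_wit φ e)) he'
      (by rwa [w.theory.mem_add_iff _ _ _ he', w.mem_theory])
    refine h2 (h w' ⟨fun {a} x => g a (.base x), fun {Δ ψ e} hψ => ?_⟩ ?_)
    · exact h1 ((w.theory.le_add φ e' he').2 _ _ (w.mem_theory.2 hψ))
    · exact h1 (w.theory.mem_add_self φ e' he')

/-- If the universal statement fails, so does its instance at a fresh parameter added to the theory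
of `w`; a world refuting that instance contains the required counterexample. -/
theorem sat_all {Γ : Ctx} {a : Ty} (φ : Fm (a :: Γ)) (e : Env w.D Γ) : w.sat (.all a φ) e ↔
    ∀ (w' : World) (f : w.Hom w') (d : w'.D a),
      w'.sat φ (Env.cons d fun _ v => f.map (e _ v)) := by
  constructor
  · intro h w' f d
    have h1 := (w'.sat_ren (Ren.wk Γ a) _ (Env.cons d fun _ v => f.map (e _ v))).2 (f.map_sat h)
    exact w'.sat_deriv (H := [(Fm.all a φ).ren (Ren.wk Γ a)])
      (Deriv.allE_wk (.hyp List.mem_cons_self)) (by simpa using h1)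
  · intro h
    by_contra hn
    let e' : Env (Wit w.D) Γ := fun a v => .base (e a v)
    have he' : ∀ a v, e' a v ∈ w.theory.U a := fun a v => ⟨_, rfl⟩
    -- The fresh parameter is the name of a witness for $\exists x\,(x=x)$, so that the condition on
    -- names in `exists_world` holds by reflexivity.
    let c : Wit w.D a := Wit.wit (Γ := []) (.eq a (.var .z) (.var .z)) Env.nil
    have hc : c ∉ w.theory.U a := w.theory_wit _ _
    have hle := w.theory.le_fresh hc
    have hU : ∀ b v, Env.cons c e' b v ∈ (w.theory.fresh c).U b :=
      (w.theory.fresh c).cons_mem (fun b v => .inl (he' b v)) (.inr rfl)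
    obtain ⟨w', g, h1, h2⟩ := (w.theory.fresh c).exists_world (χ := φ) (e₀ := Env.cons c e')
      (by
        intro b Δ ψ e'' hw
        rcases hw with hw | hw
        · exact absurd hw (w.theory_wit _ _)
        · simp only [c, Sigma.mk.injEq] at hw
          obtain ⟨rfl, hw⟩ := hw
          cases hw
          exact (w.theory.fresh c).deriv (H := []) ((w.theory.fresh c).cons_mem
            (Theory.nil_mem _) (.inr rfl)) (.eqI _) (by simp))
      hU (by rwa [w.theory.fresh_cons hc _ he', w.mem_theory])
    refine h2 ?_
    rw [Env.map_cons g]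
    exact h w' ⟨fun {a} x => g a (.base x), fun {Δ ψ e} hψ =>
      h1 (hle.2 _ _ (w.mem_theory.2 hψ))⟩ (g a c)

end World
end BISH
end

section
namespace BISH

/-! ## Forcing -/

section
variable {D : Ty → Type} (I : Interp) {Γ : Ctx}

@[simp] theorem Tm.eval_var {a : Ty} (e : Env I.D Γ) (v : Var Γ a) :
    (Tm.var v).eval I e = e a v := rfl

@[simp] theorem Tm.eval_const {a : Ty} (e : Env I.D Γ) (c : Const a) :
    (Tm.const c : Tm Γ a).eval I e = I.const c := rfl

@[simp] theorem Tm.eval_app {a b : Ty} (e : Env I.D Γ) (f : Tm Γ (a.fn b)) (x : Tm Γ a) :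
    (Tm.app f x).eval I e = I.app (f.eval I e) (x.eval I e) := rfl

@[simp] theorem Env.cons_z {a : Ty} (d : D a) (e : Env D Γ) : Env.cons d e a .z = d := rfl

@[simp] theorem Env.cons_s {a b : Ty} (d : D a) (e : Env D Γ) (v : Var Γ b) :
    Env.cons d e b (.s v) = e b v := rfl

theorem Tm.eval_subst {Δ : Ctx} (σ : Sub Γ Δ) (e : Env I.D Δ) {a : Ty} (t : Tm Γ a) :
    (t.subst σ).eval I e = t.eval I fun b v => (σ b v).eval I e := by
  induction t with
  | var v => rfl
  | const c => rfl
  | app f x hf hx => simp only [Tm.subst, Tm.eval_app, hf, hx]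

@[simp] theorem Tm.eval_wk {a b : Ty} (t : Tm Γ a) (d : I.D b) (e : Env I.D Γ) :
    (t.wk b).eval I (Env.cons d e) = t.eval I e :=
  Tm.eval_subst I _ _ t

theorem Env.eval_lift {Δ : Ctx} (σ : Sub Γ Δ) (e : Env I.D Δ) {a : Ty} (d : I.D a) :
    (fun b v => (σ.lift a b v).eval I (Env.cons d e)) =
      Env.cons d fun b v => (σ b v).eval I e := by
  funext b v
  cases v with
  | z => rfl
  | s v => exact Tm.eval_wk I _ _ _

end

def nzero (w : World) : w.D .nat := w.const .zero
def nsucc {w : World} (n : w.D .nat) : w.D .nat := w.app (w.const .succ) n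

namespace World

attribute [simp] sat_eq sat_bot sat_or sat_and

namespace Hom
variable {w w' w'' : World}

def id (w : World) : w.Hom w := ⟨fun x => x, fun h => h⟩

def comp (f : w.Hom w') (g : w'.Hom w'') : w.Hom w'' :=
  ⟨fun x => g.map (f.map x), fun h => g.map_sat (f.map_sat h)⟩

def env (f : w.Hom w') {Γ : Ctx} (e : Env w.D Γ) : Env w'.D Γ := fun _ v => f.map (e _ v)

@[simp] theorem map_id {a : Ty} (x : w.D a) : (Hom.id w).map x = x := rfl

@[simp] theorem map_comp (f : w.Hom w') (g : w'.Hom w'') {a : Ty} (x : w.D a) :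
    (f.comp g).map x = g.map (f.map x) := rfl

@[simp] theorem env_nil (f : w.Hom w') : f.env Env.nil = Env.nil := Env.nil_eq _

@[simp] theorem env_cons (f : w.Hom w') {Γ : Ctx} {a : Ty} (d : w.D a) (e : Env w.D Γ) :
    f.env (Env.cons d e) = Env.cons (f.map d) (f.env e) := 
  Env.map_cons (fun a => f.map (a := a)) d e

@[simp] theorem env_id {Γ : Ctx} (e : Env w.D Γ) : (Hom.id w).env e = e := rfl

@[simp] theorem env_comp (f : w.Hom w') (g : w'.Hom w'') {Γ : Ctx} (e : Env w.D Γ) :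
    (f.comp g).env e = g.env (f.env e) := rfl

theorem sat (f : w.Hom w') {Γ : Ctx} {φ : Fm Γ} {e : Env w.D Γ} (h : w.sat φ e) :
    w'.sat φ (f.env e) := f.map_sat h

@[simp] theorem map_const (f : w.Hom w') {a : Ty} (c : Const a) :
    f.map (w.const c) = w'.const c := by
  have := f.sat (φ := .eq a (.var .z) (.const c)) (e := Env.cons (w.const c) Env.nil)
    (by simp)
  simpa using this

@[simp] theorem map_app (f : w.Hom w') {a b : Ty} (g : w.D (a.fn b)) (x : w.D a) :
    f.map (w.app g x) = w'.app (f.map g) (f.map x) := by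
  have := f.sat (φ := .eq b (.var .z) (.app (.var (.s .z)) (.var (.s (.s .z)))))
    (e := Env.cons (w.app g x) (Env.cons g (Env.cons x Env.nil))) (by simp)
  simpa using this

theorem map_eval (f : w.Hom w') {Γ : Ctx} (e : Env w.D Γ) {a : Ty} (t : Tm Γ a) :
    f.map (t.eval w.toInterp e) = t.eval w'.toInterp (f.env e) := by
  induction t with
  | var v => rfl
  | const c => exact f.map_const c
  | app g x hg hx => simp only [Tm.eval_app, map_app, hg, hx]

theorem env_eval (f : w.Hom w') {Γ Δ : Ctx} (σ : Sub Γ Δ) (e : Env w.D Δ) :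
    f.env (fun a v => (σ a v).eval w.toInterp e) =
      fun a v => (σ a v).eval w'.toInterp (f.env e) := by
  funext a v
  exact f.map_eval e _

end Hom

variable (w : World) {Γ : Ctx}

theorem sat_imp_iff {φ ψ : Fm Γ} {e : Env w.D Γ} : w.sat (φ ⇒ ψ) e ↔
    ∀ (w' : World) (f : w.Hom w'), w'.sat φ (f.env e) → w'.sat ψ (f.env e) := w.sat_imp φ ψ e

theorem sat_all_iff {a : Ty} {φ : Fm (a :: Γ)} {e : Env w.D Γ} : w.sat (.all a φ) e ↔
    ∀ (w' : World) (f : w.Hom w') (d : w'.D a), w'.sat φ (Env.cons d (f.env e)) :=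
  w.sat_all φ e

@[simp] theorem sat_Ex {a : Ty} {φ : Tm (a :: Γ) a → Fm (a :: Γ)} {e : Env w.D Γ} :
    w.sat (Ex a φ) e ↔ ∃ d, w.sat (φ (.var .z)) (Env.cons d e) := w.sat_ex _ _

theorem sat_All {a : Ty} {φ : Tm (a :: Γ) a → Fm (a :: Γ)} {e : Env w.D Γ} :
    w.sat (All a φ) e ↔ ∀ (w' : World) (f : w.Hom w') (d : w'.D a),
      w'.sat (φ (.var .z)) (Env.cons d (f.env e)) := w.sat_all _ _

variable {w}

theorem sat_all_elim {a : Ty} {φ : Fm (a :: Γ)} {e : Env w.D Γ} (h : w.sat (.all a φ) e)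
    (d : w.D a) : w.sat φ (Env.cons d e) := w.sat_all_iff.1 h w (.id w) d

theorem sat_imp_elim {φ ψ : Fm Γ} {e : Env w.D Γ} (h : w.sat (φ ⇒ ψ) e) (h' : w.sat φ e) :
    w.sat ψ e := w.sat_imp_iff.1 h w (.id w) h'

/-- A world knows directly only about renamings. For terms this follows by induction on the formula,
with the Kripke clauses requiring all worlds at once. -/
theorem sat_subst {Δ : Ctx} (σ : Sub Γ Δ) (φ : Fm Γ) (e : Env w.D Δ) :
    w.sat (φ.subst σ) e ↔ w.sat φ fun a v => (σ a v).eval w.toInterp e := by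
  induction φ generalizing Δ w with
  | eq a s t => simp only [Fm.subst, sat_eq, Tm.eval_subst]
  | bot => simp only [Fm.subst, sat_bot]
  | and φ ψ h1 h2 => simp only [Fm.subst, sat_and, h1, h2]
  | or φ ψ h1 h2 => simp only [Fm.subst, sat_or, h1, h2]
  | imp φ ψ h1 h2 =>
    simp only [Fm.subst, sat_imp_iff, h1, h2, Hom.env_eval]
  | all a φ h =>
    simp only [Fm.subst, sat_all_iff, h, Env.eval_lift, Hom.env_eval]
  | ex a φ h => simp only [Fm.subst, sat_ex, h, Env.eval_lift]

theorem sat_ax {φ : Fm Γ} (h : Ax φ) (e : Env w.D Γ) : w.sat φ e :=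
  w.sat_deriv (H := []) (.ax h) (by simp)

/-- Induction. -/
theorem induction (φ : Fm (.nat :: Γ)) (e : Env w.D Γ)
    (h0 : w.sat φ (Env.cons (nzero w) e))
    (hs : ∀ (w' : World) (f : w.Hom w') (n : w'.D .nat), w'.sat φ (Env.cons n (f.env e)) →
      w'.sat φ (Env.cons (nsucc n) (f.env e))) (n : w.D .nat) :
    w.sat φ (Env.cons n e) := by
  refine sat_all_elim (sat_imp_elim (sat_imp_elim (sat_ax (.induction φ) e) ?_) ?_) n
  · rw [Fm.inst, sat_subst]
    convert h0 using 1
    funext b v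
    cases v <;> rfl
  · rw [sat_all_iff]
    intro w' f n
    rw [sat_imp_iff]
    intro w'' g h
    rw [sat_subst]
    rw [Hom.env_cons] at h ⊢
    convert hs w'' (f.comp g) (g.map n) h using 1
    funext b v
    cases v <;> rfl

/-- Relativized dependent choice. -/
theorem choice {a : Ty} (A : Fm (a :: .nat :: Γ)) (R : Fm (a :: a :: .nat :: Γ)) (e : Env w.D Γ)
    (h : ∀ (w' : World) (f : w.Hom w') (n : w'.D .nat) (x : w'.D a),
      w'.sat A (Env.cons x (Env.cons n (f.env e))) → ∃ y,
        w'.sat A (Env.cons y (Env.cons (nsucc n) (f.env e))) ∧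
        w'.sat R (Env.cons y (Env.cons x (Env.cons n (f.env e)))))
    (x : w.D a) (hx : w.sat A (Env.cons x (Env.cons (nzero w) e))) :
    ∃ F : w.D (seq a), w.app F (nzero w) = x ∧
      ∀ (w' : World) (f : w.Hom w') (n : w'.D .nat),
        w'.sat A (Env.cons (w'.app (f.map F) n) (Env.cons n (f.env e))) ∧
        w'.sat R (Env.cons (w'.app (f.map F) (nsucc n))
          (Env.cons (w'.app (f.map F) n) (Env.cons n (f.env e)))) := by
  have h1 := sat_imp_elim (sat_all_elim (sat_imp_elim (sat_ax (.choice a A R) e) ?_) x) ?_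
  · rw [sat_ex] at h1
    obtain ⟨F, hF⟩ := h1
    rw [sat_and] at hF
    refine ⟨F, (w.sat_eq _ _ _).1 hF.1, fun w' f n => ?_⟩
    have h2 := (w.sat_all_iff.1 hF.2) w' f n
    rw [sat_and, sat_subst, sat_subst, Hom.env_cons, Hom.env_cons] at h2
    convert h2 using 2
    · funext b v
      cases v with
      | z => rfl
      | s v => cases v <;> rfl
    · funext b v
      cases v with
      | z => rfl
      | s v =>
        cases v with
        | z => rfl
        | s v => cases v <;> rfl
  · rw [sat_all_iff]
    intro w' f n
    rw [sat_all_iff]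
    intro w'' g x
    rw [sat_imp_iff]
    intro w₃ k hA
    rw [Hom.env_cons, Hom.env_cons, Hom.env_cons] at hA ⊢
    obtain ⟨y, h1, h2⟩ := h w₃ ((f.comp g).comp k) _ _ hA
    rw [sat_ex]
    refine ⟨y, (sat_and _ _ _ _).2 ⟨?_, h2⟩⟩
    rw [sat_subst]
    convert h1 using 1
    funext b v
    cases v with
    | z => rfl
    | s v => cases v <;> rfl
  · rw [sat_subst]
    convert hx using 1
    funext b v
    cases v with
    | z => rfl
    | s v => cases v <;> rfl

end World
end BISH
end

section
namespace BISH
open World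

variable {w w' : World} {Γ : Ctx}

/-! ## Natural numbers in a world -/

def nadd (m n : w.D .nat) : w.D .nat :=
  w.app (w.app (w.app (w.const (.recN .nat)) m)
    (w.app (w.const (.K (Ty.nat.fn .nat) .nat)) (w.const .succ))) n
/-- Inclusion of the natural numbers in the rationals. -/
def ncast (n : w.D .nat) : w.D .rat := w.app (w.const .natQ) n

@[simp] theorem eval_zeroN (e : Env w.D Γ) : (zeroN : Tm Γ _).eval w.toInterp e = nzero w := rfl
@[simp] theorem eval_succ (e : Env w.D Γ) (n : Tm Γ .nat) :
    (succ n).eval w.toInterp e = nsucc (n.eval w.toInterp e) := rfl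
@[simp] theorem eval_addN (e : Env w.D Γ) (m n : Tm Γ .nat) :
    (addN m n).eval w.toInterp e = nadd (m.eval w.toInterp e) (n.eval w.toInterp e) := rfl
@[simp] theorem eval_natQ (e : Env w.D Γ) (n : Tm Γ .nat) :
    (natQ n).eval w.toInterp e = ncast (n.eval w.toInterp e) := rfl
@[simp] theorem eval_nth (e : Env w.D Γ) {a : Ty} (u : Tm Γ (seq a)) (n : Tm Γ .nat) :
    (nth a u n).eval w.toInterp e = w.app (u.eval w.toInterp e) (n.eval w.toInterp e) := rfl

@[simp] theorem World.Hom.map_nzero (f : w.Hom w') : f.map (nzero w) = nzero w' :=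
  f.map_const _
@[simp] theorem World.Hom.map_nsucc (f : w.Hom w') (n : w.D .nat) :
    f.map (nsucc n) = nsucc (f.map n) := by simp [nsucc]
@[simp] theorem World.Hom.map_ncast (f : w.Hom w') (n : w.D .nat) :
    f.map (ncast n) = ncast (f.map n) := by simp [ncast]

/-- Induction inside the world proves the internal disjunction, which the disjunction and existence
properties turn into a genuine case distinction. The decisions about numbers and rationals below
arise in this way. -/
theorem nat_cases (n : w.D .nat) : n = nzero w ∨ ∃ m, n = nsucc m := by
  have := World.induction (w := w) (Γ := [])
    (.eq .nat (.var .z) zeroN ⩔ Ex .nat fun m => .eq .nat (.var (.s .z)) (succ m)) Env.nil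
    (by simp) (fun w' f n _ => by simp) n
  simpa using this

theorem nsucc_ne_nzero (n : w.D .nat) : nsucc n ≠ nzero w := fun h =>
  w.sat_bot _ (sat_imp_elim (sat_all_elim (sat_ax .succ_ne_zero Env.nil) n)
    ((w.sat_eq _ _ _).2 h))

theorem app_K {a b : Ty} (x : w.D a) (y : w.D b) : w.app (w.app (w.const (.K a b)) x) y = x :=
  (w.sat_eq _ _ _).1 (sat_all_elim (sat_all_elim (sat_ax (.K a b) Env.nil) x) y)

theorem app_S {a b c : Ty} (f : w.D (a.fn (b.fn c))) (g : w.D (a.fn b)) (x : w.D a) :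
    w.app (w.app (w.app (w.const (.S a b c)) f) g) x = w.app (w.app f x) (w.app g x) :=
  (w.sat_eq _ _ _).1
    (sat_all_elim (sat_all_elim (sat_all_elim (sat_ax (.S a b c) Env.nil) f) g) x)

@[simp] theorem nadd_nzero (m : w.D .nat) : nadd m (nzero w) = m :=
  (w.sat_eq _ _ _).1 (sat_all_elim (sat_all_elim (sat_ax (.rec_zero .nat) Env.nil) m) _)

@[simp] theorem nadd_nsucc (m n : w.D .nat) : nadd m (nsucc n) = nsucc (nadd m n) := by
  have : nadd m (nsucc n) = w.app (w.app (w.app (w.const (.K (Ty.nat.fn .nat) .nat))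
      (w.const .succ)) n) (nadd m n) :=
    (w.sat_eq _ _ _).1
      (sat_all_elim (sat_all_elim (sat_all_elim (sat_ax (.rec_succ .nat) Env.nil) m) _) n)
  rw [this, app_K]
  rfl

theorem nzero_nadd (n : w.D .nat) : nadd (nzero w) n = n := by
  have := World.induction (w := w) (Γ := []) (.eq .nat (addN zeroN (.var .z)) (.var .z)) Env.nil
    (by simp) (fun w' f n h => by
      have h' : nadd (nzero w') n = n := by simpa using h
      simp [h']) n
  simpa using this

theorem nsucc_nadd (m n : w.D .nat) : nadd (nsucc m) n = nsucc (nadd m n) := by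
  have := World.induction (w := w) (Γ := [.nat])
    (.eq .nat (addN (succ (.var (.s .z))) (.var .z)) (succ (addN (.var (.s .z)) (.var .z))))
    (Env.cons m Env.nil) (by simp) (fun w' f n h => by
      have h' : nadd (nsucc (f.map m)) n = nsucc (nadd (f.map m) n) := by simpa using h
      have := nadd_nsucc (nsucc (f.map m)) n
      rw [h', ← nadd_nsucc] at this
      simpa using this) n
  simpa using this

theorem nat_total (m n : w.D .nat) : (∃ k, nadd m k = n) ∨ ∃ k, nadd n k = m := by
  have := World.induction (w := w) (Γ := [.nat])
    (leN (.var .z) (.var (.s .z)) ⩔ leN (.var (.s .z)) (.var .z)) (Env.cons n Env.nil)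
    (by simpa [leN] using Or.inl ⟨n, nzero_nadd n⟩) (fun w' f m h => by
      have h' : (∃ k, nadd m k = f.map n) ∨ ∃ k, nadd (f.map n) k = m := by simpa [leN] using h
      have : (∃ k, nadd (nsucc m) k = f.map n) ∨ ∃ k, nadd (f.map n) k = nsucc m := by
        rcases h' with ⟨k, hk⟩ | ⟨k, hk⟩
        · rcases nat_cases k with rfl | ⟨k, rfl⟩
          · right
            refine ⟨nsucc (nzero w'), ?_⟩
            rw [nadd_nsucc, nadd_nzero, ← hk, nadd_nzero]
          · left
            exact ⟨k, by rw [nsucc_nadd, ← hk, nadd_nsucc]⟩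
        · right
          exact ⟨nsucc k, by rw [nadd_nsucc, hk]⟩
      simpa [leN] using this) m
  simpa [leN] using this

/-! ## Rational numbers in a world -/

instance : Add (w.D .rat) := ⟨fun p q => w.app (w.app (w.const .addQ) p) q⟩
instance : Mul (w.D .rat) := ⟨fun p q => w.app (w.app (w.const .mulQ) p) q⟩
instance : Neg (w.D .rat) := ⟨fun p => w.app (w.const .negQ) p⟩
instance : Zero (w.D .rat) := ⟨ncast (nzero w)⟩
instance : One (w.D .rat) := ⟨ncast (nsucc (nzero w))⟩

theorem addQ_comm' (p q : w.D .rat) : p + q = q + p :=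
  (w.sat_eq _ _ _).1 (sat_all_elim (sat_all_elim (sat_ax .addQ_comm Env.nil) p) q)

theorem addQ_zero' (p : w.D .rat) : p + 0 = p :=
  (w.sat_eq _ _ _).1 (sat_all_elim (sat_ax .addQ_zero Env.nil) p)

theorem mulQ_comm' (p q : w.D .rat) : p * q = q * p :=
  (w.sat_eq _ _ _).1 (sat_all_elim (sat_all_elim (sat_ax .mulQ_comm Env.nil) p) q)

theorem mulQ_one' (p : w.D .rat) : p * 1 = p :=
  (w.sat_eq _ _ _).1 (sat_all_elim (sat_ax .mulQ_one Env.nil) p)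

theorem mulQ_addQ' (p q r : w.D .rat) : p * (q + r) = p * q + p * r :=
  (w.sat_eq _ _ _).1
    (sat_all_elim (sat_all_elim (sat_all_elim (sat_ax .mulQ_addQ Env.nil) p) q) r)

instance : AddCommGroup (w.D .rat) where
  add_assoc p q r := (w.sat_eq _ _ _).1
    (sat_all_elim (sat_all_elim (sat_all_elim (sat_ax .addQ_assoc Env.nil) p) q) r)
  add_comm := addQ_comm'
  add_zero := addQ_zero'
  zero_add p := (addQ_comm' _ _).trans (addQ_zero' p)
  neg_add_cancel p := (addQ_comm' _ _).trans
    ((w.sat_eq _ _ _).1 (sat_all_elim (sat_ax .addQ_neg Env.nil) p))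
  nsmul := nsmulRec
  zsmul := zsmulRec

instance : CommRing (w.D .rat) where
  __ := (inferInstance : AddCommGroup (w.D .rat))
  mul_assoc p q r := (w.sat_eq _ _ _).1
    (sat_all_elim (sat_all_elim (sat_all_elim (sat_ax .mulQ_assoc Env.nil) p) q) r)
  mul_comm := mulQ_comm'
  mul_one := mulQ_one'
  one_mul p := (mulQ_comm' _ _).trans (mulQ_one' p)
  left_distrib := mulQ_addQ'
  right_distrib p q r := by rw [mulQ_comm', mulQ_addQ', mulQ_comm' r, mulQ_comm' r]
  mul_zero p := by
    have := mulQ_addQ' p 0 0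
    rw [add_zero] at this
    exact (left_eq_add.1 this)
  zero_mul p := by
    have := mulQ_addQ' p 0 0
    rw [add_zero] at this
    rw [mulQ_comm']
    exact (left_eq_add.1 this)

theorem ncast_nzero : ncast (nzero w) = 0 := rfl

@[simp] theorem ncast_nsucc (n : w.D .nat) : ncast (nsucc n) = ncast n + 1 :=
  (w.sat_eq _ _ _).1 (sat_all_elim (sat_ax .natQ_succ Env.nil) n)

theorem ncast_add_one_ne_zero (n : w.D .nat) : ncast n + 1 ≠ 0 := fun h =>
  w.sat_bot _ (sat_imp_elim (sat_all_elim (sat_ax .natQ_succ_ne_zero Env.nil) n)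
    ((w.sat_eq _ _ _).2 ((ncast_nsucc n).trans h)))

theorem ncast_nadd (m n : w.D .nat) : ncast (nadd m n) = ncast m + ncast n := by
  have := World.induction (w := w) (Γ := [.nat])
    (.eq .rat (natQ (addN (.var (.s .z)) (.var .z))) (addQ (natQ (.var (.s .z))) (natQ (.var .z))))
    (Env.cons m Env.nil) ((w.sat_eq _ _ _).2 ?_) (fun w' f n h => (w'.sat_eq _ _ _).2 ?_) n
  · exact (w.sat_eq _ _ _).1 this
  · change ncast (nadd m (nzero w)) = ncast m + ncast (nzero w)
    rw [nadd_nzero, ncast_nzero, add_zero]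
  · have h' : ncast (nadd (f.map m) n) = ncast (f.map m) + ncast n := (w'.sat_eq _ _ _).1 h
    change ncast (nadd (f.map m) (nsucc n)) = ncast (f.map m) + ncast (nsucc n)
    rw [nadd_nsucc, ncast_nsucc, h', ncast_nsucc, add_assoc]

@[simp] theorem eval_addQ (e : Env w.D Γ) (p q : Tm Γ .rat) :
    (addQ p q).eval w.toInterp e = p.eval w.toInterp e + q.eval w.toInterp e := rfl
@[simp] theorem eval_mulQ (e : Env w.D Γ) (p q : Tm Γ .rat) :
    (mulQ p q).eval w.toInterp e = p.eval w.toInterp e * q.eval w.toInterp e := rfl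
@[simp] theorem eval_negQ (e : Env w.D Γ) (p : Tm Γ .rat) :
    (negQ p).eval w.toInterp e = - p.eval w.toInterp e := rfl
@[simp] theorem eval_subQ (e : Env w.D Γ) (p q : Tm Γ .rat) :
    (subQ p q).eval w.toInterp e = p.eval w.toInterp e - q.eval w.toInterp e :=
  (sub_eq_add_neg _ _).symm
@[simp] theorem eval_zeroQ (e : Env w.D Γ) : (zeroQ : Tm Γ _).eval w.toInterp e = 0 := rfl
@[simp] theorem eval_oneQ (e : Env w.D Γ) : (oneQ : Tm Γ _).eval w.toInterp e = 1 := rfl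

/-- Multiplication of natural numbers. -/
theorem exists_ncast_eq_mul (m n : w.D .nat) : ∃ k, ncast k = ncast m * ncast n := by
  have := World.induction (w := w) (Γ := [.nat])
    (Ex .nat fun k => .eq .rat (natQ k) (mulQ (natQ (.var (.s (.s .z)))) (natQ (.var (.s .z)))))
    (Env.cons m Env.nil) (by simpa [ncast_nzero] using ⟨nzero w, ncast_nzero⟩) (fun w' f n h => by
      obtain ⟨k, hk⟩ : ∃ k, ncast k = ncast (f.map m) * ncast n := by simpa using h
      have : ∃ k, ncast k = ncast (f.map m) * (ncast n + 1) :=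
        ⟨nadd k (f.map m), by rw [ncast_nadd, hk]; ring⟩
      simpa using this) n
  simpa using this

/-- The rational number `1 / (n + 1)`. -/
def inv1 (n : w.D .nat) : w.D .rat := w.app (w.const .invQ) (ncast (nsucc n))

theorem mul_inv1 (n : w.D .nat) : (ncast n + 1) * inv1 n = 1 := by
  -- The premise is an internal negation, so the denominator has to be nonzero after every map and
  -- not only in `w`.
  have := sat_imp_elim (sat_all_elim (sat_ax .mulQ_inv Env.nil) (ncast (nsucc n)))
    (w.sat_imp_iff.2 fun w' f h => absurd ((w'.sat_eq _ _ _).1 h) (by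
      change f.map (ncast (nsucc n)) ≠ 0
      rw [Hom.map_ncast, Hom.map_nsucc, ncast_nsucc]
      exact ncast_add_one_ne_zero _))
  rw [← ncast_nsucc]
  exact (w.sat_eq _ _ _).1 this

@[simp] theorem eval_rcp (e : Env w.D Γ) (n : Tm Γ .nat) :
    (rcp n).eval w.toInterp e = inv1 (n.eval w.toInterp e) := rfl

theorem exists_fraction (q : w.D .rat) : ∃ k l m, q = (ncast k - ncast l) * inv1 m := by
  have := sat_all_elim (sat_ax .ratQ_fraction Env.nil) q
  simpa using this

namespace World.Hom
variable (f : w.Hom w')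

/-- The map of rational numbers. -/
def ratHom : w.D .rat →+* w'.D .rat where
  toFun := f.map
  map_zero' := by
    change f.map (ncast (nzero w)) = ncast (nzero w')
    simp
  map_one' := by
    change f.map (ncast (nsucc (nzero w))) = ncast (nsucc (nzero w'))
    rw [map_ncast, map_nsucc, map_nzero]
  map_add' p q := by
    change f.map (w.app (w.app (w.const .addQ) p) q) = _
    simp only [map_app, map_const]
    rfl
  map_mul' p q := by
    change f.map (w.app (w.app (w.const .mulQ) p) q) = _
    simp only [map_app, map_const]
    rfl

end World.Hom

/-- Every rational number is zero or invertible. -/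
theorem rat_inv (q : w.D .rat) (hq : q ≠ 0) : ∃ p, q * p = 1 := by
  have key : ∀ k l : w.D .nat, ncast l ≠ 0 → ∃ p : w.D .rat, ncast l * inv1 k * p = 1 := by
    intro k l hl
    rcases nat_cases l with rfl | ⟨l, rfl⟩
    · exact absurd ncast_nzero hl
    · refine ⟨(ncast k + 1) * inv1 l, ?_⟩
      have h1 := mul_inv1 l
      have h2 := mul_inv1 k
      rw [ncast_nsucc]
      linear_combination ((ncast k + 1) * inv1 k) * h1 + h2
  obtain ⟨k, l, m, rfl⟩ := exists_fraction q
  rcases nat_total k l with ⟨j, rfl⟩ | ⟨j, rfl⟩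
  · rw [ncast_nadd] at hq ⊢
    obtain ⟨p, hp⟩ := key m j (by
      rintro hj
      exact hq (by rw [hj]; ring))
    exact ⟨-p, by linear_combination hp⟩
  · rw [ncast_nadd] at hq ⊢
    obtain ⟨p, hp⟩ := key m j (by
      rintro hj
      exact hq (by rw [hj]; ring))
    exact ⟨p, by linear_combination hp⟩

-- The constant `invQ` is unspecified at $0$, whereas a field in Mathlib has $0^{-1}=0$; the inverse
-- is therefore chosen by cases.
open Classical in
noncomputable instance : Field (w.D .rat) where
  __ := (inferInstance : CommRing (w.D .rat))
  inv q := if h : q = 0 then 0 else (rat_inv q h).choose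
  exists_pair_ne := ⟨0, 1, fun h => ncast_add_one_ne_zero (nzero w) (by
    rw [ncast_nzero, zero_add, h])⟩
  mul_inv_cancel q hq := by
    rw [dif_neg hq]
    exact (rat_inv q hq).choose_spec
  inv_zero := dif_pos rfl
  nnqsmul := _
  nnqsmul_def := fun _ _ => rfl
  qsmul := _
  qsmul_def := fun _ _ => rfl

theorem inv1_eq (n : w.D .nat) : inv1 n = 1 / (ncast n + 1) := by
  rw [eq_div_iff (ncast_add_one_ne_zero n), mul_comm, mul_inv1]

theorem ncast_nonneg_antisymm {m n : w.D .nat} (h : ncast m + ncast n = 0) : ncast m = 0 := by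
  rcases nat_cases m with rfl | ⟨m, rfl⟩
  · rfl
  · refine absurd h ?_
    rw [ncast_nsucc, add_right_comm, ← ncast_nadd]
    exact ncast_add_one_ne_zero _

/-- Nonnegative rational numbers. -/
def ratNonneg (q : w.D .rat) : Prop := ∃ k l, q = ncast k * inv1 l

theorem inv1_mul_inv1 (k l : w.D .nat) : ∃ m, inv1 k * inv1 l = inv1 m ∧
    ncast m + 1 = (ncast k + 1) * (ncast l + 1) := by
  obtain ⟨j, hj⟩ := exists_ncast_eq_mul k l
  refine ⟨nadd j (nadd k l), ?_, ?_⟩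
  · have : ncast (nadd j (nadd k l)) + 1 = (ncast k + 1) * (ncast l + 1) := by
      rw [ncast_nadd, ncast_nadd, hj]
      ring
    rw [inv1_eq, inv1_eq, inv1_eq, this]
    field_simp
  · rw [ncast_nadd, ncast_nadd, hj]
    ring

theorem ratNonneg_add {p q : w.D .rat} (hp : ratNonneg p) (hq : ratNonneg q) :
    ratNonneg (p + q) := by
  obtain ⟨k, l, rfl⟩ := hp
  obtain ⟨k', l', rfl⟩ := hq
  obtain ⟨m, hm, -⟩ := inv1_mul_inv1 l l'
  obtain ⟨i, hi⟩ := exists_ncast_eq_mul k (nsucc l')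
  obtain ⟨j, hj⟩ := exists_ncast_eq_mul k' (nsucc l)
  refine ⟨nadd i j, m, ?_⟩
  rw [← hm, ncast_nadd, hi, hj, ncast_nsucc, ncast_nsucc]
  have h1 := mul_inv1 l
  have h2 := mul_inv1 l'
  linear_combination (-ncast k * inv1 l) * h2 + (-ncast k' * inv1 l') * h1

theorem ratNonneg_mul {p q : w.D .rat} (hp : ratNonneg p) (hq : ratNonneg q) :
    ratNonneg (p * q) := by
  obtain ⟨k, l, rfl⟩ := hp
  obtain ⟨k', l', rfl⟩ := hq
  obtain ⟨m, hm, -⟩ := inv1_mul_inv1 l l'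
  obtain ⟨i, hi⟩ := exists_ncast_eq_mul k k'
  exact ⟨i, m, by rw [← hm, hi]; ring⟩

theorem ratNonneg_antisymm {q : w.D .rat} (h : ratNonneg q) (h' : ratNonneg (-q)) : q = 0 := by
  obtain ⟨k, l, rfl⟩ := h
  obtain ⟨k', l', h'⟩ := h'
  obtain ⟨i, hi⟩ := exists_ncast_eq_mul k (nsucc l')
  obtain ⟨j, hj⟩ := exists_ncast_eq_mul k' (nsucc l)
  have h1 := mul_inv1 l
  have h2 := mul_inv1 l'
  have h3 : ncast i + ncast j = 0 := by
    rw [hi, hj, ncast_nsucc, ncast_nsucc]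
    linear_combination (-((ncast l + 1) * (ncast l' + 1))) * h' - ncast k * (ncast l' + 1) * h1 -
      ncast k' * (ncast l + 1) * h2
  have h4 := ncast_nonneg_antisymm h3
  rw [hi, ncast_nsucc] at h4
  rw [(mul_eq_zero.1 h4).resolve_right (ncast_add_one_ne_zero _), zero_mul]

theorem ratNonneg_total (q : w.D .rat) : ratNonneg q ∨ ratNonneg (-q) := by
  obtain ⟨k, l, m, rfl⟩ := exists_fraction q
  rcases nat_total k l with ⟨j, rfl⟩ | ⟨j, rfl⟩
  · exact .inr ⟨j, m, by rw [ncast_nadd]; ring⟩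
  · exact .inl ⟨j, m, by rw [ncast_nadd]; ring⟩

open Classical in
noncomputable instance : LinearOrder (w.D .rat) where
  le p q := ratNonneg (q - p)
  le_refl p := ⟨nzero w, nzero w, by rw [ncast_nzero]; ring⟩
  le_trans p q r h h' := by
    have := ratNonneg_add h h'
    rwa [add_comm, sub_add_sub_cancel] at this
  le_antisymm p q h h' := (sub_eq_zero.1 (ratNonneg_antisymm h (by rwa [neg_sub]))).symm
  le_total p q := by
    have := ratNonneg_total (q - p)
    rwa [neg_sub] at this
  toDecidableLE := Classical.decRel _

instance : IsStrictOrderedRing (w.D .rat) := by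
  have h01 : (0 : w.D .rat) ≤ 1 := ⟨nsucc (nzero w), nzero w, by
    have := mul_inv1 (nzero w)
    rw [ncast_nzero, zero_add] at this
    rw [ncast_nsucc, ncast_nzero, zero_add, this, sub_zero]⟩
  have hadd : ∀ p q : w.D .rat, p ≤ q → ∀ r, p + r ≤ q + r := fun p q h r => by
    change ratNonneg _
    rwa [add_sub_add_right_eq_sub]
  have : IsOrderedAddMonoid (w.D .rat) :=
    ⟨hadd, fun p q h r => by rw [add_comm r, add_comm r]; exact hadd p q h r⟩
  have : ZeroLEOneClass (w.D .rat) := ⟨h01⟩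
  refine .of_mul_pos fun p q hp hq => lt_of_le_of_ne ?_ (mul_ne_zero hp.ne' hq.ne').symm
  change ratNonneg _
  have h1 : ratNonneg (p - 0) := hp.le
  have h2 : ratNonneg (q - 0) := hq.le
  rw [sub_zero] at h1 h2 ⊢
  exact ratNonneg_mul h1 h2

theorem rat_le_iff {p q : w.D .rat} : p ≤ q ↔ ∃ k l, p + ncast k * inv1 l = q := by
  change (∃ k l, q - p = ncast k * inv1 l) ↔ _
  constructor
  · rintro ⟨k, l, h⟩
    exact ⟨k, l, by rw [← h, add_sub_cancel]⟩
  · rintro ⟨k, l, h⟩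
    exact ⟨k, l, by rw [← h, add_sub_cancel_left]⟩

theorem ncast_nonneg (n : w.D .nat) : 0 ≤ ncast n := by
  refine rat_le_iff.2 ⟨n, nzero w, ?_⟩
  rw [inv1_eq, ncast_nzero]
  simp

theorem inv1_pos (n : w.D .nat) : 0 < inv1 n := by
  have := ncast_nonneg n
  rw [inv1_eq]
  positivity

theorem inv1_le_one (n : w.D .nat) : inv1 n ≤ 1 := by
  have := ncast_nonneg n
  rw [inv1_eq]
  exact div_le_one_of_le₀ (by linarith) (by linarith)

theorem inv1_le_inv1 {m n : w.D .nat} (h : ncast m ≤ ncast n) : inv1 n ≤ inv1 m := by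
  have := ncast_nonneg m
  rw [inv1_eq, inv1_eq]
  exact one_div_le_one_div_of_le (by linarith) (by linarith)

theorem rat_lt_iff {p q : w.D .rat} : p < q ↔ ∃ k l, p + ncast (nsucc k) * inv1 l = q := by
  constructor
  · intro h
    obtain ⟨k, l, rfl⟩ := rat_le_iff.1 h.le
    rcases nat_cases k with rfl | ⟨k, rfl⟩
    · rw [ncast_nzero] at h
      simp at h
    · exact ⟨k, l, rfl⟩
  · rintro ⟨k, l, rfl⟩
    have h1 := ncast_nonneg k
    have h2 := inv1_pos l
    rw [ncast_nsucc]
    have : 0 < (ncast k + 1) * inv1 l := by positivity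
    linarith

theorem exists_ncast_gt (q : w.D .rat) : ∃ n, q < ncast n := by
  obtain ⟨k, l, m, rfl⟩ := exists_fraction q
  refine ⟨nsucc k, ?_⟩
  have h1 := ncast_nonneg k
  have h2 := ncast_nonneg l
  have h3 := inv1_pos m
  have h4 := inv1_le_one m
  rw [ncast_nsucc]
  nlinarith [mul_nonneg h2 h3.le, mul_nonneg h1 (sub_nonneg.2 h4)]

theorem exists_inv1_lt {q : w.D .rat} (hq : 0 < q) : ∃ n, inv1 n < q := by
  obtain ⟨n, hn⟩ := exists_ncast_gt (1 / q)
  refine ⟨n, ?_⟩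
  have := ncast_nonneg n
  rw [inv1_eq, div_lt_iff₀ (by linarith)]
  rw [div_lt_iff₀ hq] at hn
  nlinarith

theorem leN_iff {m n : w.D .nat} : (∃ k, nadd m k = n) ↔ ncast m ≤ ncast n := by
  constructor
  · rintro ⟨k, rfl⟩
    rw [ncast_nadd]
    linarith [ncast_nonneg k]
  · intro h
    rcases nat_total m n with h' | ⟨k, rfl⟩
    · exact h'
    · rcases nat_cases k with rfl | ⟨k, rfl⟩
      · exact ⟨nzero w, by simp⟩
      · rw [ncast_nadd, ncast_nsucc] at h
        linarith [ncast_nonneg k]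

@[simp] theorem World.sat_leN {m n : Tm Γ .nat} {e : Env w.D Γ} : w.sat (leN m n) e ↔
    ncast (m.eval w.toInterp e) ≤ ncast (n.eval w.toInterp e) := by
  rw [← leN_iff]
  simp [leN]

@[simp] theorem World.sat_leQ {p q : Tm Γ .rat} {e : Env w.D Γ} :
    w.sat (leQ p q) e ↔ p.eval w.toInterp e ≤ q.eval w.toInterp e := by
  simp [leQ, rat_le_iff]

@[simp] theorem World.sat_ltQ {p q : Tm Γ .rat} {e : Env w.D Γ} :
    w.sat (ltQ p q) e ↔ p.eval w.toInterp e < q.eval w.toInterp e := by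
  simp [ltQ, rat_lt_iff]

/-- `|p - q| ≤ e`. -/
def near (p q e : w.D .rat) : Prop := p - q ≤ e ∧ q - p ≤ e

@[simp] theorem World.sat_nearQ {p q r : Tm Γ .rat} {e : Env w.D Γ} :
    w.sat (nearQ p q r) e ↔
      near (p.eval w.toInterp e) (q.eval w.toInterp e) (r.eval w.toInterp e) := by
  simp [nearQ, near]

namespace World.Hom
variable (f : w.Hom w') (p q : w.D .rat)

@[simp] theorem map_addQ : f.map (p + q) = f.map p + f.map q := f.ratHom.map_add p q
@[simp] theorem map_mulQ : f.map (p * q) = f.map p * f.map q := f.ratHom.map_mul p q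
@[simp] theorem map_subQ : f.map (p - q) = f.map p - f.map q := f.ratHom.map_sub p q
@[simp] theorem map_zeroQ : f.map (0 : w.D .rat) = 0 := f.ratHom.map_zero
@[simp] theorem map_oneQ : f.map (1 : w.D .rat) = 1 := f.ratHom.map_one
@[simp] theorem map_invQ : f.map p⁻¹ = (f.map p)⁻¹ := map_inv₀ f.ratHom p
@[simp] theorem map_divQ : f.map (p / q) = f.map p / f.map q := map_div₀ f.ratHom p q
@[simp] theorem map_inv1 (n : w.D .nat) : f.map (inv1 n) = inv1 (f.map n) := by
  simp [inv1_eq]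

/-- A strict inequality carries numerical witnesses, which are mapped along. As the order is linear,
inequalities between rationals are then also reflected by `f`. -/
theorem ratHom_strictMono : StrictMono f.ratHom := by
  intro p q h
  obtain ⟨k, l, rfl⟩ := rat_lt_iff.1 h
  exact rat_lt_iff.2 ⟨f.map k, f.map l, by
    change _ = f.map _
    simp
    rfl⟩

variable {p q}
@[simp] theorem map_lt_iff : f.map p < f.map q ↔ p < q := f.ratHom_strictMono.lt_iff_lt
@[simp] theorem map_le_iff : f.map p ≤ f.map q ↔ p ≤ q := f.ratHom_strictMono.le_iff_le
@[simp] theorem map_pos_iff : 0 < f.map p ↔ 0 < p := by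
  rw [← f.map_zeroQ, map_lt_iff]

end World.Hom

end BISH
end

section
namespace BISH
open World

variable {w w' : World} {Γ : Ctx}

@[simp] theorem World.Hom.eval_env (f : w.Hom w') (e : Env w.D Γ) {a : Ty} (t : Tm Γ a) :
    t.eval w'.toInterp (f.env e) = f.map (t.eval w.toInterp e) := (f.map_eval e t).symm

/-- Functions are given by terms. -/
theorem exists_fn {a b : Ty} (e : Env w.D Γ) (t : Tm (a :: Γ) b) : ∃ F : w.D (a.fn b),
    ∀ (w' : World) (f : w.Hom w') (d : w'.D a),
      w'.app (f.map F) d = t.eval w'.toInterp (Env.cons d (f.env e)) := by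
  induction t with
  | var v =>
    cases v with
    | z =>
      refine ⟨w.app (w.app (w.const (.S a (a.fn a) a)) (w.const (.K a (a.fn a))))
        (w.const (.K a a)), fun w' f d => ?_⟩
      simp only [Hom.map_app, Hom.map_const, app_S, app_K, Tm.eval_var, Env.cons_z]
    | s v =>
      refine ⟨w.app (w.const (.K _ a)) (e _ v), fun w' f d => ?_⟩
      simp only [Hom.map_app, Hom.map_const, app_K, Tm.eval_var, Env.cons_s]
      rfl
  | const c =>
    refine ⟨w.app (w.const (.K _ a)) (w.const c), fun w' f d => ?_⟩
    simp only [Hom.map_app, Hom.map_const, app_K, Tm.eval_const]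
  | app g x hg hx =>
    obtain ⟨G, hG⟩ := hg
    obtain ⟨X, hX⟩ := hx
    refine ⟨w.app (w.app (w.const (.S _ _ _)) G) X, fun w' f d => ?_⟩
    simp only [Hom.map_app, Hom.map_const, app_S, hG, hX, Tm.eval_app]

/-! ## Real numbers in a world -/

/-- Regular sequences of rational numbers. -/
def IsReg (x : w.D (seq .rat)) : Prop := ∀ (w' : World) (f : w.Hom w') (m n : w'.D .nat),
  near (w'.app (f.map x) m) (w'.app (f.map x) n) (inv1 m + inv1 n)

@[simp] theorem World.sat_Reg {x : Tm Γ (seq .rat)} {e : Env w.D Γ} :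
    w.sat (Reg x) e ↔ IsReg (x.eval w.toInterp e) := by
  simp only [Reg, sat_All, IsReg, sat_nearQ, eval_nth, Hom.env_cons, Tm.eval_wk, Hom.eval_env,
    Tm.eval_var, Env.cons_z, eval_addQ, eval_rcp]
  exact ⟨fun h w' f m n => h w' f m w' (.id w') n,
    fun h w' f m w'' g n => h w'' (f.comp g) (g.map m) n⟩

theorem IsReg.map {x : w.D (seq .rat)} (h : IsReg x) (f : w.Hom w') : IsReg (f.map x) :=
  fun _ g => h _ (f.comp g)

theorem IsReg.near {x : w.D (seq .rat)} (h : IsReg x) (m n : w.D .nat) :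
    near (w.app x m) (w.app x n) (inv1 m + inv1 n) := h w (.id w) m n

/-- The real number given by a sequence. -/
def rlim (x : w.D (seq .rat)) : w.D .real := w.app (w.const .lim) x

@[simp] theorem eval_lim (e : Env w.D Γ) (x : Tm Γ (seq .rat)) :
    (lim x).eval w.toInterp e = rlim (x.eval w.toInterp e) := rfl

@[simp] theorem World.Hom.map_rlim (f : w.Hom w') (x : w.D (seq .rat)) :
    f.map (rlim x) = rlim (f.map x) := by simp [rlim]

@[simp] theorem World.sat_Rep {x : Tm Γ (seq .rat)} {r : Tm Γ .real} {e : Env w.D Γ} :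
    w.sat (Rep x r) e ↔ IsReg (x.eval w.toInterp e) ∧
      rlim (x.eval w.toInterp e) = r.eval w.toInterp e := by
  simp [Rep]

theorem exists_rep (r : w.D .real) : ∃ x, IsReg x ∧ rlim x = r := by
  have := sat_all_elim (sat_ax .real_rep Env.nil) r
  simpa using this

theorem rlim_eq_iff {x y : w.D (seq .rat)} (hx : IsReg x) (hy : IsReg y) : rlim x = rlim y ↔
    ∀ (w' : World) (f : w.Hom w') (n : w'.D .nat),
      near (w'.app (f.map x) n) (w'.app (f.map y) n) (inv1 n + inv1 n) := by
  have := sat_imp_elim (sat_imp_elim (sat_all_elim (sat_all_elim (sat_ax .real_eq Env.nil) x) y)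
    (by simpa using hx)) (by simpa using hy)
  rw [iff, sat_and] at this
  constructor
  · intro h
    have := sat_imp_elim this.1 (by simpa using h)
    simpa [sat_All] using this
  · intro h
    have := sat_imp_elim this.2 (by simpa [sat_All] using h)
    simpa using this

theorem near_of_rlim_eq {x y : w.D (seq .rat)} (hx : IsReg x) (hy : IsReg y)
    (h : rlim x = rlim y) (n : w.D .nat) :
    near (w.app x n) (w.app y n) (inv1 n + inv1 n) := (rlim_eq_iff hx hy).1 h w (.id w) n

/-- `r < q` for rational `q`. -/
def Above (r : w.D .real) (q : w.D .rat) : Prop :=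
  ∃ x, IsReg x ∧ rlim x = r ∧ ∃ n, w.app x n + inv1 n < q

/-- `q < r` for rational `q`. -/
def Below (r : w.D .real) (q : w.D .rat) : Prop :=
  ∃ x, IsReg x ∧ rlim x = r ∧ ∃ n, q < w.app x n - inv1 n

variable {r s : w.D .real} {p q : w.D .rat}

/-- One strict inequality at one term of one representative leaves a margin, and regularity spreads
it to all terms of every representative; the comparison goes through a term of large index `k`. -/
theorem Above.rep (h : Above r q) {y : w.D (seq .rat)} (hy : IsReg y) (hr : rlim y = r) :
    ∃ e > 0, ∀ m, w.app y m ≤ q - e + inv1 m := by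
  obtain ⟨x, hx, rfl, n, hn⟩ := h
  refine ⟨q - (w.app x n + inv1 n), by linarith, fun m => ?_⟩
  by_contra! hc
  obtain ⟨k, hk⟩ := exists_inv1_lt (q := (w.app y m - (w.app x n + inv1 n + inv1 m)) / 4)
    (by linarith)
  have h1 := (near_of_rlim_eq hy hx hr k).1
  have h2 := (hx.near k n).1
  have h3 := (hy.near m k).1
  linarith

theorem Below.rep (h : Below r q) {y : w.D (seq .rat)} (hy : IsReg y) (hr : rlim y = r) :
    ∃ e > 0, ∀ m, q + e - inv1 m ≤ w.app y m := by
  obtain ⟨x, hx, rfl, n, hn⟩ := h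
  refine ⟨w.app x n - inv1 n - q, by linarith, fun m => ?_⟩
  by_contra! hc
  obtain ⟨k, hk⟩ := exists_inv1_lt (q := (w.app x n - inv1 n - inv1 m - w.app y m) / 4)
    (by linarith)
  have h1 := (near_of_rlim_eq hy hx hr k).2
  have h2 := (hx.near k n).2
  have h3 := (hy.near m k).2
  linarith

theorem Above.map (h : Above r q) (f : w.Hom w') : Above (f.map r) (f.map q) := by
  obtain ⟨x, hx, rfl, n, hn⟩ := h
  exact ⟨f.map x, hx.map f, (f.map_rlim x).symm, f.map n, by
    rw [← f.map_lt_iff] at hn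
    simpa using hn⟩

theorem Below.map (h : Below r q) (f : w.Hom w') : Below (f.map r) (f.map q) := by
  obtain ⟨x, hx, rfl, n, hn⟩ := h
  exact ⟨f.map x, hx.map f, (f.map_rlim x).symm, f.map n, by
    rw [← f.map_lt_iff] at hn
    simpa using hn⟩

theorem Above.mono (h : Above r p) (hpq : p ≤ q) : Above r q := by
  obtain ⟨x, hx, hr, n, hn⟩ := h
  exact ⟨x, hx, hr, n, hn.trans_le hpq⟩

theorem Below.mono (h : Below r q) (hpq : p ≤ q) : Below r p := by
  obtain ⟨x, hx, hr, n, hn⟩ := h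
  exact ⟨x, hx, hr, n, hpq.trans_lt hn⟩

theorem Above.exists_lt (h : Above r q) : ∃ p < q, Above r p := by
  obtain ⟨x, hx, hr, n, hn⟩ := h
  obtain ⟨p, h1, h2⟩ := exists_between hn
  exact ⟨p, h2, x, hx, hr, n, h1⟩

theorem Below.exists_gt (h : Below r q) : ∃ p > q, Below r p := by
  obtain ⟨x, hx, hr, n, hn⟩ := h
  obtain ⟨p, h1, h2⟩ := exists_between hn
  exact ⟨p, h1, x, hx, hr, n, h2⟩

theorem exists_above (r : w.D .real) : ∃ q > 0, Above r q := by
  obtain ⟨x, hx, hr⟩ := exists_rep r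
  refine ⟨max 1 (w.app x (nzero w) + 2), by positivity, x, hx, hr, nzero w, ?_⟩
  have := inv1_le_one (nzero w)
  rw [lt_max_iff]
  right
  linarith

theorem lt_of_below_above (h : Below r p) (h' : Above r q) : p < q := by
  obtain ⟨x, hx, rfl, n, hn⟩ := h'
  obtain ⟨e, he, h⟩ := h.rep hx rfl
  have := h n
  linarith

/-- Cotransitivity: an approximation of `r` with error less than $(q-p)/2$ is a rational number, and
rationals can be compared. -/
theorem below_or_above (r : w.D .real) (h : p < q) : Below r p ∨ Above r q := by
  obtain ⟨x, hx, hr⟩ := exists_rep r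
  obtain ⟨n, hn⟩ := exists_inv1_lt (q := (q - p) / 2) (by linarith)
  by_cases hp : p < w.app x n - inv1 n
  · exact .inl ⟨x, hx, hr, n, hp⟩
  · exact .inr ⟨x, hx, hr, n, by linarith⟩

/-- `r < s`. -/
def rlt (r s : w.D .real) : Prop := ∃ q, Above r q ∧ Below s q

@[simp] theorem World.sat_lt {r s : Tm Γ .real} {e : Env w.D Γ} :
    w.sat (lt r s) e ↔ rlt (r.eval w.toInterp e) (s.eval w.toInterp e) := by
  have : w.sat (lt r s) e ↔ ∃ x y, (IsReg x ∧ rlim x = r.eval w.toInterp e) ∧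
      (IsReg y ∧ rlim y = s.eval w.toInterp e) ∧
      ∃ n, w.app x n + (inv1 n + inv1 n) < w.app y n := by
    simp [lt]
  rw [this]
  constructor
  · rintro ⟨x, y, ⟨hx, hr⟩, ⟨hy, hs⟩, n, hn⟩
    obtain ⟨q, h1, h2⟩ := exists_between
      (show w.app x n + inv1 n < w.app y n - inv1 n by linarith)
    exact ⟨q, ⟨x, hx, hr, n, h1⟩, y, hy, hs, n, h2⟩
  · rintro ⟨q, h1, h2⟩
    obtain ⟨x, hx, hr⟩ := exists_rep (r.eval w.toInterp e)
    obtain ⟨y, hy, hs⟩ := exists_rep (s.eval w.toInterp e)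
    obtain ⟨d, hd, h1⟩ := h1.rep hx hr
    obtain ⟨d', hd', h2⟩ := h2.rep hy hs
    obtain ⟨n, hn⟩ := exists_inv1_lt (q := d / 4) (by linarith)
    refine ⟨x, y, ⟨hx, hr⟩, ⟨hy, hs⟩, n, ?_⟩
    linarith [h1 n, h2 n]

/-- `r ≤ s`. -/
def rle (r s : w.D .real) : Prop := ∀ (w' : World) (f : w.Hom w') (q : w'.D .rat),
  Above (f.map s) q → Below (f.map r) q → False

theorem rle.map (h : rle r s) (f : w.Hom w') : rle (f.map r) (f.map s) :=
  fun _ g => h _ (f.comp g)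

theorem rle.app_le (h : rle r s) {x y : w.D (seq .rat)} (hx : IsReg x) (hr : rlim x = r)
    (hy : IsReg y) (hs : rlim y = s) (n : w.D .nat) :
    w.app x n ≤ w.app y n + (inv1 n + inv1 n) := by
  by_contra! hc
  obtain ⟨q, h1, h2⟩ := exists_between
    (show w.app y n + inv1 n < w.app x n - inv1 n by linarith)
  exact h w (.id w) q ⟨y, hy, hs, n, h1⟩ ⟨x, hx, hr, n, h2⟩

@[simp] theorem World.sat_le {r s : Tm Γ .real} {e : Env w.D Γ} :
    w.sat (le r s) e ↔ rle (r.eval w.toInterp e) (s.eval w.toInterp e) := by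
  have : w.sat (le r s) e ↔ ∃ x y, (IsReg x ∧ rlim x = r.eval w.toInterp e) ∧
      (IsReg y ∧ rlim y = s.eval w.toInterp e) ∧ ∀ (w' : World) (f : w.Hom w') (n : w'.D .nat),
      w'.app (f.map x) n ≤ w'.app (f.map y) n + (inv1 n + inv1 n) := by
    simp [le, sat_All]
  rw [this]
  constructor
  · rintro ⟨x, y, ⟨hx, hr⟩, ⟨hy, hs⟩, h⟩ w' f q h1 h2
    rw [← hs, f.map_rlim] at h1
    rw [← hr, f.map_rlim] at h2
    obtain ⟨d, hd, h1⟩ := h1.rep (hy.map f) rfl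
    obtain ⟨d', hd', h2⟩ := h2.rep (hx.map f) rfl
    obtain ⟨n, hn⟩ := exists_inv1_lt (q := d / 4) (by linarith)
    linarith [h1 n, h2 n, h w' f n]
  · intro h
    obtain ⟨x, hx, hr⟩ := exists_rep (r.eval w.toInterp e)
    obtain ⟨y, hy, hs⟩ := exists_rep (s.eval w.toInterp e)
    refine ⟨x, y, ⟨hx, hr⟩, ⟨hy, hs⟩, fun w' f n => ?_⟩
    exact (h.map f).app_le (hx.map f) (by rw [← hr, f.map_rlim]) (hy.map f)
      (by rw [← hs, f.map_rlim]) n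

/-- The relation `rle` is purely negative. Positive information comes from cotransitivity between
`q` and a slightly smaller bound `p` of `s`. -/
theorem rle.above (h : rle r s) (hs : Above s q) : Above r q := by
  obtain ⟨p, hp, h1⟩ := hs.exists_lt
  exact (below_or_above r hp).resolve_left fun h2 => h w (.id w) p h1 h2

theorem rle.below (h : rle r s) (hr : Below r q) : Below s q := by
  obtain ⟨p, hp, h1⟩ := hr.exists_gt
  exact (below_or_above s hp).resolve_right fun h2 => h w (.id w) p h2 h1

theorem rle.antisymm (h : rle r s) (h' : rle s r) : r = s := by
  obtain ⟨x, hx, rfl⟩ := exists_rep r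
  obtain ⟨y, hy, rfl⟩ := exists_rep s
  refine (rlim_eq_iff hx hy).2 fun w' f n => ⟨?_, ?_⟩
  · have := (h.map f).app_le (hx.map f) (by simp) (hy.map f) (by simp) n
    linarith
  · have := (h'.map f).app_le (hy.map f) (by simp) (hx.map f) (by simp) n
    linarith

/-- The real number given by a rational number. -/
def ofRat (q : w.D .rat) : w.D .real := rlim (w.app (w.const (.K .rat .nat)) q)

@[simp] theorem eval_ratR (e : Env w.D Γ) (q : Tm Γ .rat) :
    (ratR q).eval w.toInterp e = ofRat (q.eval w.toInterp e) := rfl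
@[simp] theorem eval_zeroR (e : Env w.D Γ) :
    (zeroR : Tm Γ _).eval w.toInterp e = ofRat 0 := rfl
@[simp] theorem eval_oneR (e : Env w.D Γ) :
    (oneR : Tm Γ _).eval w.toInterp e = ofRat 1 := rfl

@[simp] theorem World.Hom.map_ofRat (f : w.Hom w') (q : w.D .rat) :
    f.map (ofRat q) = ofRat (f.map q) := by simp [ofRat]

theorem isReg_const (q : w.D .rat) : IsReg (w.app (w.const (.K .rat .nat)) q) := by
  intro w' f m n
  have h1 := inv1_pos m
  have h2 := inv1_pos n
  simp only [Hom.map_app, Hom.map_const, app_K]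
  constructor <;> linarith

@[simp] theorem above_ofRat : Above (ofRat p) q ↔ p < q := by
  constructor
  · intro h
    obtain ⟨d, hd, h⟩ := h.rep (isReg_const p) rfl
    obtain ⟨n, hn⟩ := exists_inv1_lt hd
    have := h n
    rw [app_K] at this
    linarith
  · intro h
    obtain ⟨n, hn⟩ := exists_inv1_lt (sub_pos.2 h)
    exact ⟨_, isReg_const p, rfl, n, by rw [app_K]; linarith⟩

@[simp] theorem below_ofRat : Below (ofRat p) q ↔ q < p := by
  constructor
  · intro h
    obtain ⟨d, hd, h⟩ := h.rep (isReg_const p) rfl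
    obtain ⟨n, hn⟩ := exists_inv1_lt hd
    have := h n
    rw [app_K] at this
    linarith
  · intro h
    obtain ⟨n, hn⟩ := exists_inv1_lt (sub_pos.2 h)
    exact ⟨_, isReg_const p, rfl, n, by rw [app_K]; linarith⟩

@[simp] theorem rlt_ofRat : rlt r (ofRat q) ↔ Above r q := by
  constructor
  · rintro ⟨p, h1, h2⟩
    exact h1.mono (below_ofRat.1 h2).le
  · intro h
    obtain ⟨p, hp, h⟩ := h.exists_lt
    exact ⟨p, h, below_ofRat.2 hp⟩

@[simp] theorem ofRat_rlt : rlt (ofRat q) r ↔ Below r q := by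
  constructor
  · rintro ⟨p, h1, h2⟩
    exact h2.mono (above_ofRat.1 h1).le
  · intro h
    obtain ⟨p, hp, h⟩ := h.exists_gt
    exact ⟨p, above_ofRat.2 hp, h⟩

/-! ## Sums and products -/

def radd (r s : w.D .real) : w.D .real := w.app (w.app (w.const .addR) r) s
def rmul (r s : w.D .real) : w.D .real := w.app (w.app (w.const .mulR) r) s

@[simp] theorem eval_addR (e : Env w.D Γ) (r s : Tm Γ .real) :
    (addR r s).eval w.toInterp e = radd (r.eval w.toInterp e) (s.eval w.toInterp e) := rfl
@[simp] theorem eval_mulR (e : Env w.D Γ) (r s : Tm Γ .real) :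
    (mulR r s).eval w.toInterp e = rmul (r.eval w.toInterp e) (s.eval w.toInterp e) := rfl

theorem radd_rlim {x y z : w.D (seq .rat)} (hx : IsReg x) (hy : IsReg y)
    (h : ∀ (w' : World) (f : w.Hom w') (n : w'.D .nat), w'.app (f.map z) n =
      w'.app (f.map x) (nsucc (nadd n n)) + w'.app (f.map y) (nsucc (nadd n n))) :
    radd (rlim x) (rlim y) = rlim z := by
  have := sat_imp_elim (sat_imp_elim (sat_imp_elim
    (sat_all_elim (sat_all_elim (sat_all_elim (sat_ax .addR_lim Env.nil) x) y) z)
    (by simpa using hx)) (by simpa using hy)) (by simpa [sat_All] using h)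
  simpa using this

theorem rmul_rlim {x y z : w.D (seq .rat)} (hx : IsReg x) (hy : IsReg y) (hz : IsReg z)
    (h : ∀ (w' : World) (f : w.Hom w') (n : w'.D .nat), w'.app (f.map z) n =
      w'.app (f.map x) n * w'.app (f.map y) n) :
    rmul (rlim x) (rlim y) = rlim z := by
  have := sat_imp_elim (sat_imp_elim (sat_imp_elim (sat_imp_elim
    (sat_all_elim (sat_all_elim (sat_all_elim (sat_ax .mulR_lim Env.nil) x) y) z)
    (by simpa using hx)) (by simpa using hy)) (by simpa using hz)) (by
      -- The termwise products agree exactly, so index $0$ serves for every tolerance.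
      refine sat_All _ |>.2 fun w' f k => sat_Ex _ |>.2 ⟨nzero w', sat_All _ |>.2 fun w'' g n =>
        (sat_imp_iff _).2 fun w₃ g' _ => ?_⟩
      have h1 := h w₃ ((f.comp g).comp g') (g'.map n)
      simp only [Hom.map_comp] at h1
      simpa [h1, near] using (inv1_pos (g'.map (g.map k))).le)
  simpa using this

theorem ofRat_add (p q : w.D .rat) : radd (ofRat p) (ofRat q) = ofRat (p + q) :=
  radd_rlim (isReg_const p) (isReg_const q) fun w' f n => by simp [app_K]

theorem ofRat_mul (p q : w.D .rat) : rmul (ofRat p) (ofRat q) = ofRat (p * q) :=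
  rmul_rlim (isReg_const p) (isReg_const q) (isReg_const _) fun w' f n => by simp [app_K]

theorem inv1_double (n : w.D .nat) :
    inv1 (nsucc (nadd n n)) + inv1 (nsucc (nadd n n)) = inv1 n := by
  have := ncast_nonneg n
  rw [inv1_eq, inv1_eq, ncast_nsucc, ncast_nadd]
  field_simp
  ring

theorem Above.add (hr : Above r p) (hs : Above s q) : Above (radd r s) (p + q) := by
  obtain ⟨x, hx, rfl⟩ := exists_rep r
  obtain ⟨y, hy, rfl⟩ := exists_rep s
  obtain ⟨d, hd, h1⟩ := hr.rep hx rfl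
  obtain ⟨d', hd', h2⟩ := hs.rep hy rfl
  obtain ⟨z, hz⟩ := exists_fn (Env.cons x (Env.cons y Env.nil))
    (addQ (nth .rat (.var (.s .z)) (succ (addN (.var .z) (.var .z))))
      (nth .rat (.var (.s (.s .z))) (succ (addN (.var .z) (.var .z)))))
  have hz' : ∀ (w' : World) (f : w.Hom w') (n : w'.D .nat), w'.app (f.map z) n =
      w'.app (f.map x) (nsucc (nadd n n)) + w'.app (f.map y) (nsucc (nadd n n)) :=
    fun w' f n => by simpa using hz w' f n
  rw [radd_rlim hx hy hz']
  obtain ⟨n, hn⟩ := exists_inv1_lt (q := d / 2) (by linarith)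
  refine ⟨z, fun w' f m n => ?_, rfl, n, ?_⟩
  · have hx' := (hx.map f).near (nsucc (nadd m m)) (nsucc (nadd n n))
    have hy' := (hy.map f).near (nsucc (nadd m m)) (nsucc (nadd n n))
    have h3 := inv1_double m
    have h4 := inv1_double n
    rw [hz', hz']
    exact ⟨by linarith [hx'.1, hy'.1], by linarith [hx'.2, hy'.2]⟩
  · have := hz' w (.id w) n
    simp only [Hom.map_id] at this
    rw [this]
    linarith [h1 (nsucc (nadd n n)), h2 (nsucc (nadd n n)), inv1_double n]

/-- For $p\le1$ the termwise multiple of a regular sequence is again regular, so no change of index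
is needed. -/
theorem above_ofRat_mul_iff (hp : 0 < p) (hp' : p ≤ 1) :
    Above (rmul (ofRat p) r) (p * q) ↔ Above r q := by
  obtain ⟨x, hx, rfl⟩ := exists_rep r
  obtain ⟨z, hz⟩ := exists_fn (Env.cons x (Env.cons p Env.nil))
    (mulQ (.var (.s (.s .z))) (nth .rat (.var (.s .z)) (.var .z)))
  have hz' : ∀ (w' : World) (f : w.Hom w') (n : w'.D .nat), w'.app (f.map z) n =
      f.map p * w'.app (f.map x) n := fun w' f n => by simpa using hz w' f n
  have hz'' : ∀ n, w.app z n = p * w.app x n := hz' w (.id w)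
  have hreg : IsReg z := fun w' f m n => by
    have h1 := (hx.map f).near m n
    have h2 := (f.map_pos_iff).2 hp
    have h3 := (f.map_le_iff).2 hp'
    have h4 := inv1_pos m
    have h5 := inv1_pos n
    rw [f.map_oneQ] at h3
    rw [hz', hz']
    constructor <;> nlinarith [h1.1, h1.2]
  rw [ofRat, rmul_rlim (isReg_const p) hx hreg (fun w' f n => by simp [hz', app_K])]
  constructor
  · intro h
    obtain ⟨d, hd, h⟩ := h.rep hreg rfl
    obtain ⟨n, hn⟩ := exists_inv1_lt (q := d / 2) (by linarith)
    refine ⟨x, hx, rfl, n, ?_⟩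
    have := h n
    rw [hz''] at this
    have h4 := inv1_pos n
    refine lt_of_mul_lt_mul_left (a := p) ?_ hp.le
    nlinarith
  · intro h
    obtain ⟨d, hd, h⟩ := h.rep hx rfl
    obtain ⟨n, hn⟩ := exists_inv1_lt (q := p * d / 2) (by positivity)
    refine ⟨z, hreg, rfl, n, ?_⟩
    rw [hz'']
    have h4 := inv1_pos n
    nlinarith [h n]

end BISH
end

section
namespace BISH
open World

variable {w w' : World} {Γ : Ctx} {i : Sp}

theorem below_iff {r : w.D .real} {q : w.D .rat} : Below r q ↔ ∃ p > q, ¬ Above r p := by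
  constructor
  · intro h
    obtain ⟨p, hp, h⟩ := h.exists_gt
    exact ⟨p, hp, fun h' => lt_irrefl _ (lt_of_below_above h h')⟩
  · rintro ⟨p, hp, h⟩
    exact (below_or_above r hp).resolve_right h

/-! ## Normed spaces in a world -/

instance : Add (w.D (.sp i)) := ⟨fun x y => w.app (w.app (w.const (.vadd i)) x) y⟩
instance : Neg (w.D (.sp i)) := ⟨fun x => w.app (w.const (.vneg i)) x⟩
instance : Zero (w.D (.sp i)) := ⟨w.const (.vzero i)⟩
instance : _root_.Sub (w.D (.sp i)) := ⟨fun x y => x + -y⟩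
instance : SMul (w.D .real) (w.D (.sp i)) := ⟨fun r x => w.app (w.app (w.const (.vsmul i)) r) x⟩
instance : SMul (w.D .rat) (w.D (.sp i)) := ⟨fun q x => ofRat q • x⟩

/-- The norm. -/
def nrm (x : w.D (.sp i)) : w.D .real := w.app (w.const (.norm i)) x

section eval
variable (e : Env w.D Γ) (x y : Tm Γ (.sp i))

@[simp] theorem eval_vzero : (vzero i : Tm Γ _).eval w.toInterp e = 0 := rfl
@[simp] theorem eval_vadd : (vadd i x y).eval w.toInterp e =
    x.eval w.toInterp e + y.eval w.toInterp e := rfl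
@[simp] theorem eval_vneg : (vneg i x).eval w.toInterp e = -x.eval w.toInterp e := rfl
@[simp] theorem eval_vsub : (vsub i x y).eval w.toInterp e =
    x.eval w.toInterp e - y.eval w.toInterp e := rfl
@[simp] theorem eval_smul (r : Tm Γ .real) : (smul i r x).eval w.toInterp e =
    r.eval w.toInterp e • x.eval w.toInterp e := rfl
@[simp] theorem eval_norm : (norm i x).eval w.toInterp e = nrm (x.eval w.toInterp e) := rfl
@[simp] theorem eval_dist : (dist i x y).eval w.toInterp e =
    nrm (x.eval w.toInterp e - y.eval w.toInterp e) := rfl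

end eval

namespace World.Hom
variable (f : w.Hom w') (x y : w.D (.sp i))

@[simp] theorem map_vzero : f.map (0 : w.D (.sp i)) = 0 := f.map_const _
@[simp] theorem map_vadd : f.map (x + y) = f.map x + f.map y := by
  change f.map (w.app (w.app (w.const (.vadd i)) x) y) = _
  simp only [map_app, map_const]
  rfl
@[simp] theorem map_vneg : f.map (-x) = -f.map x := by
  change f.map (w.app (w.const (.vneg i)) x) = _
  simp only [map_app, map_const]
  rfl
@[simp] theorem map_vsub : f.map (x - y) = f.map x - f.map y := by
  change f.map (x + -y) = _
  simp only [map_vadd, map_vneg]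
  rfl
@[simp] theorem map_rsmul (r : w.D .real) : f.map (r • x) = f.map r • f.map x := by
  change f.map (w.app (w.app (w.const (.vsmul i)) r) x) = _
  simp only [map_app, map_const]
  rfl
@[simp] theorem map_qsmul (q : w.D .rat) : f.map (q • x) = f.map q • f.map x := by
  change f.map (ofRat q • x) = ofRat (f.map q) • f.map x
  simp
@[simp] theorem map_nrm : f.map (nrm x) = nrm (f.map x) := by
  simp [nrm]

end World.Hom

/-- The `i`-th space is a Banach space. -/
class World.Banach (w : World) (i : Sp) : Prop where
  sat : w.sat (isBanach i) Env.nil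

theorem World.Hom.banach (f : w.Hom w') [h : w.Banach i] : w'.Banach i :=
  ⟨by simpa using f.sat h.sat⟩

theorem banach_sat [h : w.Banach i] :
    w.sat (isVectorSpace i) Env.nil ∧ w.sat (isNorm i) Env.nil ∧ w.sat (isComplete i) Env.nil := by
  simpa [isBanach] using h.sat

section group
variable [w.Banach i]

theorem vadd_comm' (x y : w.D (.sp i)) : x + y = y + x := by
  have h := (banach_sat (w := w) (i := i)).1
  simp only [isVectorSpace, sat_and] at h
  simpa using sat_all_elim (sat_all_elim h.2.1 x) y

theorem vadd_zero' (x : w.D (.sp i)) : x + 0 = x := by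
  have h := (banach_sat (w := w) (i := i)).1
  simp only [isVectorSpace, sat_and] at h
  simpa using sat_all_elim h.2.2.1 x

theorem vadd_neg' (x : w.D (.sp i)) : x + -x = 0 := by
  have h := (banach_sat (w := w) (i := i)).1
  simp only [isVectorSpace, sat_and] at h
  simpa using sat_all_elim h.2.2.2.1 x

instance : AddCommGroup (w.D (.sp i)) where
  add_assoc x y z := by
    have h := (banach_sat (w := w) (i := i)).1
    simp only [isVectorSpace, sat_and] at h
    simpa using sat_all_elim (sat_all_elim (sat_all_elim h.1 x) y) z
  add_comm := vadd_comm'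
  add_zero := vadd_zero'
  zero_add x := (vadd_comm' _ _).trans (vadd_zero' x)
  neg_add_cancel x := (vadd_comm' _ _).trans (vadd_neg' x)
  sub_eq_add_neg _ _ := rfl
  nsmul := nsmulRec
  zsmul := zsmulRec

theorem rsmul_add' (r : w.D .real) (x y : w.D (.sp i)) : r • (x + y) = r • x + r • y := by
  have h := (banach_sat (w := w) (i := i)).1
  simp only [isVectorSpace, sat_and] at h
  simpa using sat_all_elim (sat_all_elim (sat_all_elim h.2.2.2.2.1 r) x) y

theorem radd_smul' (r s : w.D .real) (x : w.D (.sp i)) : radd r s • x = r • x + s • x := by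
  have h := (banach_sat (w := w) (i := i)).1
  simp only [isVectorSpace, sat_and] at h
  simpa using sat_all_elim (sat_all_elim (sat_all_elim h.2.2.2.2.2.1 r) s) x

theorem rmul_smul' (r s : w.D .real) (x : w.D (.sp i)) : rmul r s • x = r • s • x := by
  have h := (banach_sat (w := w) (i := i)).1
  simp only [isVectorSpace, sat_and] at h
  simpa using sat_all_elim (sat_all_elim (sat_all_elim h.2.2.2.2.2.2.1 r) s) x

theorem ofRat_one_smul' (x : w.D (.sp i)) : ofRat (1 : w.D .rat) • x = x := by
  have h := (banach_sat (w := w) (i := i)).1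
  simp only [isVectorSpace, sat_and] at h
  simpa using sat_all_elim h.2.2.2.2.2.2.2 x

theorem qadd_smul' (p q : w.D .rat) (x : w.D (.sp i)) : (p + q) • x = p • x + q • x := by
  change ofRat (p + q) • x = ofRat p • x + ofRat q • x
  rw [← ofRat_add, radd_smul']

instance : Module (w.D .rat) (w.D (.sp i)) where
  one_smul := ofRat_one_smul'
  mul_smul p q x := by
    change ofRat (p * q) • x = ofRat p • ofRat q • x
    rw [← ofRat_mul, rmul_smul']
  smul_zero q := by
    have := rsmul_add' (ofRat q) (0 : w.D (.sp i)) 0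
    rw [add_zero] at this
    exact left_eq_add.1 this
  smul_add q := rsmul_add' (ofRat q)
  add_smul := qadd_smul'
  zero_smul x := by
    have := qadd_smul' 0 0 x
    rw [add_zero] at this
    exact left_eq_add.1 this

theorem nrm_nonneg (x : w.D (.sp i)) : rle (ofRat 0) (nrm x) := by
  have h := (banach_sat (w := w) (i := i)).2.1
  simp only [isNorm, sat_and] at h
  simpa using sat_all_elim h.1 x

theorem pos_of_nrm {x : w.D (.sp i)} {q : w.D .rat} (h : Above (nrm x) q) : 0 < q :=
  above_ofRat.1 ((nrm_nonneg x).above h)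

/-- Homogeneity for rational scalars, where the absolute value is characterized by its sign and its
square as in the norm axiom. -/
theorem nrm_smul_of_abs {p q : w.D .rat} (hq : 0 ≤ q) (h : q * q = p * p) (x : w.D (.sp i)) :
    nrm (p • x) = rmul (ofRat q) (nrm x) := by
  have h1 := (banach_sat (w := w) (i := i)).2.1
  simp only [isNorm, sat_and] at h1
  have h2 := sat_imp_elim
    (sat_all_elim (sat_all_elim (sat_all_elim h1.2.2.2 (ofRat p)) (ofRat q)) x) ?_
  · have h3 : nrm (ofRat p • x) = rmul (ofRat q) (nrm x) := by simpa using h2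
    exact h3
  · simp only [isAbs, sat_and, sat_le, sat_eq, eval_zeroR, eval_mulR, Tm.eval_wk,
      Tm.eval_var, Env.cons_z, ofRat_mul, h, and_true]
    intro w' f d h1 h2
    simp only [Hom.map_ofRat, above_ofRat, below_ofRat, Hom.map_zeroQ] at h1 h2
    have := f.map_le_iff.2 hq
    rw [f.map_zeroQ] at this
    linarith

@[simp] theorem nrm_neg (x : w.D (.sp i)) : nrm (-x) = nrm x := by
  have h1 := nrm_smul_of_abs (p := -1) (q := 1) zero_le_one (by ring) x
  have h2 := nrm_smul_of_abs (p := 1) (q := 1) zero_le_one (by ring) x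
  rw [neg_smul, one_smul] at h1
  rw [one_smul] at h2
  rw [h1, ← h2]

theorem nrm_sub_rev (x y : w.D (.sp i)) : nrm (x - y) = nrm (y - x) := by
  rw [← nrm_neg, neg_sub]

theorem nrm_add {x y : w.D (.sp i)} {p q : w.D .rat} (hx : Above (nrm x) p)
    (hy : Above (nrm y) q) : Above (nrm (x + y)) (p + q) := by
  have h := (banach_sat (w := w) (i := i)).2.1
  simp only [isNorm, sat_and] at h
  have : rle (nrm (x + y)) (radd (nrm x) (nrm y)) := by
    simpa using sat_all_elim (sat_all_elim h.2.2.1 x) y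
  exact this.above (hx.add hy)

theorem nrm_sub {x y : w.D (.sp i)} {p q : w.D .rat} (hx : Above (nrm x) p)
    (hy : Above (nrm y) q) : Above (nrm (x - y)) (p + q) := by
  rw [sub_eq_add_neg]
  exact nrm_add hx (by rwa [nrm_neg])

theorem nrm_triangle {x y z : w.D (.sp i)} {p q : w.D .rat} (hx : Above (nrm (x - y)) p)
    (hy : Above (nrm (y - z)) q) : Above (nrm (x - z)) (p + q) := by
  rw [← sub_add_sub_cancel x y z]
  exact nrm_add hx hy

/-- Factors above $1$ are reduced to those below it by writing `x` as $p^{-1}(p\,x)$. -/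
theorem above_nrm_smul {p q : w.D .rat} {x : w.D (.sp i)} (hp : 0 < p) :
    Above (nrm (p • x)) (p * q) ↔ Above (nrm x) q := by
  rcases le_total p 1 with h | h
  · rw [nrm_smul_of_abs hp.le rfl, above_ofRat_mul_iff hp h]
  · have h1 : nrm x = rmul (ofRat p⁻¹) (nrm (p • x)) := by
      rw [← nrm_smul_of_abs (by positivity) rfl, inv_smul_smul₀ hp.ne']
    rw [h1]
    nth_rw 2 [show q = p⁻¹ * (p * q) by field_simp]
    rw [above_ofRat_mul_iff (by positivity) (inv_le_one_of_one_le₀ h)]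

theorem above_nrm_smul' {p q : w.D .rat} {x : w.D (.sp i)} (hp : 0 < p) :
    Above (nrm (p • x)) q ↔ Above (nrm x) (q / p) := by
  rw [← above_nrm_smul (q := q / p) hp, mul_div_cancel₀ _ hp.ne']

-- The norm of $0$ has some bound, and homogeneity rescales that bound to any positive number.
@[simp] theorem above_nrm_zero {q : w.D .rat} : Above (nrm (0 : w.D (.sp i))) q ↔ 0 < q := by
  refine ⟨pos_of_nrm, fun h => ?_⟩
  obtain ⟨p, hp, h1⟩ := exists_above (nrm (0 : w.D (.sp i)))
  rw [← smul_zero (q / p), above_nrm_smul' (by positivity)]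
  rwa [show q / (q / p) = p by field_simp]

theorem eq_zero_of_nrm {x : w.D (.sp i)} (h : ∀ (w' : World) (f : w.Hom w') (q : w'.D .rat),
    0 < q → Below (nrm (f.map x)) q → False) : x = 0 := by
  have h1 := (banach_sat (w := w) (i := i)).2.1
  simp only [isNorm, sat_and] at h1
  have h2 := sat_imp_elim (sat_all_elim h1.2.1 x) (by
    simp only [sat_eq, eval_norm, eval_zeroR, Tm.eval_var, Env.cons_z]
    refine rle.antisymm (fun w' f q h1 h2 => ?_) (nrm_nonneg x)
    simp only [Hom.map_ofRat, above_ofRat, Hom.map_nrm, Hom.map_zeroQ] at h1 h2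
    exact h w' f q h1 h2)
  simpa using h2

end group

/-! ## Convergence -/

/-- The sequence `u` converges to `x`. -/
def Conv (u : w.D (seq (.sp i))) (x : w.D (.sp i)) : Prop :=
  ∀ (w' : World) (f : w.Hom w') (q : w'.D .rat), 0 < q → ∃ k, ∀ (w'' : World) (g : w'.Hom w'')
    (n : w''.D .nat), ncast (g.map k) ≤ ncast n →
      Above (nrm (w''.app (g.map (f.map u)) n - g.map (f.map x))) (g.map q)

theorem Conv.map {u : w.D (seq (.sp i))} {x : w.D (.sp i)} (h : Conv u x) (f : w.Hom w') :
    Conv (f.map u) (f.map x) := fun _ g => h _ (f.comp g)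

theorem Conv.exists {u : w.D (seq (.sp i))} {x : w.D (.sp i)} (h : Conv u x) {q : w.D .rat}
    (hq : 0 < q) : ∃ k, ∀ n, ncast k ≤ ncast n → Above (nrm (w.app u n - x)) q := by
  obtain ⟨k, hk⟩ := h w (.id w) q hq
  exact ⟨k, hk w (.id w)⟩

@[simp] theorem World.sat_converges {u : Tm Γ (seq (.sp i))} {x : Tm Γ (.sp i)} {e : Env w.D Γ} :
    w.sat (converges i u x) e ↔ Conv (u.eval w.toInterp e) (x.eval w.toInterp e) := by
  simp only [converges, sat_All, sat_imp_iff, sat_Ex, sat_lt, sat_leN, eval_zeroR, eval_dist,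
    eval_nth, Hom.env_cons, Tm.eval_wk, Hom.eval_env, Tm.eval_var, Env.cons_z, ofRat_rlt]
  constructor
  · intro h w' f q hq
    obtain ⟨k, hk⟩ := h w' f (ofRat q) w' (.id w') (by simpa using hq)
    exact ⟨k, fun w'' g n hn => by simpa using hk w'' g n w'' (.id w'') hn⟩
  · intro h w' f r w'' g hr
    obtain ⟨q, hq, hr⟩ := hr.exists_gt
    obtain ⟨k, hk⟩ := h w'' (f.comp g) q hq
    exact ⟨k, fun w₃ g' n w₄ g'' hn => ⟨g''.map (g'.map q),
      by simpa using hk w₄ (g'.comp g'') (g''.map n) (by simpa using hn), (hr.map g').map g''⟩⟩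

theorem exists_conv [w.Banach i] {u : w.D (seq (.sp i))} (h : ∀ (w' : World) (f : w.Hom w')
    (q : w'.D .rat), 0 < q → ∃ k, ∀ (w'' : World) (g : w'.Hom w'') (m n : w''.D .nat),
      ncast (g.map k) ≤ ncast m → ncast (g.map k) ≤ ncast n →
      Above (nrm (w''.app (g.map (f.map u)) m - w''.app (g.map (f.map u)) n)) (g.map q)) :
    ∃ x, Conv u x := by
  have h1 := sat_imp_elim (sat_all_elim (banach_sat (w := w) (i := i)).2.2 u) (by
    simp only [isCauchy, sat_All, sat_imp_iff, sat_Ex, sat_lt, sat_leN, eval_zeroR, eval_dist,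
      eval_nth, Hom.env_cons, Tm.eval_wk, Tm.eval_var, Env.cons_z, ofRat_rlt]
    intro w' f r w'' g hr
    -- A positive real tolerance exceeds a positive rational one, and rationals suffice from here
    -- on.
    obtain ⟨q, hq, hr⟩ := hr.exists_gt
    obtain ⟨k, hk⟩ := h w'' (f.comp g) q hq
    refine ⟨k, fun w₁ g₁ m w₂ g₂ n w₃ g₃ h₃ w₄ g₄ h₄ => ⟨g₄.map (g₃.map (g₂.map (g₁.map q))),
      ?_, (((hr.map g₁).map g₂).map g₃).map g₄⟩⟩
    have h₅ := (g₄.map_le_iff).2 h₃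
    have := hk w₄ (((g₁.comp g₂).comp g₃).comp g₄) (g₄.map (g₃.map (g₂.map m)))
      (g₄.map (g₃.map n)) (by simpa using h₅) (by simpa using h₄)
    simpa using this)
  simpa using h1

end BISH
end

/-! ### Limits with an explicit rate, choice of sequences, and the operator in a world -/

section
namespace BISH
open World

variable {w w' : World} {Γ : Ctx} {i : Sp}

theorem inv1_sub_pos (n : w.D .nat) : 0 < inv1 n - inv1 (nsucc n) := by
  have := ncast_nonneg n
  rw [inv1_eq, inv1_eq, ncast_nsucc, sub_pos]
  exact one_div_lt_one_div_of_lt (by linarith) (by linarith)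

theorem Conv.unique [w.Banach i] {u : w.D (seq (.sp i))} {x y : w.D (.sp i)} (hx : Conv u x)
    (hy : ∀ (w' : World) (f : w.Hom w') (q : w'.D .rat), 0 < q → ∃ k, ∀ n, ncast k ≤ ncast n →
      Above (nrm (w'.app (f.map u) n - f.map y)) q) : x = y := by
  rw [← sub_eq_zero]
  refine eq_zero_of_nrm fun w' f q hq h => ?_
  have := f.banach (i := i)
  obtain ⟨k, hk⟩ := (hx.map f).exists (half_pos hq)
  obtain ⟨l, hl⟩ := hy w' f (q / 2) (half_pos hq)
  have hn : ∃ n, ncast k ≤ ncast n ∧ ncast l ≤ ncast n :=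
    ⟨nadd k l, by rw [ncast_nadd]; linarith [ncast_nonneg l],
      by rw [ncast_nadd]; linarith [ncast_nonneg k]⟩
  obtain ⟨n, h1, h2⟩ := hn
  have h3 := hk n h1
  rw [nrm_sub_rev] at h3
  have h4 := nrm_triangle h3 (hl n h2)
  rw [f.map_vsub] at h
  have := lt_of_below_above h h4
  linarith

/-- A sequence whose steps are bounded by the decrements of a null sequence converges. -/
theorem exists_limit [w.Banach i] (u : w.D (seq (.sp i))) (S : w.D (seq .rat))
    (h : ∀ (w' : World) (f : w.Hom w') (n : w'.D .nat),
      Above (nrm (w'.app (f.map u) (nsucc n) - w'.app (f.map u) n))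
        (w'.app (f.map S) n - w'.app (f.map S) (nsucc n)))
    (h0 : ∀ (w' : World) (f : w.Hom w') (n : w'.D .nat), 0 ≤ w'.app (f.map S) n)
    (h1 : ∀ (w' : World) (f : w.Hom w') (n : w'.D .nat), w'.app (f.map S) n ≤ inv1 n) :
    ∃ x, Conv u x ∧ ∀ (w' : World) (f : w.Hom w') (n : w'.D .nat),
      Above (nrm (w'.app (f.map u) n - f.map x)) (w'.app (f.map S) n) := by
  -- The steps telescope. The estimate is strict and so fails for equal indices; the induction
  -- inside the world therefore starts at a difference of one.
  have key : ∀ (w' : World) (f : w.Hom w') (m n : w'.D .nat), ncast m ≤ ncast n → n = m ∨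
      Above (nrm (w'.app (f.map u) n - w'.app (f.map u) m))
        (w'.app (f.map S) m - w'.app (f.map S) n) := by
    intro w' f m n hmn
    obtain ⟨k, rfl⟩ := leN_iff.2 hmn
    rcases nat_cases k with rfl | ⟨k, rfl⟩
    · exact .inl (nadd_nzero m)
    right
    have := World.induction (w := w') (Γ := [.nat, seq (.sp i), seq .rat])
      (lt (dist i (nth (.sp i) (.var (.s (.s .z))) (addN (.var (.s .z)) (succ (.var .z))))
        (nth (.sp i) (.var (.s (.s .z))) (.var (.s .z))))
        (ratR (subQ (nth .rat (.var (.s (.s (.s .z)))) (.var (.s .z)))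
          (nth .rat (.var (.s (.s (.s .z)))) (addN (.var (.s .z)) (succ (.var .z)))))))
      (Env.cons m (Env.cons (f.map u) (Env.cons (f.map S) Env.nil)))
      (by simpa using h w' f m) (fun w'' g k hk => by
        have := (f.comp g).banach (i := i)
        have h1 := h w'' (f.comp g) (nadd (g.map m) (nsucc k))
        simp at hk h1 ⊢
        have := nrm_triangle h1 hk
        exact this.mono (by linarith)) k
    simpa using this
  have key' : ∀ (w' : World) (f : w.Hom w') (m n : w'.D .nat) (q : w'.D .rat),
      ncast m ≤ ncast n → w'.app (f.map S) m < q →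
      Above (nrm (w'.app (f.map u) n - w'.app (f.map u) m)) q := by
    intro w' f m n q hmn hq
    have := f.banach (i := i)
    rcases key w' f m n hmn with rfl | h2
    · rw [sub_self, above_nrm_zero]
      exact (h0 w' f n).trans_lt hq
    · exact h2.mono (by linarith [h0 w' f n])
  obtain ⟨x, hx⟩ := exists_conv (u := u) fun w' f q hq => by
    obtain ⟨k, hk⟩ := exists_inv1_lt (half_pos hq)
    refine ⟨k, fun w'' g m n hm hn => ?_⟩
    have := (f.comp g).banach (i := i)
    have hS : w''.app ((f.comp g).map S) (g.map k) < g.map q / 2 := by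
      have hk' : inv1 k + inv1 k < q := by linarith
      rw [← g.map_lt_iff, g.map_addQ, g.map_inv1] at hk'
      linarith [h1 w'' (f.comp g) (g.map k)]
    have h2 := key' w'' (f.comp g) _ _ _ hm hS
    have h3 := key' w'' (f.comp g) _ _ _ hn hS
    rw [nrm_sub_rev] at h3
    exact (nrm_triangle h2 h3).mono (by linarith)
  refine ⟨x, hx, fun w' f n => ?_⟩
  have := f.banach (i := i)
  -- The step at `n` is strictly below its bound. The slack `d` is split between the estimate for
  -- the tail and the passage to the limit, so that the final estimate is strict as well.
  obtain ⟨p, hp, h2⟩ := (h w' f n).exists_lt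
  set d := w'.app (f.map S) n - w'.app (f.map S) (nsucc n) - p with hd
  have hd0 : 0 < d := by linarith
  obtain ⟨k, hk⟩ := (hx.map f).exists (half_pos hd0)
  have h3 := hk (nadd (nsucc n) k) (by
    rw [ncast_nadd, ncast_nsucc]
    linarith [ncast_nonneg n])
  have h4 := key' w' f (nsucc n) (nadd (nsucc n) k) (w'.app (f.map S) (nsucc n) + d / 2) (by
    rw [ncast_nadd]
    linarith [ncast_nonneg k]) (by linarith)
  rw [nrm_sub_rev] at h2 h4
  exact (nrm_triangle (nrm_triangle h2 h4) h3).mono (by linarith)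

/-! ## Pairs and countable choice -/

def pr {a b : Ty} (x : w.D a) (y : w.D b) : w.D (a.prod b) :=
  w.app (w.app (w.const (.pair a b)) x) y
def pr₁ {a b : Ty} (p : w.D (a.prod b)) : w.D a := w.app (w.const (.fst a b)) p
def pr₂ {a b : Ty} (p : w.D (a.prod b)) : w.D b := w.app (w.const (.snd a b)) p

@[simp] theorem pr₁_pr {a b : Ty} (x : w.D a) (y : w.D b) : pr₁ (pr x y) = x :=
  (w.sat_eq _ _ _).1 (sat_all_elim (sat_all_elim (sat_ax (.fst a b) Env.nil) x) y)

@[simp] theorem pr₂_pr {a b : Ty} (x : w.D a) (y : w.D b) : pr₂ (pr x y) = y :=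
  (w.sat_eq _ _ _).1 (sat_all_elim (sat_all_elim (sat_ax (.snd a b) Env.nil) x) y)

/-- The components of a pair, as terms. -/
def fstT (a b : Ty) (p : Tm Γ (a.prod b)) : Tm Γ a := .app (.const (.fst a b)) p
def sndT (a b : Ty) (p : Tm Γ (a.prod b)) : Tm Γ b := .app (.const (.snd a b)) p

@[simp] theorem eval_fstT {a b : Ty} (e : Env w.D Γ) (p : Tm Γ (a.prod b)) :
    (fstT a b p).eval w.toInterp e = pr₁ (p.eval w.toInterp e) := rfl
@[simp] theorem eval_sndT {a b : Ty} (e : Env w.D Γ) (p : Tm Γ (a.prod b)) :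
    (sndT a b p).eval w.toInterp e = pr₂ (p.eval w.toInterp e) := rfl

@[simp] theorem World.Hom.map_pr₁ {a b : Ty} (f : w.Hom w') (p : w.D (a.prod b)) :
    f.map (pr₁ p) = pr₁ (f.map p) := by simp [pr₁]
@[simp] theorem World.Hom.map_pr₂ {a b : Ty} (f : w.Hom w') (p : w.D (a.prod b)) :
    f.map (pr₂ p) = pr₂ (f.map p) := by simp [pr₂]

/-- Countable choice. -/
theorem countable_choice {a : Ty} (A : Fm (a :: .nat :: Γ)) (e : Env w.D Γ)
    (h : ∀ (w' : World) (f : w.Hom w') (n : w'.D .nat), ∃ x,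
      w'.sat A (Env.cons x (Env.cons n (f.env e)))) :
    ∃ F : w.D (seq a), ∀ (w' : World) (f : w.Hom w') (n : w'.D .nat),
      w'.sat A (Env.cons (w'.app (f.map F) n) (Env.cons n (f.env e))) := by
  obtain ⟨x, hx⟩ := h w (.id w) (nzero w)
  -- Dependent choice with a trivial relation between successive terms.
  obtain ⟨F, -, hF⟩ := World.choice A (.eq .nat zeroN zeroN) e (fun w' f n x _ => by
    obtain ⟨y, hy⟩ := h w' f (nsucc n)
    exact ⟨y, hy, by simp⟩) x hx
  exact ⟨F, fun w' f n => (hF w' f n).1⟩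

/-! ## The operator -/

/-- The hypotheses on the spaces and the operator hold. -/
class World.Model (w : World) : Prop where
  banachX : w.Banach .X
  banachY : w.Banach .Y
  separable : w.sat (isSeparable .X) Env.nil
  linear : w.sat isLinear Env.nil
  continuous : w.sat isSeqContinuous Env.nil
  onto : w.sat isOnto Env.nil
  located : w.sat kerLocated Env.nil

instance [h : w.Model] : w.Banach .X := h.banachX
instance [h : w.Model] : w.Banach .Y := h.banachY

theorem World.Hom.model (f : w.Hom w') [h : w.Model] : w'.Model where
  banachX := f.banach
  banachY := f.banach
  separable := by simpa using f.sat h.separable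
  linear := by simpa using f.sat h.linear
  continuous := by simpa using f.sat h.continuous
  onto := by simpa using f.sat h.onto
  located := by simpa using f.sat h.located

def opT (x : w.D (.sp .X)) : w.D (.sp .Y) := w.app (w.const .op) x

@[simp] theorem eval_T (e : Env w.D Γ) (x : Tm Γ (.sp .X)) :
    (T x).eval w.toInterp e = opT (x.eval w.toInterp e) := rfl

@[simp] theorem World.Hom.map_opT (f : w.Hom w') (x : w.D (.sp .X)) :
    f.map (opT x) = opT (f.map x) := by simp [opT]

@[simp] theorem World.sat_inKer {z : Tm Γ (.sp .X)} {e : Env w.D Γ} :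
    w.sat (inKer z) e ↔ opT (z.eval w.toInterp e) = 0 := by
  simp [inKer]

/-- The sequence `u` is dense in `X`. -/
def Dense (u : w.D (seq (.sp .X))) : Prop := ∀ (w' : World) (f : w.Hom w') (x : w'.D (.sp .X))
  (q : w'.D .rat), 0 < q → ∃ n, Above (nrm (x - w'.app (f.map u) n)) q

theorem Dense.map {u : w.D (seq (.sp .X))} (hu : Dense u) (f : w.Hom w') : Dense (f.map u) :=
  fun _ g => hu _ (f.comp g)

section
variable [h : w.Model]

@[simp] theorem opT_add (x y : w.D (.sp .X)) : opT (x + y) = opT x + opT y := by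
  have h := h.linear
  simp only [isLinear, sat_and] at h
  simpa using sat_all_elim (sat_all_elim h.1 x) y

@[simp] theorem opT_smul (q : w.D .rat) (x : w.D (.sp .X)) : opT (q • x) = q • opT x := by
  have h := h.linear
  simp only [isLinear, sat_and] at h
  have h1 : opT (ofRat q • x) = ofRat q • opT x := by
    simpa using sat_all_elim (sat_all_elim h.2 (ofRat q)) x
  exact h1

@[simp] theorem opT_zero : opT (0 : w.D (.sp .X)) = 0 := by
  rw [← zero_smul (w.D .rat) (0 : w.D (.sp .X)), opT_smul, zero_smul]

@[simp] theorem opT_neg (x : w.D (.sp .X)) : opT (-x) = -opT x := by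
  rw [← neg_one_smul (w.D .rat), opT_smul, neg_one_smul]

@[simp] theorem opT_sub (x y : w.D (.sp .X)) : opT (x - y) = opT x - opT y := by
  rw [sub_eq_add_neg, opT_add, opT_neg, sub_eq_add_neg]

theorem exists_opT_eq (y : w.D (.sp .Y)) : ∃ x, opT x = y := by
  simpa using sat_all_elim h.onto y

theorem Conv.opT {u : w.D (seq (.sp .X))} {x : w.D (.sp .X)} (hu : Conv u x) :
    ∃ v : w.D (seq (.sp .Y)), Conv v (opT x) ∧ ∀ (w' : World) (f : w.Hom w') (n : w'.D .nat),
      w'.app (f.map v) n = BISH.opT (w'.app (f.map u) n) := by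
  obtain ⟨v, hv⟩ := exists_fn (Env.cons u Env.nil) (T (nth (.sp .X) (.var (.s .z)) (.var .z)))
  have hv' : ∀ (w' : World) (f : w.Hom w') (n : w'.D .nat),
      w'.app (f.map v) n = BISH.opT (w'.app (f.map u) n) := fun w' f n => by simpa using hv w' f n
  refine ⟨v, ?_, hv'⟩
  have := sat_imp_elim (sat_imp_elim
    (sat_all_elim (sat_all_elim (sat_all_elim h.continuous u) x) v) (by simpa using hu))
    (by simpa [sat_All] using hv')
  simpa using this

theorem exists_dense : ∃ u : w.D (seq (.sp .X)), Dense u := by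
  have h1 := h.separable
  simp only [isSeparable, sat_Ex] at h1
  obtain ⟨u, hu⟩ := h1
  refine ⟨u, fun w' f x q hq => ?_⟩
  have h2 := sat_imp_elim (sat_all_elim (sat_all_elim (f.sat hu) x) (ofRat q)) (by simpa using hq)
  simpa using h2

/-- Countable choice selects terms of `u` within $1/(n+1)$ of `x`. They converge to `x`, so by
sequential continuity their images converge to the image of `x`, and a late term is good for both.
-/
theorem Dense.exists_near {u : w.D (seq (.sp .X))} (hu : Dense u) (x : w.D (.sp .X))
    {q : w.D .rat} (hq : 0 < q) : ∃ n, Above (nrm (w.app u n - x)) q ∧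
      Above (nrm (BISH.opT (w.app u n) - BISH.opT x)) q := by
  obtain ⟨J, hJ⟩ := countable_choice (Γ := [.sp .X, seq (.sp .X)])
    (lt (dist .X (.var (.s (.s .z))) (nth (.sp .X) (.var (.s (.s (.s .z)))) (.var .z)))
      (ratR (rcp (.var (.s .z))))) (Env.cons x (Env.cons u Env.nil)) (fun w' f n => by
        simpa using hu w' f (f.map x) (inv1 n) (inv1_pos n))
  have hJ' : ∀ (w' : World) (f : w.Hom w') (n : w'.D .nat), Above (nrm (f.map x -
      w'.app (f.map u) (w'.app (f.map J) n))) (inv1 n) := fun w' f n => by simpa using hJ w' f n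
  obtain ⟨v, hv⟩ := exists_fn (Env.cons J (Env.cons u Env.nil))
    (nth (.sp .X) (.var (.s (.s .z))) (nth .nat (.var (.s .z)) (.var .z)))
  have hv' : ∀ (w' : World) (f : w.Hom w') (n : w'.D .nat),
      w'.app (f.map v) n = w'.app (f.map u) (w'.app (f.map J) n) :=
    fun w' f n => by simpa using hv w' f n
  have hc : Conv v x := by
    intro w' f q hq
    obtain ⟨k, hk⟩ := exists_inv1_lt hq
    refine ⟨k, fun w'' g n hn => ?_⟩
    have := (f.comp g).model
    have h1 := hJ' w'' (f.comp g) n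
    have h2 := hv' w'' (f.comp g) n
    simp only [Hom.map_comp] at h1 h2
    rw [h2, nrm_sub_rev]
    refine h1.mono ((inv1_le_inv1 hn).trans ?_)
    have := g.map_le_iff.2 hk.le
    simpa using this
  obtain ⟨v', hc', hv''⟩ := hc.opT
  obtain ⟨k, hk⟩ := hc.exists hq
  obtain ⟨l, hl⟩ := hc'.exists hq
  have h1 := hk (nadd k l) (by rw [ncast_nadd]; linarith [ncast_nonneg l])
  have h2 := hl (nadd k l) (by rw [ncast_nadd]; linarith [ncast_nonneg k])
  have h3 := hv' w (.id w) (nadd k l)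
  have h4 := hv'' w (.id w) (nadd k l)
  simp only [Hom.map_id] at h3 h4
  rw [h4] at h2
  rw [h3] at h1 h2
  exact ⟨_, h1, h2⟩

end

end BISH
end

/-! ### Deciding by a convergent sequence of images -/

section
namespace BISH
open World

variable {w w' : World} {Γ : Ctx} {i : Sp}

theorem nsucc_inj {m n : w.D .nat} (h : nsucc m = nsucc n) : m = n :=
  (w.sat_eq _ _ _).1 (sat_imp_elim (sat_all_elim (sat_all_elim (sat_ax .succ_inj Env.nil) m) n)
    ((w.sat_eq _ _ _).2 h))

theorem eq_nzero_of_le {n : w.D .nat} (h : ncast n ≤ 0) : n = nzero w := by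
  rcases nat_cases n with rfl | ⟨m, rfl⟩
  · rfl
  · rw [ncast_nsucc] at h
    linarith [ncast_nonneg m]

theorem le_or_eq_nsucc {m n : w.D .nat} (h : ncast m ≤ ncast (nsucc n)) :
    ncast m ≤ ncast n ∨ m = nsucc n := by
  obtain ⟨k, hk⟩ := leN_iff.2 h
  rcases nat_cases k with rfl | ⟨k, rfl⟩
  · exact .inr (by simpa using hk)
  · rw [nadd_nsucc] at hk
    rw [← nsucc_inj hk, ncast_nadd]
    exact .inl (by linarith [ncast_nonneg k])

@[simp] theorem ofRat_rsmul (q : w.D .rat) (x : w.D (.sp i)) : ofRat q • x = q • x := rfl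

theorem World.sat_subst_cons {Δ : Ctx} {a : Ty} (φ : Fm (a :: Γ)) (t : Tm Δ a) (σ : Sub Γ Δ)
    (e : Env w.D Δ) : w.sat (φ.subst (Sub.cons t σ)) e ↔
      w.sat φ (Env.cons (t.eval w.toInterp e) fun b v => (σ b v).eval w.toInterp e) := by
  rw [sat_subst]
  apply iff_of_eq
  congr 1
  funext b v
  cases v <;> rfl

/-! ## Points far from the kernel -/

/-- The distance of `x` to all points of the kernel is at least `ρ`. -/
def far (x : Tm Γ (.sp .X)) (ρ : Tm Γ .rat) : Fm Γ :=
  All (.sp .X) fun z => inKer z ⇒ lt (dist .X x z) (ratR ρ) ⇒ .bot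

/-- The distance of `x` to all points of the kernel is at least `ρ`. -/
def Far (x : w.D (.sp .X)) (ρ : w.D .rat) : Prop :=
  ∀ (w' : World) (f : w.Hom w') (z : w'.D (.sp .X)), opT z = 0 →
    Above (nrm (f.map x - z)) (f.map ρ) → False

@[simp] theorem World.sat_far {x : Tm Γ (.sp .X)} {ρ : Tm Γ .rat} {e : Env w.D Γ} :
    w.sat (far x ρ) e ↔ Far (x.eval w.toInterp e) (ρ.eval w.toInterp e) := by
  simp only [far, sat_All, sat_imp_iff, sat_inKer, sat_lt, eval_dist, Hom.env_cons, Tm.eval_wk,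
    Hom.eval_env, Tm.eval_var, Env.cons_z, eval_ratR, rlt_ofRat, sat_bot]
  exact ⟨fun h w' f z hz h' => h w' f z w' (.id w') hz w' (.id w') h',
    fun h w' f z w'' g hz w₃ g' h' => h w₃ ((f.comp g).comp g') (g'.map (g.map z))
      (by rw [← Hom.map_opT, hz, Hom.map_vzero]) h'⟩

/-- A flag and a vector. -/
abbrev flagged : Ty := .prod .nat (.sp .Y)

/-- The vector `s` is zero and `B` holds up to `n`, or it is flagged by `m + 1` where `A m`. -/
def flagState (A B : Fm (.nat :: Γ)) : Fm (flagged :: .nat :: .rat :: Γ) :=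
  (.eq .nat (fstT .nat (.sp .Y) (.var .z)) zeroN ⩓
    .eq (.sp .Y) (sndT .nat (.sp .Y) (.var .z)) (vzero .Y) ⩓
    .all .nat (leN (.var .z) (.var (.s (.s .z))) ⇒
      B.subst (Sub.cons (.var .z) fun _ v => .var (.s (.s (.s (.s v))))))) ⩔
  .ex .nat (.eq .nat (fstT .nat (.sp .Y) (.var (.s .z))) (succ (.var .z)) ⩓
    A.subst (Sub.cons (.var .z) fun _ v => .var (.s (.s (.s (.s v))))) ⩓
    .ex (.sp .X) (far (.var .z) (.var (.s (.s (.s (.s .z))))) ⩓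
      .eq (.sp .Y) (sndT .nat (.sp .Y) (.var (.s (.s .z))))
        (smul .Y (ratR (natQ (.var (.s .z)))) (T (.var .z)))))

/-- A flagged vector stays; an unflagged one may be flagged by `n + 2` and then moves little. -/
def flagStep : Fm (flagged :: flagged :: .nat :: .rat :: Γ) :=
  (.eq .nat (fstT .nat (.sp .Y) (.var (.s .z))) zeroN ⩓
    (.eq .nat (fstT .nat (.sp .Y) (.var .z)) zeroN ⩔
      .eq .nat (fstT .nat (.sp .Y) (.var .z)) (succ (succ (.var (.s (.s .z)))))) ⩓
    lt (dist .Y (sndT .nat (.sp .Y) (.var .z)) (sndT .nat (.sp .Y) (.var (.s .z))))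
      (ratR (subQ (rcp (.var (.s (.s .z)))) (rcp (succ (.var (.s (.s .z)))))))) ⩔
  .eq flagged (.var .z) (.var (.s .z))

theorem World.sat_flagState (A B : Fm (.nat :: Γ)) (e : Env w.D Γ) (ρ : w.D .rat) (n : w.D .nat)
    (s : w.D flagged) : w.sat (flagState A B) (Env.cons s (Env.cons n (Env.cons ρ e))) ↔
      (pr₁ s = nzero w ∧ pr₂ s = 0 ∧ ∀ (w' : World) (g : w.Hom w') (k : w'.D .nat),
        ncast k ≤ ncast (g.map n) → w'.sat B (Env.cons k (g.env e))) ∨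
      ∃ m, pr₁ s = nsucc m ∧ w.sat A (Env.cons m e) ∧ ∃ x, Far x ρ ∧
        pr₂ s = ncast m • opT x := by
  simp only [flagState, sat_or, sat_and, sat_eq, eval_fstT, eval_sndT, Tm.eval_var, Env.cons_z,
    Env.cons_s, eval_zeroN, eval_vzero, sat_all_iff, sat_imp_iff, sat_leN, sat_subst_cons,
    Hom.env_cons, sat_ex, eval_succ, sat_far, eval_smul, eval_ratR, eval_natQ, eval_T,
    ofRat_rsmul]
  refine or_congr_left (and_congr_right fun _ => and_congr_right fun _ => ?_)
  exact ⟨fun h w' g k => h w' g k w' (.id w'),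
    fun h w' g k w'' g' => h w'' (g.comp g') (g'.map k)⟩

theorem World.sat_flagStep (e : Env w.D Γ) (ρ : w.D .rat) (n : w.D .nat) (s s' : w.D flagged) :
    w.sat flagStep (Env.cons s' (Env.cons s (Env.cons n (Env.cons ρ e)))) ↔
      (pr₁ s = nzero w ∧ (pr₁ s' = nzero w ∨ pr₁ s' = nsucc (nsucc n)) ∧
        Above (nrm (pr₂ s' - pr₂ s)) (inv1 n - inv1 (nsucc n))) ∨ s' = s := by
  simp [flagStep]

/-- If each `A n` or `B n` holds, where `B n` provides a point far from the kernel with small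
image, then either some `A n` holds or all `B n` do. -/
theorem dichotomy [w.Model] (A B : Fm (.nat :: Γ)) (e : Env w.D Γ) {ρ : w.D .rat} (hρ : 0 < ρ)
    (h : ∀ (w' : World) (f : w.Hom w') (n : w'.D .nat),
      w'.sat A (Env.cons n (f.env e)) ∨ w'.sat B (Env.cons n (f.env e)))
    (hB : ∀ (w' : World) (f : w.Hom w') (n : w'.D .nat), w'.sat B (Env.cons n (f.env e)) →
      ∃ x : w'.D (.sp .X), Far x (f.map ρ) ∧
        Above (nrm (opT x)) ((inv1 n - inv1 (nsucc n)) * inv1 n)) :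
    (∃ n, w.sat A (Env.cons n e)) ∨
      ∀ (w' : World) (f : w.Hom w') (n : w'.D .nat), w'.sat B (Env.cons n (f.env e)) := by
  rcases h w (.id w) (nzero w) with h0 | h0
  · exact .inl ⟨_, h0⟩
  have hinit : ∀ (w' : World) (f : w.Hom w') (k : w'.D .nat), ncast k ≤ ncast (f.map (nzero w)) →
      w'.sat B (Env.cons k (f.env e)) := fun w' f k hk => by
    rw [f.map_nzero, ncast_nzero] at hk
    rw [eq_nzero_of_le hk]
    simpa using f.sat h0
  -- The premise decides between $A$ and $B$ without providing a function that makes the decisions.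
  -- Dependent choice records them in the flag, where $0$ means that only $B$ has been chosen so
  -- far.
  obtain ⟨F, hF0, hF⟩ := World.choice (flagState A B) flagStep (Env.cons ρ e) (fun w' f n s hs => by
    have := f.model
    simp only [Hom.env_cons, sat_flagState, sat_flagStep] at hs ⊢
    rcases hs with ⟨h1, h2, h3⟩ | hs
    · rcases h w' f (nsucc n) with h4 | h4
      · obtain ⟨x, hx, hx'⟩ := hB w' f n (h3 w' (.id w') n le_rfl)
        -- The point comes from $B_n$ and is used when $A_{n+1}$ is chosen. Multiplying by $n+1$
        -- cancels the factor $1/(n+1)$ in the bound on its image, so the jump is shorter than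
        -- $1/(n+1)-1/(n+2)$.
        refine ⟨pr (nsucc (nsucc n)) (ncast (nsucc n) • opT x), .inr ⟨nsucc n, by simp, h4, x, hx,
          by simp⟩, .inl ⟨h1, by simp, ?_⟩⟩
        rw [pr₂_pr, h2, sub_zero, above_nrm_smul' (by
          rw [ncast_nsucc]
          linarith [ncast_nonneg n])]
        refine hx'.mono (le_of_eq ?_)
        rw [div_eq_mul_one_div, ncast_nsucc, ← inv1_eq]
      · refine ⟨pr (nzero w') 0, .inl ⟨by simp, by simp, fun w'' g k hk => ?_⟩,
          .inl ⟨h1, by simp, ?_⟩⟩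
        · rw [g.map_nsucc] at hk
          rcases le_or_eq_nsucc hk with hk | rfl
          · exact h3 w'' g k hk
          · simpa using g.sat h4
        · rw [pr₂_pr, h2, sub_zero, above_nrm_zero]
          exact inv1_sub_pos n
    · exact ⟨s, .inr hs, .inr rfl⟩) (pr (nzero w) 0) (by
      rw [sat_flagState]
      exact .inl ⟨by simp, by simp, hinit⟩)
  simp only [Hom.env_cons, sat_flagState, sat_flagStep] at hF
  obtain ⟨Y, hY⟩ := exists_fn (Env.cons F Env.nil)
    (sndT .nat (.sp .Y) (nth flagged (.var (.s .z)) (.var .z)))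
  have hY' : ∀ (w' : World) (f : w.Hom w') (n : w'.D .nat),
      w'.app (f.map Y) n = pr₂ (w'.app (f.map F) n) := fun w' f n => by simpa using hY w' f n
  obtain ⟨S, hS⟩ := exists_fn (w := w) Env.nil (rcp (.var .z))
  have hS' : ∀ (w' : World) (f : w.Hom w') (n : w'.D .nat), w'.app (f.map S) n = inv1 n :=
    fun w' f n => by simpa using hS w' f n
  obtain ⟨y, hy, -⟩ := exists_limit Y S (fun w' f n => by
    have := f.model
    rw [hY', hY', hS', hS']
    rcases (hF w' f n).2 with h1 | h1
    · exact h1.2.2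
    · rw [h1, sub_self, above_nrm_zero]
      exact inv1_sub_pos n) (fun w' f n => by
    rw [hS']
    exact (inv1_pos n).le) (fun w' f n => by rw [hS'])
  -- Surjectivity gives a preimage `u` of the limit. Since $N>c/\rho$ with $c>\|u\|$, a jump with
  -- multiplier $m\ge N$ is impossible.
  obtain ⟨u, rfl⟩ := exists_opT_eq y
  obtain ⟨c, hc, hu⟩ := exists_above (nrm u)
  obtain ⟨N, hN⟩ := exists_ncast_gt (c / ρ)
  -- The state at `N` decides: a raised flag exhibits an instance of $A$. Otherwise the flag is
  -- never raised in any later world, and so $B$ holds throughout.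
  rcases (hF w (.id w) N).1 with h1 | ⟨m, -, h1, -⟩
  swap
  · exact .inl ⟨m, h1⟩
  right
  intro w' f n
  have := f.model
  rcases (hF w' f n).1 with h2 | ⟨m, hm, -, x, hx, hx'⟩
  · exact h2.2.2 w' (.id w') n le_rfl
  exfalso
  -- the flag is raised only after `N`
  have hflag : ∀ k : w'.D .nat, pr₁ (w'.app (f.map F) (nadd (f.map N) k)) = nzero w' ∨
      ∃ m, pr₁ (w'.app (f.map F) (nadd (f.map N) k)) = nsucc m ∧ ncast (f.map N) ≤ ncast m := by
    intro k
    have := World.induction (w := w') (Γ := [.nat, seq flagged])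
      (.eq .nat (fstT .nat (.sp .Y) (nth flagged (.var (.s (.s .z))) (addN (.var (.s .z)) (.var .z))))
        zeroN ⩔ Ex .nat fun m => .eq .nat (fstT .nat (.sp .Y) (nth flagged (.var (.s (.s (.s .z))))
          (addN (.var (.s (.s .z))) (.var (.s .z))))) (succ m) ⩓ leN (.var (.s (.s .z))) m)
      (Env.cons (f.map N) (Env.cons (f.map F) Env.nil))
      (by
        have := congrArg f.map h1.1
        simp at this
        simp [this]) (fun w'' g k hk => by
        have h3 := (hF w'' (f.comp g) (nadd (g.map (f.map N)) k)).2
        simp only [Hom.map_comp] at h3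
        simp at hk ⊢
        rcases h3 with ⟨-, h3 | h3, -⟩ | h3
        · exact .inl h3
        · refine .inr ⟨_, h3, ?_⟩
          rw [ncast_nsucc, ncast_nadd]
          linarith [ncast_nonneg k]
        · rw [h3]
          exact hk) k
    simpa using this
  -- Once raised, the flag cannot satisfy the first alternative of `flagStep`, so the state no
  -- longer changes and the limit is the vector at `n`.
  have hconst : ∀ (w'' : World) (g : w'.Hom w'') (k : w''.D .nat),
      w''.app (g.map (f.map F)) (nadd (g.map n) k) = w''.app (g.map (f.map F)) (g.map n) := by
    intro w₁ g₁ k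
    have := World.induction (w := w₁) (Γ := [.nat, seq flagged])
      (.eq flagged (nth flagged (.var (.s (.s .z))) (addN (.var (.s .z)) (.var .z)))
        (nth flagged (.var (.s (.s .z))) (.var (.s .z))))
      (Env.cons (g₁.map n) (Env.cons (g₁.map (f.map F)) Env.nil)) (by simp) (fun w₂ g₂ k hk => by
        have h3 := (hF w₂ ((f.comp g₁).comp g₂) (nadd (g₂.map (g₁.map n)) k)).2
        simp only [Hom.map_comp] at h3
        have hm' := congrArg g₂.map (congrArg g₁.map hm)
        simp at hk hm' ⊢
        rw [hk] at h3
        rcases h3 with ⟨h3, -⟩ | h3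
        · exact absurd (hm'.symm.trans h3) (nsucc_ne_nzero _)
        · exact h3) k
    simpa using this
  have hle : ncast (f.map N) ≤ ncast m := by
    rcases le_total (ncast n) (ncast (f.map N)) with hn | hn
    · exfalso
      obtain ⟨k, hk⟩ := leN_iff.2 hn
      have h3 := hconst w' (.id w') k
      have h4 := congrArg f.map h1.1
      simp only [Hom.map_id, Hom.map_pr₁, Hom.map_app, Hom.map_nzero] at h3 h4
      rw [← hk, h3, hm] at h4
      exact nsucc_ne_nzero _ h4
    · obtain ⟨k, rfl⟩ := leN_iff.2 hn
      rcases hflag k with h3 | ⟨m', h3, h4⟩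
      · exact absurd (hm.symm.trans h3) (nsucc_ne_nzero _)
      · rwa [nsucc_inj (hm.symm.trans h3)]
  have hlim : f.map (opT u) = ncast m • opT x := by
    refine (hy.map f).unique fun w'' g q hq => ⟨g.map n, fun l hl => ?_⟩
    have := (f.comp g).model
    obtain ⟨k, rfl⟩ := leN_iff.2 hl
    have h3 := hY' w'' (f.comp g) (nadd (g.map n) k)
    simp only [Hom.map_comp] at h3
    rw [h3, hconst, ← hx']
    simpa using hq
  have hN' := f.map_le_iff.2 ((div_lt_iff₀ hρ).1 hN).le
  have hc' := f.map_pos_iff.2 hc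
  have hρ' := f.map_pos_iff.2 hρ
  simp only [Hom.map_mulQ, Hom.map_ncast] at hN'
  have hm0 : 0 < ncast m := by
    have := f.map_pos_iff.2 ((div_pos hc hρ).trans hN)
    rw [f.map_ncast] at this
    linarith
  -- This point is in the kernel because $Tu=m\,Tx$, and its distance to `x` is
  -- $\|u\|/m<c/m\le\rho$, which contradicts that `x` is far from the kernel.
  refine hx w' (.id w') (x - (1 / ncast m) • f.map u) ?_ ?_
  · rw [opT_sub, opT_smul, ← f.map_opT, hlim, smul_smul, one_div_mul_cancel hm0.ne', one_smul,
      sub_self]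
  · simp only [Hom.map_id, sub_sub_cancel]
    rw [above_nrm_smul' (by positivity)]
    have h5 := hu.map f
    rw [f.map_nrm] at h5
    refine h5.mono (hN'.trans ?_)
    rw [div_div_eq_mul_div, div_one, mul_comm]
    exact mul_le_mul_of_nonneg_left hle hρ'.le

end BISH
end

/-! ### Omniscience, the open mapping argument and Baire's argument -/

section
namespace BISH
open World

variable {w w' : World} {Γ : Ctx}

/-- There are points at distance at least `ρ` from the kernel with arbitrarily small images. -/
def SmallFar (ρ : w.D .rat) : Prop := ∀ (w' : World) (f : w.Hom w') (q : w'.D .rat), 0 < q →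
  ∃ x : w'.D (.sp .X), Far x (f.map ρ) ∧ Above (nrm (opT x)) q

theorem SmallFar.map {ρ : w.D .rat} (h : SmallFar ρ) (f : w.Hom w') : SmallFar (f.map ρ) :=
  fun _ g => h _ (f.comp g)

/-- The limited principle of omniscience. -/
theorem SmallFar.omniscience [w.Model] {ρ : w.D .rat} (hs : SmallFar ρ) (hρ : 0 < ρ)
    (A B : Fm (.nat :: Γ)) (e : Env w.D Γ)
    (h : ∀ (w' : World) (f : w.Hom w') (n : w'.D .nat),
      w'.sat A (Env.cons n (f.env e)) ∨ w'.sat B (Env.cons n (f.env e))) :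
    (∃ n, w.sat A (Env.cons n e)) ∨ w.sat (.all .nat B) e := by
  rw [sat_all_iff]
  exact dichotomy A B e hρ h fun w' f n _ =>
    hs w' f _ (mul_pos (inv1_sub_pos n) (inv1_pos n))

/-- The images of balls are nowhere dense. -/
theorem SmallFar.not_dense [w.Model] {ρ : w.D .rat} (hs : SmallFar ρ) (hρ : 0 < ρ)
    (y : w.D (.sp .Y)) {s M : w.D .rat} (hs0 : 0 < s) (hM : 0 < M)
    (hd : ∀ (w' : World) (f : w.Hom w') (z : w'.D (.sp .Y)) (q : w'.D .rat), 0 < q →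
      Above (nrm (z - f.map y)) (f.map s) →
      ∃ x, Above (nrm x) (f.map M) ∧ Above (nrm (opT x - z)) q) : False := by
  -- The ball is recentred at $0$ and rescaled: approximate preimages of $y+t^{-1}z$ and of $y$ are
  -- subtracted and multiplied by $t$, which doubles the bound `M`.
  have hd' : ∀ (w' : World) (f : w.Hom w') (z : w'.D (.sp .Y)) (t q : w'.D .rat), 0 < t → 0 < q →
      Above (nrm z) (t * f.map s) →
      ∃ x, Above (nrm x) (t * (f.map M + f.map M)) ∧ Above (nrm (opT x - z)) q := by
    intro w' f z t q ht hq hz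
    have := f.model
    obtain ⟨x, hx, hx'⟩ := hd w' f (f.map y + t⁻¹ • z) (q / t / 2) (by positivity) (by
      rw [add_sub_cancel_left, above_nrm_smul' (by positivity)]
      rwa [div_inv_eq_mul, mul_comm])
    obtain ⟨x', hx₂, hx₂'⟩ := hd w' f (f.map y) (q / t / 2) (by positivity) (by
      rw [sub_self, above_nrm_zero]
      exact f.map_pos_iff.2 hs0)
    refine ⟨t • (x - x'), (above_nrm_smul ht).2 (nrm_sub hx hx₂), ?_⟩
    have h1 := (above_nrm_smul ht).2 (nrm_sub hx' hx₂')
    rw [add_halves, mul_div_cancel₀ _ ht.ne'] at h1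
    convert h1 using 2
    rw [opT_smul, opT_sub, sub_sub_sub_comm, add_sub_cancel_left, smul_sub t (opT x - opT x'),
      smul_inv_smul₀ ht.ne']
  -- The total length of the corrections is to be less than `κ`: at most `ρ` for the final
  -- contradiction, and at most $1$ because `exists_limit` asks for the rate $1/(n+1)$.
  obtain ⟨κ, hκ, hκ1, hκρ⟩ : ∃ κ > 0, κ ≤ 1 ∧ κ ≤ ρ :=
    ⟨min 1 ρ, lt_min one_pos hρ, min_le_left _ _, min_le_right _ _⟩
  obtain ⟨c, hc, hcκ⟩ : ∃ c > 0, c * (M + M) = κ :=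
    ⟨κ / (M + M), by positivity, div_mul_cancel₀ _ (by positivity)⟩
  obtain ⟨x, hx, hTx⟩ := hs w (.id w) (c * s * (inv1 (nzero w) - inv1 (nsucc (nzero w))))
    (mul_pos (mul_pos hc hs0) (inv1_sub_pos _))
  -- Successive approximation of $Tx$ from $u_0=0$: the residual at stage `n` is less than
  -- $cs(1/(n+1)-1/(n+2))$, and the correction that reduces it is shorter than
  -- $\kappa(1/(n+1)-1/(n+2))$.
  obtain ⟨u, hu0, hu⟩ := World.choice (a := .sp .X)
    (Γ := [.sp .Y, .rat, .rat])
    (lt (dist .Y (.var (.s (.s .z))) (T (.var .z))) (ratR (mulQ (.var (.s (.s (.s .z))))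
      (subQ (rcp (.var (.s .z))) (rcp (succ (.var (.s .z))))))))
    (lt (dist .X (.var .z) (.var (.s .z))) (ratR (mulQ (.var (.s (.s (.s (.s (.s .z))))))
      (subQ (rcp (.var (.s (.s .z)))) (rcp (succ (.var (.s (.s .z)))))))))
    (Env.cons (opT x) (Env.cons (c * s) (Env.cons κ Env.nil))) (fun w' f n v hv => by
      have := f.model
      simp at hv ⊢
      have hn := inv1_sub_pos n
      have hn' := inv1_sub_pos (nsucc n)
      have hc' := f.map_pos_iff.2 hc
      have hs' := f.map_pos_iff.2 hs0
      obtain ⟨x', hx', hx''⟩ := hd' w' f (opT (f.map x) - opT v)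
        (f.map c * (inv1 n - inv1 (nsucc n)))
        (f.map c * f.map s * (inv1 (nsucc n) - inv1 (nsucc (nsucc n)))) (by positivity)
        (by positivity) (by
          convert hv using 1
          ring)
      refine ⟨v + x', ?_, ?_⟩
      · rw [nrm_sub_rev] at hx''
        convert hx'' using 2
        rw [opT_add, sub_add_eq_sub_sub]
      · rw [add_sub_cancel_left]
        convert hx' using 1
        rw [← hcκ, f.map_mulQ, f.map_addQ]
        ring)
    0 (by simpa using hTx)
  simp at hu
  obtain ⟨S, hS⟩ := exists_fn (Env.cons κ Env.nil) (mulQ (.var (.s .z)) (rcp (.var .z)))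
  have hS' : ∀ (w' : World) (f : w.Hom w') (n : w'.D .nat), w'.app (f.map S) n =
    f.map κ * inv1 n := fun w' f n => by simpa using hS w' f n
  obtain ⟨v, hv, hv'⟩ := exists_limit u S (fun w' f n => by
    rw [hS', hS', ← mul_sub]
    exact (hu w' f n).2) (fun w' f n => by
    rw [hS']
    exact (mul_pos (f.map_pos_iff.2 hκ) (inv1_pos n)).le) (fun w' f n => by
    rw [hS']
    have h1 := f.map_le_iff.2 hκ1
    rw [f.map_oneQ] at h1
    exact mul_le_of_le_one_left (inv1_pos n).le h1)
  have hTv : opT v = opT x := by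
    obtain ⟨v', h1, h2⟩ := hv.opT
    refine h1.unique fun w' f q hq => ?_
    have := f.model
    have hcs := f.map_pos_iff.2 (mul_pos hc hs0)
    obtain ⟨k, hk⟩ := exists_inv1_lt (div_pos hq hcs)
    refine ⟨k, fun n hn => ?_⟩
    have h3 := (hu w' f n).1
    rw [nrm_sub_rev, ← h2, ← f.map_opT, ← f.map_mulQ] at h3
    refine h3.mono ?_
    rw [lt_div_iff₀ hcs] at hk
    nlinarith [inv1_le_inv1 hn, inv1_pos (nsucc n)]
  -- The limit `v` has the same image as `x` and norm less than `ρ`, so $x-v$ is a kernel point too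
  -- close to `x`.
  refine hx w (.id w) (x - v) (by rw [opT_sub, hTv, sub_self]) ?_
  have h1 := hv' w (.id w) (nzero w)
  rw [hS'] at h1
  simp only [Hom.map_id, hu0, zero_sub, nrm_neg, sub_sub_cancel] at h1 ⊢
  refine h1.mono ((mul_le_of_le_one_right hκ.le (inv1_le_one _)).trans hκρ)

/-- Some ball inside a given one does not meet the image of a given ball. -/
theorem SmallFar.exists_ball [w.Model] {ρ : w.D .rat} (hs : SmallFar ρ) (hρ : 0 < ρ)
    (y : w.D (.sp .Y)) {s M : w.D .rat} (hs0 : 0 < s) (hM : 0 < M) :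
    ∃ (y' : w.D (.sp .Y)) (s' : w.D .rat), 0 < s' ∧ Above (nrm (y' - y)) (s - s') ∧
      ∀ (w' : World) (f : w.Hom w') (x : w'.D (.sp .X)), Above (nrm x) (f.map M) →
        Above (nrm (f.map y' - opT x)) (f.map s') → False := by
  obtain ⟨u, hu⟩ := exists_dense (w := w)
  let Γ : Ctx := [seq (.sp .X), .sp .Y, .rat, .rat]
  let e : Env w.D Γ := Env.cons u (Env.cons y (Env.cons s (Env.cons M Env.nil)))
  -- The variables are $j,i,k$: the centre $Tu_i$, the radius $1/(k+1)$ and a candidate $u_j$. Since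
  -- reals can only be compared approximately, the alternatives overlap: norms are tested against
  -- `M` and $M+1$, distances against $1/(k+1)$ and $2/(k+1)$.
  let A₁ : Fm (.nat :: .nat :: .nat :: Γ) :=
    lt (norm .X (nth (.sp .X) (.var (.s (.s (.s .z)))) (.var .z)))
      (ratR (addQ (.var (.s (.s (.s (.s (.s (.s .z))))))) oneQ)) ⩓
    lt (dist .Y (T (nth (.sp .X) (.var (.s (.s (.s .z)))) (.var (.s .z))))
      (T (nth (.sp .X) (.var (.s (.s (.s .z)))) (.var .z))))
      (ratR (addQ (rcp (.var (.s (.s .z)))) (rcp (.var (.s (.s .z))))))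
  let B₁ : Fm (.nat :: .nat :: .nat :: Γ) :=
    lt (ratR (.var (.s (.s (.s (.s (.s (.s .z))))))))
      (norm .X (nth (.sp .X) (.var (.s (.s (.s .z)))) (.var .z))) ⩔
    lt (ratR (rcp (.var (.s (.s .z)))))
      (dist .Y (T (nth (.sp .X) (.var (.s (.s (.s .z)))) (.var (.s .z))))
        (T (nth (.sp .X) (.var (.s (.s (.s .z)))) (.var .z))))
  let A₂ : Fm (.nat :: .nat :: Γ) :=
    lt (dist .Y (T (nth (.sp .X) (.var (.s (.s .z))) (.var .z))) (.var (.s (.s (.s .z)))))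
      (ratR (subQ (.var (.s (.s (.s (.s .z))))) (rcp (.var (.s .z))))) ⩓ .all .nat B₁
  let B₂ : Fm (.nat :: .nat :: Γ) :=
    lt (ratR (subQ (.var (.s (.s (.s (.s .z))))) (addQ (rcp (.var (.s .z))) (rcp (.var (.s .z))))))
      (dist .Y (T (nth (.sp .X) (.var (.s (.s .z))) (.var .z))) (.var (.s (.s (.s .z))))) ⩔
      .ex .nat A₁
  have h₁ : ∀ (w' : World) (f : w.Hom w') (k i : w'.D .nat),
      (∃ j, w'.sat A₁ (Env.cons j (Env.cons i (Env.cons k (f.env e))))) ∨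
        w'.sat (.all .nat B₁) (Env.cons i (Env.cons k (f.env e))) := by
    intro w' f k i
    have := f.model
    refine (hs.map f).omniscience (f.map_pos_iff.2 hρ) A₁ B₁ _ fun w'' g j => ?_
    simp [A₁, B₁, e]
    have hk := inv1_pos (g.map k)
    rcases below_or_above (nrm (w''.app (g.map (f.map u)) j))
      (lt_add_one (g.map (f.map M))) with h1 | h1
    · exact .inr (.inl h1)
    · rcases below_or_above (nrm (opT (w''.app (g.map (f.map u)) (g.map i)) -
        opT (w''.app (g.map (f.map u)) j))) (lt_add_of_pos_left (inv1 (g.map k)) hk) with h2 | h2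
      · exact .inr (.inr h2)
      · exact .inl ⟨h1, h2⟩
  have h₂ : ∀ (w' : World) (f : w.Hom w') (k : w'.D .nat),
      (∃ i, w'.sat A₂ (Env.cons i (Env.cons k (f.env e)))) ∨
        w'.sat (.all .nat B₂) (Env.cons k (f.env e)) := by
    intro w' f k
    have := f.model
    refine (hs.map f).omniscience (f.map_pos_iff.2 hρ) A₂ B₂ _ fun w'' g i => ?_
    have hk := inv1_pos (g.map k)
    rw [Hom.env_cons]
    rcases h₁ w'' (f.comp g) (g.map k) i with h1 | h1
    · right
      exact (sat_or _ _ _ _).2 (.inr ((sat_ex _ _ _).2 h1))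
    · rcases below_or_above (nrm (opT (w''.app (g.map (f.map u)) i) - g.map (f.map y)))
        (show g.map (f.map s) - (inv1 (g.map k) + inv1 (g.map k)) <
          g.map (f.map s) - inv1 (g.map k) by linarith) with h2 | h2
      · right
        refine (sat_or _ _ _ _).2 (.inl ?_)
        simpa [e] using h2
      · left
        refine (sat_and _ _ _ _).2 ⟨?_, h1⟩
        simpa [e] using h2
  -- Omniscience over $j$, then $i$, then $k$: either some ball about a $Tu_i$ inside the given one
  -- is avoided, or every eligible $Tu_i$ is approximated by images of points of norm less than
  -- $M+1$.
  have h₃ : (∃ k, w.sat (.ex .nat A₂) (Env.cons k e)) ∨ w.sat (.all .nat (.all .nat B₂)) e :=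
    hs.omniscience hρ _ _ _ fun w' f k => by
      rw [sat_ex]
      exact h₂ w' f k
  rcases h₃ with ⟨k, h₃⟩ | h₃
  · rw [sat_ex] at h₃
    obtain ⟨i, h₃⟩ := h₃
    rw [sat_and] at h₃
    refine ⟨opT (w.app u i), inv1 k, inv1_pos k, by simpa [e] using h₃.1, fun w' f x hx hx' => ?_⟩
    have := f.model
    obtain ⟨p, hp, hx⟩ := hx.exists_lt
    obtain ⟨p', hp', hx'⟩ := hx'.exists_lt
    -- Both inequalities for `x` are strict, so a nearby term of the dense sequence satisfies them
    -- too; but the terms of the sequence are excluded.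
    obtain ⟨j, hj, hj'⟩ := (hu.map f).exists_near x
      (show 0 < min (f.map M - p) (f.map (inv1 k) - p') from
        lt_min (sub_pos.2 hp) (sub_pos.2 hp'))
    have h4 := sat_all_elim (f.sat h₃.2) j
    simp [B₁, e] at h4
    rcases h4 with h4 | h4
    · have h5 := nrm_add (hj.mono (min_le_left _ _)) hx
      rw [sub_add_cancel, sub_add_cancel] at h5
      exact lt_irrefl _ (lt_of_below_above h4 h5)
    · rw [nrm_sub_rev] at hj'
      have h5 := nrm_triangle hx' (hj'.mono (min_le_right _ _))
      rw [add_sub_cancel, f.map_inv1, f.map_opT, f.map_app] at h5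
      exact lt_irrefl _ (lt_of_below_above h4 h5)
  · exfalso
    refine hs.not_dense hρ y hs0 (M := M + 1) (by positivity) fun w' f z q hq hz => ?_
    have := f.model
    obtain ⟨x, rfl⟩ := exists_opT_eq z
    obtain ⟨p, hp, hz⟩ := hz.exists_lt
    -- Error budget: $Tu_i$ is within $t/2$ of $z$ and $2/(k+1)<t/2$. The bound $t\le s-p$ keeps
    -- $Tu_i$ well inside the ball, and $t\le q$ gives the required accuracy.
    obtain ⟨t, ht, htq, htp⟩ : ∃ t > 0, t ≤ q ∧ t ≤ f.map s - p :=
      ⟨min q (f.map s - p), lt_min hq (sub_pos.2 hp), min_le_left _ _, min_le_right _ _⟩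
    obtain ⟨k, hk⟩ := exists_inv1_lt (show 0 < t / 4 by linarith)
    obtain ⟨i, -, hi⟩ := (hu.map f).exists_near x (half_pos ht)
    have h4 := sat_all_elim (sat_all_elim (f.sat h₃) k) i
    simp [B₂, A₁, e, sat_ex] at h4
    rcases h4 with h4 | ⟨j, h4, h5⟩
    · have := lt_of_below_above h4 (nrm_triangle hi hz)
      linarith
    · refine ⟨_, by simpa using h4, ?_⟩
      rw [nrm_sub_rev] at h5
      exact (nrm_triangle h5 hi).mono (by linarith)

/-- Baire's argument: choose nested balls with radii tending to $0$, the one with index $n+1$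
missing the image of the ball of radius $n+1$. The common point of these balls has a preimage, which
lies in one of the balls of $X$. -/
theorem not_smallFar [w.Model] {ρ : w.D .rat} (hρ : 0 < ρ) : ¬ SmallFar ρ := by
  intro hs
  obtain ⟨F, -, hF⟩ := World.choice (w := w) (a := .prod (.sp .Y) .rat) (Γ := [])
    (ltQ zeroQ (sndT _ _ (.var .z)) ⩓ leQ (sndT _ _ (.var .z)) (rcp (.var (.s .z))))
    (lt (dist .Y (fstT _ _ (.var .z)) (fstT _ _ (.var (.s .z))))
      (ratR (subQ (sndT _ _ (.var (.s .z))) (sndT _ _ (.var .z)))) ⩓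
      .all (.sp .X) (lt (norm .X (.var .z)) (ratR (natQ (succ (.var (.s (.s (.s .z))))))) ⇒
        lt (dist .Y (fstT _ _ (.var (.s .z))) (T (.var .z))) (ratR (sndT _ _ (.var (.s .z)))) ⇒
        .bot)) Env.nil (fun w' f n p hp => by
      have := f.model
      simp [sat_all_iff, sat_imp_iff] at hp ⊢
      -- The minimum serves two purposes: the new ball lies in the old one, and its radius is at
      -- most $1/(n+2)$.
      obtain ⟨y, s, hs1, hs2, hs3⟩ := (hs.map f).exists_ball (f.map_pos_iff.2 hρ) (pr₁ p)
        (s := min (pr₂ p) (inv1 (nsucc n))) (M := ncast (nsucc n)) (lt_min hp.1 (inv1_pos _))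
        (by
          rw [ncast_nsucc]
          linarith [ncast_nonneg n])
      have hs4 := pos_of_nrm hs2
      refine ⟨pr y s, ⟨by simpa using hs1, ?_⟩, ?_, fun w₁ f₁ x w₂ f₂ h1 w₃ f₃ h2 => ?_⟩
      · rw [pr₂_pr]
        linarith [min_le_right (pr₂ p) (inv1 (nsucc n))]
      · rw [pr₁_pr, pr₂_pr]
        exact hs2.mono (by linarith [min_le_left (pr₂ p) (inv1 (nsucc n))])
      · refine hs3 w₃ ((f₁.comp f₂).comp f₃) (f₃.map (f₂.map x)) ?_ ?_
        · simpa using h1.map f₃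
        · have h3 := congrArg (f₁.comp (f₂.comp f₃)).map (pr₁_pr y s)
          have h4 := congrArg (f₁.comp (f₂.comp f₃)).map (pr₂_pr y s)
          simp only [Hom.map_pr₁, Hom.map_pr₂, Hom.map_comp] at h3 h4
          simpa [h3, h4] using h2)
    (pr 0 (inv1 (nzero w))) (by simpa using inv1_pos _)
  simp [sat_all_iff, sat_imp_iff] at hF
  obtain ⟨Y, hY⟩ := exists_fn (Env.cons F Env.nil)
    (fstT (.sp .Y) .rat (nth _ (.var (.s .z)) (.var .z)))
  obtain ⟨S, hS⟩ := exists_fn (Env.cons F Env.nil)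
    (sndT (.sp .Y) .rat (nth _ (.var (.s .z)) (.var .z)))
  simp at hY hS
  obtain ⟨y, -, hy⟩ := exists_limit Y S (fun w' f n => by
    rw [hY, hY, hS, hS]
    exact (hF w' f n).2.1) (fun w' f n => by
    rw [hS]
    exact (hF w' f n).1.1.le) (fun w' f n => by
    rw [hS]
    exact (hF w' f n).1.2)
  obtain ⟨u, rfl⟩ := exists_opT_eq y
  obtain ⟨c, -, hu⟩ := exists_above (nrm u)
  obtain ⟨n, hn⟩ := exists_ncast_gt c
  -- The ball that misses the image of the ball of radius $n+1$ is the one with index $n+1$.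
  have h1 := hy w (.id w) (nsucc n)
  rw [hY, hS] at h1
  exact (hF w (.id w) n).2.2 w (.id w) u w (.id w) (hu.mono (by
    change c ≤ ncast n + 1
    linarith)) w (.id w) h1

end BISH
end

section
namespace BISH
open World

variable {w w' : World} {Γ : Ctx}

/-! ## Distances to the kernel -/

/-- `d` is the distance of `x` to the kernel. -/
def IsDist (x : w.D (.sp .X)) (d : w.D .real) : Prop :=
  (∀ (w' : World) (f : w.Hom w') (z : w'.D (.sp .X)), opT z = 0 → rle (f.map d)
    (nrm (f.map x - z))) ∧
  ∀ (w' : World) (f : w.Hom w') (q : w'.D .rat), Above (f.map d) q →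
    ∃ z, opT z = 0 ∧ Above (nrm (f.map x - z)) q

theorem World.sat_isInf {b : Ty} {P : ∀ Δ : Ctx, Tm Δ b → Tm Δ .real → Fm Δ}
    {Q : ∀ w : World, w.D b → w.D .real → Prop}
    (hP : ∀ (w : World) (Δ : Ctx) (p : Tm Δ b) (s : Tm Δ .real) (e : Env w.D Δ),
      w.sat (P Δ p s) e ↔ Q w (p.eval w.toInterp e) (s.eval w.toInterp e))
    {p : Tm Γ b} {d : Tm Γ .real} {e : Env w.D Γ} : w.sat (isInf P p d) e ↔
      (∀ (w' : World) (f : w.Hom w') (s : w'.D .real), Q w' (f.map (p.eval w.toInterp e)) s →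
        rle (f.map (d.eval w.toInterp e)) s) ∧
      ∀ (w' : World) (f : w.Hom w') (q : w'.D .rat), Above (f.map (d.eval w.toInterp e)) q →
        ∃ s, Q w' (f.map (p.eval w.toInterp e)) s ∧ Above s q := by
  simp only [isInf, sat_and, sat_All, sat_imp_iff, hP, sat_le, sat_lt, sat_Ex, Hom.env_cons,
    Tm.eval_wk, Hom.eval_env, Tm.eval_var, Env.cons_z]
  refine and_congr ⟨fun h w' f s => h w' f s w' (.id w'),
    fun h w' f s w'' g => h w'' (f.comp g) (g.map s)⟩ ⟨fun h w' f q hq => ?_,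
    fun h w' f r w'' g hr => ?_⟩
  · have := h w' f (ofRat q) w' (.id w') (by simpa using hq)
    simpa using this
  · obtain ⟨q, hq, hr⟩ := hr
    obtain ⟨s, hs, h2⟩ := h w'' (f.comp g) q hq
    exact ⟨s, hs, q, h2, hr⟩

@[simp] theorem World.sat_isDistToKer {x : Tm Γ (.sp .X)} {d : Tm Γ .real} {e : Env w.D Γ} :
    w.sat (isDistToKer x d) e ↔ IsDist (x.eval w.toInterp e) (d.eval w.toInterp e) := by
  rw [isDistToKer, sat_isInf (Q := fun w x s => ∃ z : w.D (.sp .X), opT z = 0 ∧ s = nrm (x - z))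
    (fun w Δ p s e => by simp [isDistToKerPoint])]
  refine and_congr ⟨fun h w' f z hz => h w' f _ ⟨z, hz, rfl⟩, ?_⟩
    ⟨fun h w' f q hq => ?_, fun h w' f q hq => ?_⟩
  · rintro h w' f _ ⟨z, hz, rfl⟩
    exact h w' f z hz
  · obtain ⟨_, ⟨z, hz, rfl⟩, h1⟩ := h w' f q hq
    exact ⟨z, hz, h1⟩
  · obtain ⟨z, hz, h1⟩ := h w' f q hq
    exact ⟨_, ⟨z, hz, rfl⟩, h1⟩

theorem exists_isDist [h : w.Model] (x : w.D (.sp .X)) : ∃ d, IsDist x d := by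
  simpa using sat_all_elim h.located x

/-- Trades a real distance for a rational lower bound; the arguments about far points need no more
than that. -/
theorem IsDist.far {x : w.D (.sp .X)} {d : w.D .real} {ρ : w.D .rat} (h : IsDist x d)
    (hd : Below d ρ) : Far x ρ := fun w' f z hz h' =>
  lt_irrefl _ (lt_of_below_above (hd.map f) ((h.1 w' f z hz).above h'))

theorem World.sat_infFar {r d : Tm Γ .real} {e : Env w.D Γ} :
    w.sat (isInf isNormFarFromKer r d) e ↔
      (∀ (w' : World) (f : w.Hom w') (x : w'.D (.sp .X)) (d' : w'.D .real), IsDist x d' →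
        rle (f.map (r.eval w.toInterp e)) d' → rle (f.map (d.eval w.toInterp e)) (nrm (opT x))) ∧
      ∀ (w' : World) (f : w.Hom w') (q : w'.D .rat), Above (f.map (d.eval w.toInterp e)) q →
        ∃ x d', IsDist x d' ∧ rle (f.map (r.eval w.toInterp e)) d' ∧ Above (nrm (opT x)) q := by
  rw [sat_isInf (Q := fun w r s => ∃ x : w.D (.sp .X), (∃ d, IsDist x d ∧ rle r d) ∧
    s = nrm (opT x)) (fun w Δ p s e => by simp [isNormFarFromKer])]
  refine and_congr ⟨fun h w' f x d hx hd => h w' f _ ⟨x, ⟨d, hx, hd⟩, rfl⟩, ?_⟩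
    ⟨fun h w' f q hq => ?_, fun h w' f q hq => ?_⟩
  · rintro h w' f _ ⟨x, ⟨d, hx, hd⟩, rfl⟩
    exact h w' f x d hx hd
  · obtain ⟨_, ⟨x, ⟨d, hx, hd⟩, rfl⟩, h1⟩ := h w' f q hq
    exact ⟨x, d, hx, hd, h1⟩
  · obtain ⟨x, d, hx, hd, h1⟩ := h w' f q hq
    exact ⟨_, ⟨x, ⟨d, hx, hd⟩, rfl⟩, h1⟩

/-- The infimum of the norms of the images of points far from the kernel is positive. -/
theorem inf_pos [w.Model] {r d : w.D .real} {ρ : w.D .rat} (hρ : 0 < ρ) (hr : Below r ρ)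
    (h : ∀ (w' : World) (f : w.Hom w') (q : w'.D .rat), Above (f.map d) q →
      ∃ (x : w'.D (.sp .X)) (d' : w'.D .real), IsDist x d' ∧ rle (f.map r) d' ∧
        Above (nrm (opT x)) q) : Below d 0 := by
  have hfar : ∀ (w' : World) (f : w.Hom w') (q : w'.D .rat), Above (f.map d) q →
      ∃ x : w'.D (.sp .X), Far x (f.map ρ) ∧ Above (nrm (opT x)) q := fun w' f q hq => by
    obtain ⟨x, d', h1, h2, h3⟩ := h w' f q hq
    exact ⟨x, h1.far (h2.below (hr.map f)), h3⟩
  -- The first alternative does not depend on `n` and is the claim itself. The second is chosen so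
  -- that the infimum property supplies exactly the small images required by `dichotomy`.
  have h1 := dichotomy (Γ := [.real]) (lt zeroR (.var (.s .z))) (lt (.var (.s .z))
    (ratR (mulQ (subQ (rcp (.var .z)) (rcp (succ (.var .z)))) (rcp (.var .z)))))
    (Env.cons d Env.nil) hρ (fun w' f n => by
      simpa using below_or_above (f.map d) (mul_pos (inv1_sub_pos n) (inv1_pos n)))
    (fun w' f n hn => hfar w' f _ (by simpa using hn))
  rcases h1 with ⟨n, h1⟩ | h1
  · simpa using h1
  -- If the infimum is below every tolerance, it is below every positive rational, because the
  -- tolerances are at most $1/(n+1)$.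
  · refine absurd (fun w' f q hq => hfar w' f q ?_) (not_smallFar hρ)
    obtain ⟨n, hn⟩ := exists_inv1_lt hq
    have h2 : Above (f.map d) ((inv1 n - inv1 (nsucc n)) * inv1 n) := by simpa using h1 w' f n
    refine h2.mono (le_trans ?_ hn.le)
    refine mul_le_of_le_one_left (inv1_pos n).le ?_
    linarith [inv1_pos (nsucc n), inv1_le_one n]

/-- By cotransitivity the distance of `x` to the kernel is less than `q`, as desired, or more than
$q/2$. In the latter case, with $t=q/(2R)$, the point $t^{-1}x$ has distance at least $r$, since
$r<R$ and $tR=q/2$; then its image has norm at least $d>c$, against the bound on $\|Tx\|$. -/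
theorem stable [w.Model] {r d : w.D .real} {c R : w.D .rat} (hd : Below d c)
    (hR : 0 < R) (hr : Above r R)
    (h : ∀ (x : w.D (.sp .X)) (d' : w.D .real), IsDist x d' → rle r d' → rle d (nrm (opT x)))
    {q : w.D .rat} (hq : 0 < q) {x : w.D (.sp .X)} (hx : Above (nrm (opT x)) (c * (q / (R + R)))) :
    ∃ z, opT z = 0 ∧ Above (nrm (x - z)) q := by
  obtain ⟨d₁, hd₁⟩ := exists_isDist x
  rcases below_or_above d₁ (half_lt_self hq) with h1 | h1
  swap
  · exact hd₁.2 w (.id w) q h1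
  exfalso
  have ht : 0 < q / (R + R) := by positivity
  set t := q / (R + R) with ht_def
  obtain ⟨d₂, hd₂⟩ := exists_isDist (t⁻¹ • x)
  have h2 := h _ _ hd₂ fun w' f p hp hp' => by
    have := f.model
    obtain ⟨z, hz, h3⟩ := hd₂.2 w' f p hp
    have ht' := f.map_pos_iff.2 ht
    refine hd₁.far h1 w' f (f.map t • z) (by rw [opT_smul, hz, smul_zero]) ?_
    have h4 := (above_nrm_smul ht').2 h3
    rw [smul_sub, f.map_qsmul, f.map_invQ, smul_inv_smul₀ ht'.ne'] at h4
    refine h4.mono ?_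
    have h5 := lt_of_below_above hp' (hr.map f)
    have h6 : f.map (q / 2) = f.map t * f.map R := by
      rw [← f.map_mulQ, ht_def]
      congr 1
      field_simp
      ring
    rw [h6]
    exact mul_le_mul_of_nonneg_left h5.le ht'.le
  have h3 : Above (nrm (opT (t⁻¹ • x))) c := by
    rw [opT_smul, above_nrm_smul' (by positivity), div_inv_eq_mul]
    exact hx
  exact lt_irrefl _ (lt_of_below_above hd (h2.above h3))

theorem sat_isUniformlyZStable [h : w.Model] (hinf : w.sat infExists Env.nil) :
    w.sat isUniformlyZStable Env.nil := by
  simp only [infExists, sat_Ex, sat_and, sat_lt, eval_zeroR, Tm.eval_var, Env.cons_z, ofRat_rlt,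
    sat_infFar, Tm.eval_wk] at hinf
  obtain ⟨r, hr, d, hd₁, hd₂⟩ := hinf
  -- Rational bounds $0<\rho<r<R$: the lower one makes points at distance at least $r$ far in the
  -- rational sense, and the upper one serves for scaling.
  obtain ⟨ρ, hρ, hrρ⟩ := hr.exists_gt
  obtain ⟨R, hR, hrR⟩ := exists_above r
  obtain ⟨c, hc, hdc⟩ := (inf_pos hρ hrρ hd₂).exists_gt
  simp only [isUniformlyZStable, sat_All, sat_imp_iff, sat_lt, eval_zeroR, Tm.eval_var, Env.cons_z,
    ofRat_rlt, Hom.env_cons, sat_Ex, sat_and, Hom.env_nil, eval_norm, eval_T, sat_inKer,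
    eval_dist, Tm.eval_wk]
  intro w₁ f₁ r' w₂ f₂ hr'
  obtain ⟨q, hq, hr'⟩ := hr'.exists_gt
  have hc₂ := (f₁.comp f₂).map_pos_iff.2 hc
  have hR₂ := (f₁.comp f₂).map_pos_iff.2 hR
  -- The modulus is $cq/(2R)$, where $0<c<\delta_r$ and $q$ is a positive rational below the given
  -- tolerance.
  refine ⟨ofRat ((f₁.comp f₂).map c * (q / ((f₁.comp f₂).map R + (f₁.comp f₂).map R))),
    below_ofRat.2 (by positivity), fun w₃ f₃ x w₄ f₄ hx => ?_⟩
  let f := ((f₁.comp f₂).comp f₃).comp f₄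
  have := f.model
  obtain ⟨z, hz, hz'⟩ := stable (hdc.map f) (f.map_pos_iff.2 hR) (hrR.map f)
    (fun x d' => hd₁ w₄ f x d') ((f₃.comp f₄).map_pos_iff.2 hq) (x := f₄.map x)
    (by simpa [f] using hx)
  exact ⟨z, hz, _, hz', (hr'.map f₃).map f₄⟩

end BISH
end

theorem mainTheorem1 :
    BISH.Deriv (Γ := [])
      [BISH.isBanach .X, BISH.isSeparable .X, BISH.isBanach .Y,
        BISH.isLinear, BISH.isNonzero, BISH.isSeqContinuous, BISH.isOnto,
        BISH.kerLocated, BISH.infExists]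
      BISH.isUniformlyZStable := by
  refine BISH.deriv_of_forall_sat fun w e h => ?_
  obtain rfl : e = BISH.Env.nil := BISH.Env.nil_eq e
  simp only [List.mem_cons, List.not_mem_nil, or_false, forall_eq_or_imp, forall_eq] at h
  obtain ⟨hX, hsep, hY, hlin, -, hcont, honto, hloc, hinf⟩ := h
  have : w.Model := ⟨⟨hX⟩, ⟨hY⟩, hsep, hlin, hcont, honto, hloc⟩
  exact BISH.sat_isUniformlyZStable hinf
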